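/- Let $p,q\ge 3$ be integers and let $M$ be a finite connected orientable map of type $\{p,q\}$ and girth $p$, that is, a finite graph embedded in a closed oriented surface such that every vertex has degree $q$, every complementary face is a disk with $p$ sides, and every embedded cycle of the graph has length at least $p$ (loops and pairs of parallel edges count as cycles of length $1$ and $2$). For $t>0$ let $P(t,q)$ be the right-angled hyperbolic $2q$-gon with rotational symmetry of order $q$ whose sides alternate between \emph{blue} sides of length $t$ and \emph{red} sides of length $s(t)$, where $\sinh(t/2)\sinh(s(t)/2)=\cos(\pi/q)$. Take one copy $P_v$ of $P(t,q)$ for each vertex $v$ of $M$, associate its blue sides to the edges at $v$ respecting the cyclic order of these edges, and for every edge $\{v,w\}$ glue $P_v$ and $P_w$ along the corresponding blue sides, respecting orientations; this gives a hyperbolic surface $B(t,M)$ with geodesic boundary made of the red sides. Let $X(t,M)$ be the closed hyperbolic surface obtained by doubling $B(t,M)$ across its boundary. The \emph{blue curves} of $X(t,M)$, one for each edge of $M$, are the unions of the two copies of a blue side; the \emph{red curves}, one for each face of $M$, are the unions of the $p$ red sides along a boundary component of $B(t,M)$. A \emph{systole} is a closed geodesic of minimal length. Let $t_0>0$ satisfy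 $2t_0=p\,s(t_0)$ and let $X(M)=X(t_0,M)$. Then the systoles of $X(M)$ are precisely the blue curves and the red curves, and they have length $2t_0$. Moreover they fill: every connected component of the complement of their union is contractible. -/

import Mathlib

open scoped UpperHalfPlane MatrixGroups

/-- A finite connected orientable surface map, given by its rotation system: `D` is the set of
darts (oriented edges), `rot` sends a dart to the next dart, counterclockwise, with the same
initial vertex, and `rev` reverses a dart. Vertices are the cycles of `rot`, edges the cycles of
`rev`, and faces the cycles of `rev * rot`. -/
structure SurfaceMap (D : Type*) where
  rot : Equiv.Perm D
  rev : Equiv.Perm D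
  rev_rev : ∀ d, rev (rev d) = d
  rev_ne : ∀ d, rev d ≠ d
  connected : MulAction.IsPretransitive (Subgroup.closure {rot, rev}) D

namespace SurfaceMap

variable {D : Type*}

/-- Every vertex has degree `q` and every face has `p` sides. -/
def HasType (M : SurfaceMap D) (p q : ℕ) : Prop :=
  (∀ d, Function.minimalPeriod M.rot d = q) ∧
    ∀ d, Function.minimalPeriod (M.rev * M.rot : Equiv.Perm D) d = p

/-- The two darts have the same initial vertex. -/
def SameVertex (M : SurfaceMap D) (d e : D) : Prop := M.rot.SameCycle d e

/-- The darts `c 0, …, c (n - 1)` form an embedded cycle of length `n` in the underlying graph: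
consecutive, with distinct vertices and distinct edges. Loops are the cycles of length one, and
pairs of parallel edges those of length two. -/
structure IsEmbeddedCycle (M : SurfaceMap D) (n : ℕ) (c : ZMod n → D) : Prop where
  pos : 0 < n
  consecutive : ∀ i, M.SameVertex (M.rev (c i)) (c (i + 1))
  vertices_distinct : ∀ i j, M.SameVertex (c i) (c j) → i = j
  edges_distinct : ∀ i j, c i ≠ M.rev (c j)

/-- Every embedded cycle has length at least `p`. When all faces have `p` sides, the girth is then
equal to `p`. -/
def GirthAtLeast (M : SurfaceMap D) (p : ℕ) : Prop :=
  ∀ n (c : ZMod n → D), M.IsEmbeddedCycle n c → p ≤ n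

end SurfaceMap

noncomputable section

namespace RightAngled

/-- The counterclockwise rotation of angle `θ` about the point `i` of the upper half-plane. -/
def rotation (θ : ℝ) : SL(2, ℝ) :=
  ⟨!![Real.cos (θ / 2), Real.sin (θ / 2); -Real.sin (θ / 2), Real.cos (θ / 2)], by
    rw [Matrix.det_fin_two_of]
    nlinarith [Real.sin_sq_add_cos_sq (θ / 2)]⟩

/-- The unit speed geodesic orthogonal to the ray from `i` to `∞` at distance `a` from `i`, which it
meets at time `0`. Its image is the half-circle `|z| = exp a`. -/
def perp (a u : ℝ) : ℍ :=
  ⟨⟨-(Real.exp a * Real.tanh u), Real.exp a / Real.cosh u⟩,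
    div_pos (Real.exp_pos a) (Real.cosh_pos u)⟩

/-- The length of the red sides: `cos (π / q) = sinh (t / 2) * sinh (s / 2)`. -/
def s (q : ℕ) (t : ℝ) : ℝ :=
  2 * Real.arsinh (Real.cos (Real.pi / q) / Real.sinh (t / 2))

/-- The distance from the centre to a side of length `ℓ` of a right-angled semi-regular `2 q`-gon,
in which every second side has length `ℓ`. -/
def apothem (q : ℕ) (ℓ : ℝ) : ℝ :=
  Real.arsinh (Real.cot (Real.pi / q) / Real.tanh (ℓ / 2))

/-- The polygon `P(t, q)`, centred at `i`: the right-angled `2 q`-gon cut out by the geodesics that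
carry the blue sides (of length `t`, in the directions `2 π k / q` from the centre) and the red
sides (of length `s(t)`, in the directions `(2 k + 1) π / q`). Directions are measured
counterclockwise from the vertical ray. -/
def polygon (q : ℕ) (t : ℝ) : Set ℍ :=
  {z | ∀ k : ℤ,
    ‖(((rotation (2 * k * Real.pi / q))⁻¹ • z : ℍ) : ℂ)‖ ≤ Real.exp (apothem q t) ∧
    ‖(((rotation ((2 * k + 1) * Real.pi / q))⁻¹ • z : ℍ) : ℂ)‖ ≤ Real.exp (apothem q (s q t))}

/-- The blue side in direction `0`, for `|u| ≤ t / 2`, by arc length and counterclockwise. -/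
def blueSide (q : ℕ) (t u : ℝ) : ℍ := perp (apothem q t) u

/-- The red side that follows `blueSide` counterclockwise, in direction `π / q`, for
`|u| ≤ s(t) / 2`, by arc length and counterclockwise. -/
def redSide (q : ℕ) (t u : ℝ) : ℍ := rotation (Real.pi / q) • perp (apothem q (s q t)) u

variable {D : Type*}

/-- The disjoint union of the polygons before gluing. A point `⟨(d, b), z⟩` is the point `z` of the
polygon of the initial vertex of `d`, in the copy number `b` of `B(t, M)`, in the position where
`blueSide` is the side associated to `d`. -/
abbrev Pieces (D : Type*) (q : ℕ) (t : ℝ) : Type _ := Σ _ : D × Bool, polygon q t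

/-- The identifications that define the surface.
* `turn`: positions of the same polygon for the different darts at a vertex (the blue side of
  `rot d` is the next one, counterclockwise, after the one of `d`);
* `blue`: the sides of `d` and of `rev d` are glued, respecting the orientations;
* `red`: the two copies are glued by the identity along the red sides. -/
inductive Glue (M : SurfaceMap D) (q : ℕ) (t : ℝ) : Pieces D q t → Pieces D q t → Prop
  | turn (d : D) (b : Bool) (z w : polygon q t)
      (h : (w : ℍ) = rotation (2 * Real.pi / q) • (z : ℍ)) :
      Glue M q t ⟨(M.rot d, b), z⟩ ⟨(d, b), w⟩
  | blue (d : D) (b : Bool) (u : ℝ) (z w : polygon q t) (hu : |u| ≤ t / 2)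
      (hz : (z : ℍ) = blueSide q t u) (hw : (w : ℍ) = blueSide q t (-u)) :
      Glue M q t ⟨(d, b), z⟩ ⟨(M.rev d, b), w⟩
  | red (d : D) (u : ℝ) (z : polygon q t) (hu : |u| ≤ s q t / 2)
      (hz : (z : ℍ) = redSide q t u) :
      Glue M q t ⟨(d, false), z⟩ ⟨(d, true), z⟩

/-- The closed surface `X(t, M)`, with the quotient topology. -/
abbrev X (M : SurfaceMap D) (q : ℕ) (t : ℝ) : Type _ := Quot (Glue M q t)

/-- The image in the surface of a point of one of the polygons. -/
def X.mk (M : SurfaceMap D) (q : ℕ) (t : ℝ) (d : D) (b : Bool) (z : polygon q t) : X M q t :=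
  Quot.mk _ ⟨(d, b), z⟩

variable (M : SurfaceMap D) (q : ℕ) (t : ℝ)

/-- The local coordinates of the hyperbolic structure on `X(t, M)`: homeomorphisms between open
subsets of the surface and of the hyperbolic plane, which are isometric on every polygon. -/
def IsHyperbolicChart (φ : OpenPartialHomeomorph (X M q t) ℍ) : Prop :=
  ∀ d b, ∃ g : ℍ ≃ᵢ ℍ, ∀ z : polygon q t,
    X.mk M q t d b z ∈ φ.source → φ (X.mk M q t d b z) = g z

/-- Unit speed geodesics of the hyperbolic surface `X(t, M)`. -/
def IsGeodesic (γ : ℝ → X M q t) : Prop :=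
  ∀ r : ℝ, ∃ φ : OpenPartialHomeomorph (X M q t) ℍ, IsHyperbolicChart M q t φ ∧
    ∃ ε > 0, ∀ a ∈ Set.Ioo (r - ε) (r + ε), ∀ b ∈ Set.Ioo (r - ε) (r + ε),
      γ a ∈ φ.source ∧ γ b ∈ φ.source ∧ dist (φ (γ a)) (φ (γ b)) = |a - b|

/-- `γ`, restricted to a period `L`, is a closed geodesic of length `L`. -/
def IsClosedGeodesic (L : ℝ) (γ : ℝ → X M q t) : Prop :=
  0 < L ∧ Function.Periodic γ L ∧ IsGeodesic M q t γ

/-- `γ` is a systole: a closed geodesic of minimal length `L`. -/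
def IsSystole (L : ℝ) (γ : ℝ → X M q t) : Prop :=
  IsClosedGeodesic M q t L γ ∧ ∀ L' γ', IsClosedGeodesic M q t L' γ' → L ≤ L'

/-- The systoles, as subsets of the surface. -/
def systoles : Set (Set (X M q t)) :=
  {C | ∃ L γ, IsSystole M q t L γ ∧ Set.range γ = C}

/-- The blue curve of the edge of `d`: the union of the two copies of its blue side. -/
def blueCurve (d : D) : Set (X M q t) :=
  {x | ∃ (b : Bool) (u : ℝ) (z : polygon q t), |u| ≤ t / 2 ∧ (z : ℍ) = blueSide q t u ∧
    x = X.mk M q t d b z}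

/-- The red curve of the face of `d`: the union of the red sides along this face. -/
def redCurve (d : D) : Set (X M q t) :=
  {x | ∃ (e : D) (b : Bool) (u : ℝ) (z : polygon q t), (M.rev * M.rot).SameCycle d e ∧
    |u| ≤ s q t / 2 ∧ (z : ℍ) = redSide q t u ∧ x = X.mk M q t e b z}

/-- A set of curves fills if every component of the complement of their union is contractible. -/
def Fills {Y : Type*} [TopologicalSpace Y] (𝒞 : Set (Set Y)) : Prop :=
  ∀ x ∈ (⋃₀ 𝒞)ᶜ, ContractibleSpace (connectedComponentIn (⋃₀ 𝒞)ᶜ x)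

end RightAngled

end

/-! A closed geodesic is cut by the blue curves into arcs, each contained in the double of one
polygon across its red sides. Folding the two copies onto each other turns an arc into a path in
P(t, q) that moves at most at unit speed, so lengths are bounded below by distances between sides of
a single polygon. By trigonometry, distinct blue sides are at distance at least s(t) and distinct
red sides at distance at least t, with equality only between the two ends of a side of the other
colour (`SideRelations.le_dist`).

A closed geodesic that stays in one doubled polygon meets two different red sides by a convexity
argument, so it has length at least 2t; in case of equality it is a blue curve
(`IsClosedGeodesic.of_star`). Otherwise its successive transverse crossings with the blue curves
describe a closed walk in M (`IsClosedGeodesic.exists_exits`). An arc between different blue sides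
has length at least s(t) (`IsGeodesic.arc_blue`). An arc that comes back to the blue side where it
started has length greater than t, because it must touch a red side that is not adjacent to this
blue side (`IsGeodesic.arc_backtrack`). Two backtracks therefore cost more than 2t. With at most one
backtrack the walk contains an embedded cycle and has at least p steps by the girth hypothesis
(`le_length_of_backtrack`). Each step has length at least s(t), because s(t) < t, and p s(t) = 2t.
Equality forces an arc to be a red side, and unique continuation makes the geodesic a red curve
(`IsClosedGeodesic.two_mul_le`).

Geodesics are defined through arbitrary charts that are isometric on the polygons, so explicit
charts are needed. The polygons have right angles, so four of them fit around a corner and are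
unfolded by two commuting reflections (`chartMap`); `IsGeodesic.exists_lift` moves any geodesic into
these charts. Computations use hyperboloid coordinates, where the symmetries are linear and linear
functions satisfy f(r + h) + f(r - h) = 2 cosh(h) f(r) along geodesics. The resulting maximum
principle supplies the convexity.

The complement of the curves consists of open polygons, which are star-shaped about their centres in
the space coordinates. -/

namespace RightAngled
noncomputable section

open Real

/-! ### Hyperboloid coordinates on the upper half-plane -/

/-- The time coordinate of the hyperboloid model. -/
def cT (z : ℍ) : ℝ := (1 + z.re ^ 2 + z.im ^ 2) / (2 * z.im)

/-- The space coordinate of the hyperboloid model in the vertical direction. -/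
def cX (z : ℍ) : ℝ := (z.re ^ 2 + z.im ^ 2 - 1) / (2 * z.im)

/-- The space coordinate of the hyperboloid model in the leftward direction. -/
def cY (z : ℍ) : ℝ := -z.re / z.im

lemma cT_sq (z : ℍ) : cT z ^ 2 = 1 + cX z ^ 2 + cY z ^ 2 := by
  have := z.im_ne_zero
  unfold cT cX cY
  field_simp
  ring

lemma cT_pos (z : ℍ) : 0 < cT z := by
  have := z.im_pos
  unfold cT
  positivity

/-- The hyperbolic cosine of the distance is the Minkowski product. Through this identity metric
statements become polynomial identities in the coordinates. -/
lemma cosh_dist_eq (z w : ℍ) :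
    cosh (dist z w) = cT z * cT w - cX z * cX w - cY z * cY w := by
  have h1 := z.im_ne_zero
  have h2 := w.im_ne_zero
  rw [UpperHalfPlane.cosh_dist, Complex.dist_eq, Complex.sq_norm, Complex.normSq_apply]
  simp only [Complex.sub_re, Complex.sub_im, UpperHalfPlane.coe_re, UpperHalfPlane.coe_im]
  unfold cT cX cY
  field_simp
  ring

lemma cT_sub_cX (z : ℍ) : cT z - cX z = 1 / z.im := by
  have h1 := z.im_ne_zero
  unfold cT cX
  field_simp
  ring

lemma ext_coords {z w : ℍ} (hX : cX z = cX w) (hY : cY z = cY w) : z = w := by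
  have hT : cT z = cT w := by
    have h1 := cT_sq z
    have h2 := cT_sq w
    rw [hX, hY, ← h2] at h1
    exact (pow_left_inj₀ (cT_pos z).le (cT_pos w).le two_ne_zero).1 h1
  have hi : z.im = w.im := by
    have h1 := cT_sub_cX z
    have h2 := cT_sub_cX w
    rw [hX, hT, h2] at h1
    simpa using h1.symm
  have hr : z.re = w.re := by
    unfold cY at hY
    rw [hi] at hY
    have := w.im_ne_zero
    field_simp at hY
    linarith
  exact UpperHalfPlane.ext (Complex.ext hr hi)

lemma sqrt_sub_pos (x y : ℝ) : 0 < √(1 + x ^ 2 + y ^ 2) - x := by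
  have : x < √(1 + x ^ 2 + y ^ 2) := by
    apply Real.lt_sqrt_of_sq_lt
    nlinarith [sq_nonneg y]
  linarith

/-- The point with given space coordinates. -/
def ofXY (x y : ℝ) : ℍ :=
  ⟨⟨-y / (√(1 + x ^ 2 + y ^ 2) - x), 1 / (√(1 + x ^ 2 + y ^ 2) - x)⟩,
    div_pos one_pos (sqrt_sub_pos x y)⟩

@[simp] lemma cX_ofXY (x y : ℝ) : cX (ofXY x y) = x := by
  have h := sqrt_sub_pos x y
  have h2 : √(1 + x ^ 2 + y ^ 2) ^ 2 = 1 + x ^ 2 + y ^ 2 := Real.sq_sqrt (by positivity)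
  show ((-y / (√(1 + x ^ 2 + y ^ 2) - x)) ^ 2 + (1 / (√(1 + x ^ 2 + y ^ 2) - x)) ^ 2 - 1) /
    (2 * (1 / (√(1 + x ^ 2 + y ^ 2) - x))) = x
  generalize √(1 + x ^ 2 + y ^ 2) = w at *
  have := h.ne'
  field_simp
  linear_combination -h2

@[simp] lemma cY_ofXY (x y : ℝ) : cY (ofXY x y) = y := by
  have h := sqrt_sub_pos x y
  show -(-y / (√(1 + x ^ 2 + y ^ 2) - x)) / (1 / (√(1 + x ^ 2 + y ^ 2) - x)) = y
  have := h.ne'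
  field_simp

lemma cT_ofXY {x y T : ℝ} (hT : 0 < T) (h : T ^ 2 = 1 + x ^ 2 + y ^ 2) : cT (ofXY x y) = T := by
  refine (pow_left_inj₀ (cT_pos _).le hT.le two_ne_zero).1 ?_
  rw [cT_sq, h]; simp

@[simp] lemma ofXY_coords (z : ℍ) : ofXY (cX z) (cY z) = z := ext_coords (by simp) (by simp)

lemma continuous_cX : Continuous cX := by
  unfold cX
  exact Continuous.div (by fun_prop) (by fun_prop) fun z => by
    simpa using z.im_ne_zero

lemma continuous_cY : Continuous cY := by
  unfold cY
  exact Continuous.div (by fun_prop) (by fun_prop) fun z => z.im_ne_zero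

lemma continuous_cT : Continuous cT := by
  unfold cT
  exact Continuous.div (by fun_prop) (by fun_prop) fun z => by
    simpa using z.im_ne_zero

lemma continuous_ofXY : Continuous fun p : ℝ × ℝ => ofXY p.1 p.2 := by
  rw [UpperHalfPlane.isEmbedding_coe.continuous_iff]
  have h : ∀ p : ℝ × ℝ, √(1 + p.1 ^ 2 + p.2 ^ 2) - p.1 ≠ 0 := fun p => (sqrt_sub_pos _ _).ne'
  have : (UpperHalfPlane.coe ∘ fun p : ℝ × ℝ => ofXY p.1 p.2) = fun p : ℝ × ℝ =>
      ((-p.2 / (√(1 + p.1 ^ 2 + p.2 ^ 2) - p.1) : ℝ) : ℂ) +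
      ((1 / (√(1 + p.1 ^ 2 + p.2 ^ 2) - p.1) : ℝ) : ℂ) * Complex.I := by
    funext p
    exact (Complex.mk_eq_add_mul_I _ _)
  rw [this]
  have h1 : Continuous fun p : ℝ × ℝ => -p.2 / (√(1 + p.1 ^ 2 + p.2 ^ 2) - p.1) :=
    Continuous.div (by fun_prop) (by fun_prop) h
  have h2 : Continuous fun p : ℝ × ℝ => 1 / (√(1 + p.1 ^ 2 + p.2 ^ 2) - p.1) :=
    Continuous.div (by fun_prop) (by fun_prop) h
  exact (Complex.continuous_ofReal.comp h1).add
    ((Complex.continuous_ofReal.comp h2).mul continuous_const)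

/-- The space coordinates form a homeomorphism onto the Euclidean plane. -/
def coordHomeo : ℍ ≃ₜ ℝ × ℝ where
  toFun z := (cX z, cY z)
  invFun p := ofXY p.1 p.2
  left_inv z := by simp
  right_inv p := by simp
  continuous_toFun := continuous_cX.prodMk continuous_cY
  continuous_invFun := continuous_ofXY

lemma cX_I : cX UpperHalfPlane.I = 0 := by simp [cX]
lemma cY_I : cY UpperHalfPlane.I = 0 := by simp [cY]
lemma cT_I : cT UpperHalfPlane.I = 1 := by simp [cT]

/-! ### Rotations and the standard perpendiculars -/

lemma rotation_smul_denom (θ : ℝ) (z : ℍ) :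
    0 < (Real.cos (θ / 2) - Real.sin (θ / 2) * z.re) ^ 2 + (Real.sin (θ / 2) * z.im) ^ 2 := by
  by_contra h
  have h1 : (Real.cos (θ / 2) - Real.sin (θ / 2) * z.re) ^ 2 = 0 := by
    nlinarith [sq_nonneg (Real.cos (θ / 2) - Real.sin (θ / 2) * z.re),
      sq_nonneg (Real.sin (θ / 2) * z.im)]
  have h2 : (Real.sin (θ / 2) * z.im) ^ 2 = 0 := by
    nlinarith [sq_nonneg (Real.cos (θ / 2) - Real.sin (θ / 2) * z.re),
      sq_nonneg (Real.sin (θ / 2) * z.im)]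
  have hs : Real.sin (θ / 2) = 0 := by
    rcases mul_eq_zero.1 (pow_eq_zero_iff two_ne_zero |>.1 h2) with h | h
    · exact h
    · exact absurd h z.im_ne_zero
  have hc : Real.cos (θ / 2) = 0 := by
    have := pow_eq_zero_iff two_ne_zero |>.1 h1
    rw [hs] at this; linarith
  have := Real.sin_sq_add_cos_sq (θ / 2)
  rw [hs, hc] at this; norm_num at this

lemma rotation_smul_coe (θ : ℝ) (z : ℍ) :
    ((rotation θ • z : ℍ) : ℂ) = ((Real.cos (θ / 2) : ℂ) * z + (Real.sin (θ / 2) : ℂ)) /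
      (-(Real.sin (θ / 2) : ℂ) * z + (Real.cos (θ / 2) : ℂ)) := by
  rw [UpperHalfPlane.coe_specialLinearGroup_apply]
  simp [rotation]

lemma rotation_smul_re (θ : ℝ) (z : ℍ) : (rotation θ • z : ℍ).re =
    ((Real.cos (θ / 2) * z.re + Real.sin (θ / 2)) * (Real.cos (θ / 2) - Real.sin (θ / 2) * z.re) -
      Real.cos (θ / 2) * Real.sin (θ / 2) * z.im ^ 2) /
    ((Real.cos (θ / 2) - Real.sin (θ / 2) * z.re) ^ 2 + (Real.sin (θ / 2) * z.im) ^ 2) := by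
  rw [← UpperHalfPlane.coe_re, rotation_smul_coe, Complex.div_re, Complex.normSq_apply]
  have := (rotation_smul_denom θ z).ne'
  simp only [Complex.add_re, Complex.add_im, Complex.mul_re, Complex.mul_im, Complex.neg_re,
    Complex.neg_im, Complex.ofReal_re, Complex.ofReal_im, UpperHalfPlane.coe_re,
    UpperHalfPlane.coe_im]
  rw [← add_div]
  congr 1 <;> ring

lemma rotation_smul_im (θ : ℝ) (z : ℍ) : (rotation θ • z : ℍ).im =
    z.im /
    ((Real.cos (θ / 2) - Real.sin (θ / 2) * z.re) ^ 2 + (Real.sin (θ / 2) * z.im) ^ 2) := by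
  rw [← UpperHalfPlane.coe_im, rotation_smul_coe, Complex.div_im, Complex.normSq_apply]
  simp only [Complex.add_re, Complex.add_im, Complex.mul_re, Complex.mul_im, Complex.neg_re,
    Complex.neg_im, Complex.ofReal_re, Complex.ofReal_im, UpperHalfPlane.coe_re,
    UpperHalfPlane.coe_im]
  rw [← sub_div]
  congr 1
  · linear_combination z.im * Real.sin_sq_add_cos_sq (θ / 2)
  · ring

lemma cos_eq_half (θ : ℝ) : Real.cos θ = Real.cos (θ / 2) ^ 2 - Real.sin (θ / 2) ^ 2 := by
  rw [← Real.cos_two_mul', mul_div_cancel₀ θ two_ne_zero]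

lemma sin_eq_half (θ : ℝ) : Real.sin θ = 2 * Real.sin (θ / 2) * Real.cos (θ / 2) := by
  rw [← Real.sin_two_mul, mul_div_cancel₀ θ two_ne_zero]

lemma cX_rotation (θ : ℝ) (z : ℍ) :
    cX (rotation θ • z) = cX z * Real.cos θ - cY z * Real.sin θ := by
  have h := (rotation_smul_denom θ z).ne'
  have hz := z.im_ne_zero
  unfold cX cY
  rw [rotation_smul_re, rotation_smul_im, cos_eq_half θ, sin_eq_half θ]
  have h1 := Real.sin_sq_add_cos_sq (θ / 2)
  generalize Real.cos (θ / 2) = c at *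
  generalize Real.sin (θ / 2) = s at *
  generalize z.re = x at *
  generalize z.im = y at *
  set E := (c - s * x) ^ 2 + (s * y) ^ 2 with hE
  have key : ((c * x + s) * (c - s * x) - c * s * y ^ 2) ^ 2 + y ^ 2 =
      ((c * x + s) ^ 2 + (c * y) ^ 2) * E := by
    rw [hE]
    linear_combination (-(y ^ 2) * (1 + (s ^ 2 + c ^ 2))) * h1
  rw [div_pow, div_pow, ← add_div, key, pow_two E, mul_div_mul_right _ _ h]
  field_simp
  rw [hE]; ring

lemma cY_rotation (θ : ℝ) (z : ℍ) :
    cY (rotation θ • z) = cX z * Real.sin θ + cY z * Real.cos θ := by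
  have h := (rotation_smul_denom θ z).ne'
  have hz := z.im_ne_zero
  unfold cX cY
  rw [rotation_smul_re, rotation_smul_im, cos_eq_half θ, sin_eq_half θ]
  set E := (Real.cos (θ / 2) - Real.sin (θ / 2) * z.re) ^ 2 + (Real.sin (θ / 2) * z.im) ^ 2
  field_simp
  ring

lemma cT_rotation (θ : ℝ) (z : ℍ) : cT (rotation θ • z) = cT z := by
  refine (pow_left_inj₀ (cT_pos _).le (cT_pos _).le two_ne_zero).1 ?_
  rw [cT_sq, cT_sq, cX_rotation, cY_rotation]
  linear_combination (cX z ^ 2 + cY z ^ 2) * Real.sin_sq_add_cos_sq θ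

lemma rotation_smul_smul (α β : ℝ) (z : ℍ) :
    rotation α • rotation β • z = rotation (α + β) • z := by
  apply ext_coords
  · rw [cX_rotation, cX_rotation, cY_rotation, cX_rotation, Real.cos_add, Real.sin_add]; ring
  · rw [cY_rotation, cX_rotation, cY_rotation, cY_rotation, Real.cos_add, Real.sin_add]; ring

lemma rotation_zero_smul (z : ℍ) : rotation 0 • z = z := by
  apply ext_coords <;> simp [cX_rotation, cY_rotation]

lemma rotation_int_smul (n : ℤ) (z : ℍ) : rotation (n * (2 * π)) • z = z := by
  apply ext_coords
  · rw [cX_rotation, Real.cos_int_mul_two_pi]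
    have : Real.sin (n * (2 * π)) = 0 := by
      rw [← zero_add (n * (2 * π)), Real.sin_add_int_mul_two_pi, Real.sin_zero]
    rw [this]; ring
  · rw [cY_rotation, Real.cos_int_mul_two_pi]
    have : Real.sin (n * (2 * π)) = 0 := by
      rw [← zero_add (n * (2 * π)), Real.sin_add_int_mul_two_pi, Real.sin_zero]
    rw [this]; ring

lemma rotation_inv_smul (θ : ℝ) (z : ℍ) : (rotation θ)⁻¹ • z = rotation (-θ) • z := by
  rw [inv_smul_eq_iff, rotation_smul_smul, add_neg_cancel, rotation_zero_smul]

lemma cosh_sq_sub (x : ℝ) : Real.cosh x ^ 2 = 1 + Real.sinh x ^ 2 := by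
  rw [Real.cosh_sq]; ring

lemma perp_im (a u : ℝ) : (perp a u).im = Real.exp a / Real.cosh u := rfl
lemma perp_re (a u : ℝ) : (perp a u).re = -(Real.exp a * Real.tanh u) := rfl

lemma perp_normSq (a u : ℝ) : (perp a u).re ^ 2 + (perp a u).im ^ 2 = Real.exp a ^ 2 := by
  rw [perp_re, perp_im, Real.tanh_eq_sinh_div_cosh]
  have := (Real.cosh_pos u).ne'
  field_simp
  linear_combination -cosh_sq_sub u

lemma cY_perp (a u : ℝ) : cY (perp a u) = Real.sinh u := by
  unfold cY
  rw [perp_re, perp_im, Real.tanh_eq_sinh_div_cosh]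
  have := (Real.cosh_pos u).ne'
  have := (Real.exp_pos a).ne'
  field_simp

lemma cX_perp (a u : ℝ) : cX (perp a u) = Real.sinh a * Real.cosh u := by
  unfold cX
  rw [perp_normSq, perp_im, Real.sinh_eq, Real.exp_neg]
  have := (Real.cosh_pos u).ne'
  have := (Real.exp_pos a).ne'
  field_simp

lemma cT_perp (a u : ℝ) : cT (perp a u) = Real.cosh a * Real.cosh u := by
  unfold cT
  rw [add_assoc, perp_normSq, perp_im, Real.cosh_eq a, Real.exp_neg]
  have := (Real.cosh_pos u).ne'
  have := (Real.exp_pos a).ne'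
  field_simp
  ring

lemma dist_eq_of_cosh {z w : ℍ} {r : ℝ} (h : Real.cosh (dist z w) = Real.cosh r) :
    dist z w = |r| := by
  have h1 := Real.cosh_le_cosh.1 h.le
  have h2 := Real.cosh_le_cosh.1 h.ge
  rw [abs_of_nonneg dist_nonneg] at h1 h2
  exact le_antisymm h1 h2

lemma dist_eq_dist_of_cosh {z w z' w' : ℍ} (h : Real.cosh (dist z w) = Real.cosh (dist z' w')) :
    dist z w = dist z' w' := by
  rw [dist_eq_of_cosh h, abs_of_nonneg dist_nonneg]

lemma dist_le_dist_of_cosh {z w z' w' : ℍ}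
    (h : Real.cosh (dist z w) ≤ Real.cosh (dist z' w')) : dist z w ≤ dist z' w' := by
  have h1 := Real.cosh_le_cosh.1 h
  rwa [abs_of_nonneg dist_nonneg, abs_of_nonneg dist_nonneg] at h1

lemma dist_perp (a u v : ℝ) : dist (perp a u) (perp a v) = |u - v| := by
  apply dist_eq_of_cosh
  rw [cosh_dist_eq]
  simp only [cT_perp, cX_perp, cY_perp]
  rw [Real.cosh_sub]
  linear_combination (Real.cosh u * Real.cosh v) * cosh_sq_sub a

lemma dist_rotation (θ : ℝ) (z w : ℍ) : dist (rotation θ • z) (rotation θ • w) = dist z w := by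
  apply dist_eq_dist_of_cosh
  simp only [cosh_dist_eq, cT_rotation, cX_rotation, cY_rotation]
  linear_combination (-(cX z * cX w) - cY z * cY w) * Real.sin_sq_add_cos_sq θ

/-- The reflection in the vertical axis. -/
def mirror (z : ℍ) : ℍ := ofXY (cX z) (-cY z)

@[simp] lemma cX_mirror (z : ℍ) : cX (mirror z) = cX z := by simp [mirror]
@[simp] lemma cY_mirror (z : ℍ) : cY (mirror z) = -cY z := by simp [mirror]
@[simp] lemma cT_mirror (z : ℍ) : cT (mirror z) = cT z :=
  cT_ofXY (cT_pos z) (by rw [cT_sq]; ring)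
@[simp] lemma mirror_mirror (z : ℍ) : mirror (mirror z) = z := ext_coords (by simp) (by simp)

lemma dist_mirror (z w : ℍ) : dist (mirror z) (mirror w) = dist z w := by
  apply dist_eq_dist_of_cosh
  simp [cosh_dist_eq]

lemma mirror_rotation (θ : ℝ) (z : ℍ) :
    mirror (rotation θ • z) = rotation (-θ) • mirror z := by
  apply ext_coords
  · simp [cX_rotation]
  · simp [cY_rotation]; ring

lemma mirror_perp (a u : ℝ) : mirror (perp a u) = perp a (-u) := by
  apply ext_coords
  · simp [cX_perp]
  · simp [cY_perp]

/-! ### Signed heights over geodesics and reflections -/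

/-- The hyperbolic sine of the signed distance to the geodesic at distance `a` from the centre in
the direction `θ`, positive on the side of the centre if `0 < a`. -/
def height (a θ : ℝ) (z : ℍ) : ℝ :=
  cT z * Real.sinh a - Real.cosh a * (cX z * Real.cos θ + cY z * Real.sin θ)

lemma height_rotation (a θ α : ℝ) (z : ℍ) :
    height a θ (rotation α • z) = height a (θ - α) z := by
  simp only [height, cT_rotation, cX_rotation, cY_rotation, Real.cos_sub, Real.sin_sub]
  ring

lemma height_mirror (a θ : ℝ) (z : ℍ) : height a θ (mirror z) = height a (-θ) z := by
  simp [height]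

lemma height_add_int (a θ : ℝ) (n : ℤ) (z : ℍ) : height a (θ + n * (2 * π)) z = height a θ z := by
  simp only [height, Real.cos_add_int_mul_two_pi, Real.sin_add_int_mul_two_pi]

lemma continuous_height (a θ : ℝ) : Continuous (height a θ) := by
  have := continuous_cT
  have := continuous_cX
  have := continuous_cY
  unfold height
  fun_prop

/-- The half-disc conditions that define the polygon become signs of linear forms; the heights and
the norms differ by a positive factor. -/
lemma norm_rotation_inv_le_iff (a θ : ℝ) (z : ℍ) :
    ‖(((rotation θ)⁻¹ • z : ℍ) : ℂ)‖ ≤ Real.exp a ↔ 0 ≤ height a θ z := by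
  have h0 : height a θ z = height a 0 ((rotation θ)⁻¹ • z) := by
    rw [rotation_inv_smul, height_rotation]; congr 1; ring
  rw [h0]
  generalize (rotation θ)⁻¹ • z = w
  have hy := w.im_pos
  rw [← sq_le_sq₀ (norm_nonneg _) (Real.exp_pos a).le, Complex.sq_norm, Complex.normSq_apply]
  simp only [UpperHalfPlane.coe_re, UpperHalfPlane.coe_im]
  have hE := Real.exp_pos a
  have : height a 0 w = (Real.exp a ^ 2 - (w.re * w.re + w.im * w.im)) /
      (2 * w.im * Real.exp a) := by
    simp only [height, cT, cX, Real.cos_zero, Real.sin_zero, Real.sinh_eq, Real.cosh_eq,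
      Real.exp_neg]
    field_simp
    ring
  rw [this, le_div_iff₀ (by positivity), zero_mul, sub_nonneg]

/-- The time coordinate of the reflection of `z` is positive. -/
lemma cT_add_height_pos (a θ : ℝ) (z : ℍ) : 0 < cT z + 2 * height a θ z * Real.sinh a := by
  have h1 := cT_sq z
  have h2 := cT_pos z
  have h3 := Real.sin_sq_add_cos_sq θ
  have h4 := cosh_sq_sub a
  set v := cX z * Real.cos θ + cY z * Real.sin θ with hv
  have hle : v ^ 2 < cT z ^ 2 := by
    nlinarith [sq_nonneg (cX z * Real.sin θ - cY z * Real.cos θ)]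
  have habs : |v| < cT z := abs_lt_of_sq_lt_sq hle h2.le
  have e : cT z + 2 * height a θ z * Real.sinh a =
      cT z * (Real.sinh a ^ 2 + Real.cosh a ^ 2) - v * (2 * Real.sinh a * Real.cosh a) := by
    unfold height
    rw [← hv]; linear_combination (-cT z) * h4
  have hc : 0 < Real.cosh a + Real.sinh a := by rw [Real.cosh_add_sinh]; exact Real.exp_pos a
  rw [e]
  rcases abs_lt.1 habs with ⟨hl, hr⟩
  nlinarith [mul_pos (sub_pos.2 hr) (mul_pos hc hc),
    mul_nonneg (neg_lt_iff_pos_add.1 hl).le (sq_nonneg (Real.sinh a - Real.cosh a))]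

/-- The reflection in the geodesic at distance `a` from the centre in the direction `θ`. -/
def reflect (a θ : ℝ) (z : ℍ) : ℍ :=
  ofXY (cX z + 2 * height a θ z * (Real.cosh a * Real.cos θ))
    (cY z + 2 * height a θ z * (Real.cosh a * Real.sin θ))

lemma cX_reflect (a θ : ℝ) (z : ℍ) :
    cX (reflect a θ z) = cX z + 2 * height a θ z * (Real.cosh a * Real.cos θ) := by
  simp [reflect]

lemma cY_reflect (a θ : ℝ) (z : ℍ) :
    cY (reflect a θ z) = cY z + 2 * height a θ z * (Real.cosh a * Real.sin θ) := by
  simp [reflect]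

lemma cT_reflect (a θ : ℝ) (z : ℍ) :
    cT (reflect a θ z) = cT z + 2 * height a θ z * Real.sinh a := by
  refine cT_ofXY (cT_add_height_pos a θ z) ?_
  have e : height a θ z = cT z * Real.sinh a -
    Real.cosh a * (cX z * Real.cos θ + cY z * Real.sin θ) := rfl
  linear_combination cT_sq z - 4 * height a θ z * e -
    4 * height a θ z ^ 2 * Real.cosh a ^ 2 * Real.sin_sq_add_cos_sq θ -
    4 * height a θ z ^ 2 * cosh_sq_sub a

lemma height_reflect (a θ : ℝ) (z : ℍ) : height a θ (reflect a θ z) = -height a θ z := by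
  conv_lhs => unfold height
  rw [cT_reflect, cX_reflect, cY_reflect]
  have e : height a θ z = cT z * Real.sinh a -
    Real.cosh a * (cX z * Real.cos θ + cY z * Real.sin θ) := rfl
  linear_combination -e - 2 * height a θ z * cosh_sq_sub a -
    2 * height a θ z * Real.cosh a ^ 2 * Real.sin_sq_add_cos_sq θ

/-- The hypothesis expresses that the normal vectors of the two geodesics are Minkowski orthogonal,
that is, that the geodesics are perpendicular. -/
lemma height_reflect_other (a θ b η : ℝ) (z : ℍ) (h : Real.sinh a * Real.sinh b =
    Real.cosh a * Real.cosh b * Real.cos (θ - η)) :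
    height b η (reflect a θ z) = height b η z := by
  rw [Real.cos_sub] at h
  unfold height
  rw [cT_reflect, cX_reflect, cY_reflect]
  linear_combination (2 * height a θ z) * h

@[simp] lemma reflect_reflect (a θ : ℝ) (z : ℍ) : reflect a θ (reflect a θ z) = z := by
  apply ext_coords
  · rw [cX_reflect, height_reflect, cX_reflect]; ring
  · rw [cY_reflect, height_reflect, cY_reflect]; ring

lemma reflect_of_height_eq_zero {a θ : ℝ} {z : ℍ} (h : height a θ z = 0) :
    reflect a θ z = z := by
  apply ext_coords
  · rw [cX_reflect, h]; ring
  · rw [cY_reflect, h]; ring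

lemma cosh_dist_reflect (a θ : ℝ) (z w : ℍ) : Real.cosh (dist (reflect a θ z) w) =
    Real.cosh (dist z w) + 2 * height a θ z * height a θ w := by
  rw [cosh_dist_eq, cosh_dist_eq, cT_reflect, cX_reflect, cY_reflect]
  have e : height a θ w = cT w * Real.sinh a -
    Real.cosh a * (cX w * Real.cos θ + cY w * Real.sin θ) := rfl
  rw [e]; ring

lemma dist_reflect (a θ : ℝ) (z w : ℍ) :
    dist (reflect a θ z) (reflect a θ w) = dist z w := by
  apply dist_eq_dist_of_cosh
  rw [cosh_dist_reflect, height_reflect, dist_comm, cosh_dist_reflect, dist_comm]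
  ring

/-- An involution that preserves distances, as an isometry. -/
def isometryOfInvolution (f : ℍ → ℍ) (h : ∀ z, f (f z) = z)
    (hd : ∀ z w, dist (f z) (f w) = dist z w) : ℍ ≃ᵢ ℍ :=
  ⟨⟨f, f, h, h⟩, Isometry.of_dist_eq hd⟩

/-- `reflect` as an isometry. -/
def reflectIso (a θ : ℝ) : ℍ ≃ᵢ ℍ :=
  isometryOfInvolution (reflect a θ) (reflect_reflect a θ) (dist_reflect a θ)

/-- `mirror` as an isometry. -/
def mirrorIso : ℍ ≃ᵢ ℍ := isometryOfInvolution mirror mirror_mirror dist_mirror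

/-- Rotations as isometries. -/
def rotationIso (θ : ℝ) : ℍ ≃ᵢ ℍ :=
  ⟨MulAction.toPerm (rotation θ), Isometry.of_dist_eq (dist_rotation θ)⟩

/-- The folding of the plane along a geodesic. -/
def foldLine (a θ : ℝ) (z : ℍ) : ℍ := if height a θ z < 0 then reflect a θ z else z

/-- For points on opposite sides the heights have opposite signs, so the term 2 · height · height in
`cosh_dist_reflect` is nonpositive and reflecting one point brings them closer. -/
lemma dist_foldLine_le (a θ : ℝ) (z w : ℍ) :
    dist (foldLine a θ z) (foldLine a θ w) ≤ dist z w := by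
  unfold foldLine
  split_ifs with h1 h2 h2
  · rw [dist_reflect]
  · apply dist_le_dist_of_cosh
    rw [cosh_dist_reflect]
    nlinarith
  · apply dist_le_dist_of_cosh
    rw [dist_comm, cosh_dist_reflect, dist_comm]
    nlinarith
  · exact le_rfl

lemma continuous_foldLine (a θ : ℝ) : Continuous (foldLine a θ) :=
  (LipschitzWith.of_dist_le_mul (K := 1) fun z w => by
    simpa using dist_foldLine_le a θ z w).continuous

/-- The square of the determinant of z, w and the unit normal of the geodesic is expanded as a Gram
determinant. As w is orthogonal to the normal, it equals sinh² of the distance minus the square of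
the height. -/
lemma abs_height_le_sinh_dist {a θ : ℝ} {z w : ℍ} (h : height a θ w = 0) :
    |height a θ z| ≤ Real.sinh (dist z w) := by
  apply abs_le_of_sq_le_sq _ (Real.sinh_nonneg_iff.2 dist_nonneg)
  have h1 : Real.sinh (dist z w) ^ 2 = Real.cosh (dist z w) ^ 2 - 1 := by rw [Real.cosh_sq]; ring
  rw [h1, cosh_dist_eq]
  unfold height at h ⊢
  have hz := cT_sq z
  have hw := cT_sq w
  have h3 := Real.sin_sq_add_cos_sq θ
  have h4 := cosh_sq_sub a
  generalize cT z = T at *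
  generalize cX z = X at *
  generalize cY z = Y at *
  generalize cT w = T' at *
  generalize cX w = X' at *
  generalize cY w = Y' at *
  obtain ⟨n, hn⟩ : ∃ n, n = Real.sinh a := ⟨_, rfl⟩
  obtain ⟨l, hl⟩ : ∃ l, l = Real.cosh a * Real.cos θ := ⟨_, rfl⟩
  obtain ⟨m, hm⟩ : ∃ m, m = Real.cosh a * Real.sin θ := ⟨_, rfl⟩
  have hnlm : l ^ 2 + m ^ 2 = 1 + n ^ 2 := by
    rw [hl, hm, hn]; linear_combination Real.cosh a ^ 2 * h3 + h4
  have e1 : T' * Real.sinh a - Real.cosh a * (X' * Real.cos θ + Y' * Real.sin θ) =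
    T' * n - X' * l - Y' * m := by rw [hl, hm, hn]; ring
  have e2 : T * Real.sinh a - Real.cosh a * (X * Real.cos θ + Y * Real.sin θ) =
    T * n - X * l - Y * m := by rw [hl, hm, hn]; ring
  rw [e1] at h
  rw [e2]
  have key := sq_nonneg (T * (X' * m - Y' * l) - X * (T' * m - Y' * n) + Y * (T' * l - X' * n))
  have gram : (T * (X' * m - Y' * l) - X * (T' * m - Y' * n) + Y * (T' * l - X' * n)) ^ 2 =
      (T * T' - X * X' - Y * Y') ^ 2 * (l ^ 2 + m ^ 2 - n ^ 2) +
      2 * (T * T' - X * X' - Y * Y') * (T * n - X * l - Y * m) * (T' * n - X' * l - Y' * m) -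
      (T ^ 2 - X ^ 2 - Y ^ 2) * (T' ^ 2 - X' ^ 2 - Y' ^ 2) * (l ^ 2 + m ^ 2 - n ^ 2) -
      (T ^ 2 - X ^ 2 - Y ^ 2) * (T' * n - X' * l - Y' * m) ^ 2 -
      (T' ^ 2 - X' ^ 2 - Y' ^ 2) * (T * n - X * l - Y * m) ^ 2 := by ring
  have r1 : T ^ 2 - X ^ 2 - Y ^ 2 = 1 := by linarith
  have r2 : T' ^ 2 - X' ^ 2 - Y' ^ 2 = 1 := by linarith
  have r3 : l ^ 2 + m ^ 2 - n ^ 2 = 1 := by linarith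
  rw [gram, h, r1, r2, r3] at key
  linarith

/-! ### Unit speed geodesics of the plane -/

/-- The orthogonal complement of a timelike vector is definite, so it contains no nonzero null
vector. -/
lemma minkowski_eq_zero {wT wX wY T X Y : ℝ} (h : T ^ 2 = 1 + X ^ 2 + Y ^ 2)
    (h1 : wT * T - wX * X - wY * Y = 0) (h2 : wT ^ 2 - wX ^ 2 - wY ^ 2 = 0) :
    wT = 0 ∧ wX = 0 ∧ wY = 0 := by
  have e : (wT * T) ^ 2 = (wX * X + wY * Y) ^ 2 := by
    rw [show wT * T = wX * X + wY * Y by linarith]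
  have h3 : wT ^ 2 ≤ 0 := by
    nlinarith [sq_nonneg (wX * Y - wY * X)]
  have h4 : wT = 0 := by nlinarith
  subst h4
  refine ⟨rfl, ?_, ?_⟩ <;> nlinarith [sq_nonneg wX, sq_nonneg wY]

/-- Three points whose distances are those of the reals `a`, `b`, `r` are on a geodesic, and the
coordinates of the third are determined by those of the first two. -/
lemma coords_of_dist {A B x : ℍ} {a b r : ℝ} (hAB : dist A B = |b - a|) (hA : dist A x = |r - a|)
    (hB : dist B x = |b - r|) :
    Real.sinh (b - a) * cT x = Real.sinh (b - r) * cT A + Real.sinh (r - a) * cT B ∧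
    Real.sinh (b - a) * cX x = Real.sinh (b - r) * cX A + Real.sinh (r - a) * cX B ∧
    Real.sinh (b - a) * cY x = Real.sinh (b - r) * cY A + Real.sinh (r - a) * cY B := by
  have e1 := cosh_dist_eq A B
  have e2 := cosh_dist_eq A x
  have e3 := cosh_dist_eq B x
  rw [hAB, Real.cosh_abs] at e1
  rw [hA, Real.cosh_abs] at e2
  rw [hB, Real.cosh_abs] at e3
  have qA := cT_sq A
  have qB := cT_sq B
  have qx := cT_sq x
  have eb : b - a = (b - r) + (r - a) := by ring
  rw [eb, Real.cosh_add] at e1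
  rw [eb, Real.sinh_add]
  have k1 := cosh_sq_sub (b - r)
  have k2 := cosh_sq_sub (r - a)
  generalize Real.cosh (b - r) = c at *
  generalize Real.sinh (b - r) = s at *
  generalize Real.cosh (r - a) = c' at *
  generalize Real.sinh (r - a) = s' at *
  generalize cT A = AT at *
  generalize cX A = AX at *
  generalize cY A = AY at *
  generalize cT B = BT at *
  generalize cX B = BX at *
  generalize cY B = BY at *
  generalize cT x = T at *
  generalize cX x = X at *
  generalize cY x = Y at *
  -- The difference of the two sides of the claim is orthogonal to x and null, by the three given
  -- distances.
  have := minkowski_eq_zero (wT := (s * c' + c * s') * T - (s * AT + s' * BT))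
    (wX := (s * c' + c * s') * X - (s * AX + s' * BX))
    (wY := (s * c' + c * s') * Y - (s * AY + s' * BY)) qx
    (by linear_combination (s * c' + c * s') * qx + s * e2 + s' * e3)
    (by
      linear_combination (s * c' + c * s') ^ 2 * qx + s ^ 2 * qA + s' ^ 2 * qB
        - 2 * s * s' * e1 + 2 * (s * c' + c * s') * (s * e2 + s' * e3) - s' ^ 2 * k1 - s ^ 2 * k2)
  obtain ⟨h1, h2, h3⟩ := this
  exact ⟨by linarith, by linarith, by linarith⟩

/-- A function that is linear in the hyperboloid coordinates. -/
def IsLinear (Λ : ℍ → ℝ) : Prop :=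
  ∃ l m n : ℝ, ∀ z, Λ z = l * cT z + m * cX z + n * cY z

lemma isLinear_height (a θ : ℝ) : IsLinear (height a θ) :=
  ⟨Real.sinh a, -(Real.cosh a * Real.cos θ), -(Real.cosh a * Real.sin θ),
    fun z => by unfold height; ring⟩

lemma isLinear_cosh_dist (w : ℍ) : IsLinear fun z => Real.cosh (dist z w) :=
  ⟨cT w, -cX w, -cY w, fun z => by simp only [cosh_dist_eq]; ring⟩

lemma IsLinear.interpolate {Λ : ℍ → ℝ} (hΛ : IsLinear Λ) {A B x : ℍ} {a b r : ℝ}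
    (hAB : dist A B = |b - a|) (hA : dist A x = |r - a|) (hB : dist B x = |b - r|) :
    Real.sinh (b - a) * Λ x = Real.sinh (b - r) * Λ A + Real.sinh (r - a) * Λ B := by
  obtain ⟨l, m, n, h⟩ := hΛ
  obtain ⟨h1, h2, h3⟩ := coords_of_dist hAB hA hB
  rw [h, h, h]
  linear_combination l * h1 + m * h2 + n * h3

lemma eq_of_dist_eq {A B x y : ℍ} {a b r : ℝ} (hab : a ≠ b) (hAB : dist A B = |b - a|)
    (hA : dist A x = |r - a|) (hB : dist B x = |b - r|)
    (hA' : dist A y = |r - a|) (hB' : dist B y = |b - r|) : x = y := by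
  obtain ⟨-, h2, h3⟩ := coords_of_dist hAB hA hB
  obtain ⟨-, k₂, k₃⟩ := coords_of_dist hAB hA' hB'
  have hne : Real.sinh (b - a) ≠ 0 := by
    rw [Ne, Real.sinh_eq_zero]; intro h; exact hab (by linarith)
  exact ext_coords (mul_left_cancel₀ hne (by rw [h2, k₂])) (mul_left_cancel₀ hne (by rw [h3, k₃]))

/-- `c` is a unit speed geodesic of the plane on the set `S` of times. -/
def UnitSpeedOn (c : ℝ → ℍ) (S : Set ℝ) : Prop :=
  ∀ a ∈ S, ∀ b ∈ S, dist (c a) (c b) = |a - b|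

lemma UnitSpeedOn.iso {c : ℝ → ℍ} {S : Set ℝ} (h : UnitSpeedOn c S) {g : ℍ → ℍ}
    (hg : ∀ z w, dist (g z) (g w) = dist z w) : UnitSpeedOn (fun r => g (c r)) S :=
  fun a ha b hb => by rw [hg]; exact h a ha b hb

lemma UnitSpeedOn.continuousOn {c : ℝ → ℍ} {S : Set ℝ} (h : UnitSpeedOn c S) :
    ContinuousOn c S := by
  have : LipschitzOnWith 1 c S := LipschitzOnWith.of_dist_le_mul fun a ha b hb => by
    rw [h a ha b hb, Real.dist_eq]; simp
  exact this.continuousOn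

lemma UnitSpeedOn.interpolate {c : ℝ → ℍ} {S : Set ℝ} (h : UnitSpeedOn c S) {Λ : ℍ → ℝ}
    (hΛ : IsLinear Λ) {a b r : ℝ} (ha : a ∈ S) (hb : b ∈ S) (hr : r ∈ S) :
    Real.sinh (b - a) * Λ (c r) = Real.sinh (b - r) * Λ (c a) + Real.sinh (r - a) * Λ (c b) :=
  hΛ.interpolate (by rw [h a ha b hb, abs_sub_comm]) (by rw [h a ha r hr, abs_sub_comm])
    (h b hb r hr)

/-- Linear functions along a unit speed geodesic have the mean value property of the
hyperbolic functions. -/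
lemma UnitSpeedOn.mean {c : ℝ → ℍ} {S : Set ℝ} (hc : UnitSpeedOn c S) {Λ : ℍ → ℝ}
    (hΛ : IsLinear Λ) {r h : ℝ} (h1 : r + h ∈ S) (h2 : r - h ∈ S) (h3 : r ∈ S) :
    Λ (c (r + h)) + Λ (c (r - h)) = 2 * Real.cosh h * Λ (c r) := by
  rcases eq_or_ne h 0 with rfl | hne
  · simp; ring
  have := hc.interpolate hΛ h2 h1 h3
  rw [show r + h - (r - h) = 2 * h by ring, show r + h - r = h by ring,
    show r - (r - h) = h by ring, Real.sinh_two_mul] at this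
  have hs : Real.sinh h ≠ 0 := by rwa [Ne, Real.sinh_eq_zero]
  apply mul_left_cancel₀ hs
  linarith

/-- A linear function that vanishes at time `r₀` of a unit speed geodesic is a multiple of
`sinh (r - r₀)`. -/
lemma UnitSpeedOn.exists_sinh {c : ℝ → ℍ} {r₀ ε : ℝ} (hε : 0 < ε)
    (hc : UnitSpeedOn c (Set.Ioo (r₀ - ε) (r₀ + ε))) {Λ : ℍ → ℝ} (hΛ : IsLinear Λ)
    (h0 : Λ (c r₀) = 0) :
    ∃ α, ∀ r ∈ Set.Ioo (r₀ - ε) (r₀ + ε), Λ (c r) = α * Real.sinh (r - r₀) := by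
  have m0 : r₀ ∈ Set.Ioo (r₀ - ε) (r₀ + ε) := ⟨by linarith, by linarith⟩
  have m1 : r₀ + ε / 2 ∈ Set.Ioo (r₀ - ε) (r₀ + ε) := ⟨by linarith, by linarith⟩
  refine ⟨Λ (c (r₀ + ε / 2)) / Real.sinh (ε / 2), fun r hr => ?_⟩
  have := hc.interpolate hΛ m0 m1 hr
  rw [h0, show r₀ + ε / 2 - r₀ = ε / 2 by ring] at this
  have hs : 0 < Real.sinh (ε / 2) := Real.sinh_pos_iff.2 (by linarith)
  rw [div_mul_eq_mul_div, eq_div_iff hs.ne']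
  linarith

/-- The segment is the hyperbolic interpolation (sinh(ℓ - r) A + sinh(r) B) / sinh ℓ in the
hyperboloid; the addition formulas show that it has unit speed. -/
lemma exists_segment {A B : ℍ} (hne : A ≠ B) : ∃ τ : ℝ → ℍ, τ 0 = A ∧ τ (dist A B) = B ∧
    UnitSpeedOn τ (Set.Icc 0 (dist A B)) := by
  have hpos : 0 < dist A B := dist_pos.2 hne
  have e := cosh_dist_eq A B
  have qA := cT_sq A
  have qB := cT_sq B
  have tA := cT_pos A
  have tB := cT_pos B
  set ℓ := dist A B
  have hS : 0 < Real.sinh ℓ := Real.sinh_pos_iff.2 hpos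
  have qℓ := cosh_sq_sub ℓ
  let f : (ℍ → ℝ) → ℝ → ℝ := fun κ r =>
    (Real.sinh (ℓ - r) * κ A + Real.sinh r * κ B) / Real.sinh ℓ
  have prod : ∀ r r', f cT r * f cT r' - f cX r * f cX r' - f cY r * f cY r' =
      Real.cosh (r - r') := by
    intro r r'
    simp only [f, Real.sinh_sub, Real.cosh_sub]
    field_simp
    linear_combination (-(Real.sinh ℓ * Real.cosh r - Real.cosh ℓ * Real.sinh r) *
        (Real.sinh ℓ * Real.cosh r' - Real.cosh ℓ * Real.sinh r')) * (-qA) +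
      Real.sinh r * Real.sinh r' * qB -
      ((Real.sinh ℓ * Real.cosh r - Real.cosh ℓ * Real.sinh r) * Real.sinh r' +
        (Real.sinh ℓ * Real.cosh r' - Real.cosh ℓ * Real.sinh r') * Real.sinh r) * e -
      Real.sinh r * Real.sinh r' * qℓ
  have hT : ∀ r ∈ Set.Icc 0 ℓ, cT (ofXY (f cX r) (f cY r)) = f cT r := by
    intro r hr
    apply cT_ofXY
    · have h1 : 0 ≤ Real.sinh (ℓ - r) := Real.sinh_nonneg_iff.2 (by linarith [hr.2])
      have h2 : 0 ≤ Real.sinh r := Real.sinh_nonneg_iff.2 hr.1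
      apply div_pos _ hS
      rcases eq_or_lt_of_le hr.1 with h | h
      · subst h; simpa using mul_pos hS tA
      · have : 0 < Real.sinh r := Real.sinh_pos_iff.2 h
        positivity
    · have := prod r r
      rw [sub_self, Real.cosh_zero] at this
      linarith
  refine ⟨fun r => ofXY (f cX r) (f cY r), ?_, ?_, ?_⟩
  · apply ext_coords <;> simp [f, hS.ne']
  · apply ext_coords <;> simp [f, hS.ne']
  · intro a ha b hb
    apply dist_eq_of_cosh
    rw [cosh_dist_eq, hT a ha, hT b hb]
    simpa using prod a b

/-! ### Functions that are locally contracting -/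

/-- Continuous induction: the times up to which the estimate from a holds form a closed set, and the
local hypothesis extends it to the right. -/
lemma dist_le_of_locally {Y : Type*} [PseudoMetricSpace Y] {f : ℝ → Y} {a b : ℝ} (hab : a ≤ b)
    (h : ∀ r ∈ Set.Icc a b, ∃ ε > 0, ∀ r' ∈ Set.Icc a b, |r' - r| < ε →
      dist (f r) (f r') ≤ |r' - r|) : dist (f a) (f b) ≤ b - a := by
  have hcont : ContinuousOn f (Set.Icc a b) := by
    intro r hr
    obtain ⟨ε, hε, hh⟩ := h r hr
    rw [Metric.continuousWithinAt_iff]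
    intro δ hδ
    refine ⟨min ε δ, lt_min hε hδ, fun r' hr' hd => ?_⟩
    rw [Real.dist_eq] at hd
    rw [dist_comm]
    exact (hh r' hr' (hd.trans_le (min_le_left _ _))).trans_lt (hd.trans_le (min_le_right _ _))
  have hcl : IsClosed ({x | dist (f a) (f x) ≤ x - a} ∩ Set.Icc a b) := by
    have : IsClosed {x ∈ Set.Icc a b | dist (f a) (f x) ≤ x - a} :=
      isClosed_Icc.isClosed_le ((continuous_const.dist continuous_id).comp_continuousOn hcont) (by fun_prop)
    convert this using 1
    ext x; exact and_comm
  have key := hcl.Icc_subset_of_forall_exists_gt (by simp) (fun x hx y hy => by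
    obtain ⟨hx1, hx2⟩ := hx
    obtain ⟨ε, hε, hh⟩ := h x ⟨hx2.1, hx2.2.le⟩
    set z := min (min y b) (x + ε / 2) with hz
    have hxz : x < z := lt_min (lt_min hy hx2.2) (by linarith)
    refine ⟨z, ?_, hxz, (min_le_left _ _).trans (min_le_left _ _)⟩
    have hzb : z ≤ b := (min_le_left _ _).trans (min_le_right _ _)
    have hze : z ≤ x + ε / 2 := min_le_right _ _
    have := hh z ⟨hx2.1.trans hxz.le, hzb⟩ (by rw [abs_of_pos (by linarith)]; linarith)
    rw [abs_of_pos (by linarith)] at this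
    have h3 : dist (f a) (f x) ≤ x - a := hx1
    show dist (f a) (f z) ≤ z - a
    linarith [dist_triangle (f a) (f x) (f z)])
  exact key (Set.right_mem_Icc.2 hab)

/-- A continuous function on an interval that is contracting on each of finitely many closed sets
that cover the interval is contracting. -/
lemma dist_le_of_closed_cover {ι Y : Type*} [Finite ι] [PseudoMetricSpace Y] {f : ℝ → Y} {a b : ℝ}
    (hab : a ≤ b) (S : ι → Set ℝ) (hS : ∀ i, IsClosed (S i ∩ Set.Icc a b))
    (hcov : ∀ r ∈ Set.Icc a b, ∃ i, r ∈ S i)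
    (h : ∀ i, ∀ r ∈ S i ∩ Set.Icc a b, ∀ r' ∈ S i ∩ Set.Icc a b, dist (f r) (f r') ≤ |r' - r|) :
    dist (f a) (f b) ≤ b - a := by
  apply dist_le_of_locally hab
  intro r hr
  -- Close to r only those sets of the finite cover that contain r itself are met, so r and r'
  -- always share one.
  have : ∀ᶠ r' in nhds r, ∀ i, r ∉ S i → r' ∉ S i ∩ Set.Icc a b := by
    rw [Filter.eventually_all]
    intro i
    by_cases hi : r ∈ S i
    · simp [hi]
    · filter_upwards [(hS i).isOpen_compl.mem_nhds (fun h => hi h.1)] with r' hr' _ using hr'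
  obtain ⟨ε, hε, hh⟩ := Metric.eventually_nhds_iff.1 this
  refine ⟨ε, hε, fun r' hr' hd => ?_⟩
  obtain ⟨i, hi⟩ := hcov r' hr'
  have hri : r ∈ S i := by
    by_contra hn
    exact hh (y := r') (by rwa [Real.dist_eq]) i hn ⟨hi, hr'⟩
  have := h i r ⟨hri, hr⟩ r' ⟨hi, hr'⟩
  exact this

/-- The maximum principle for functions with the mean value property of the hyperbolic functions. -/
lemma nonpos_of_mean {f : ℝ → ℝ} {a b : ℝ} (hab : a ≤ b) (hf : ContinuousOn f (Set.Icc a b))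
    (hfa : f a ≤ 0) (hfb : f b ≤ 0)
    (hm : ∀ r ∈ Set.Ioo a b, ∃ h > 0, a ≤ r - h ∧ r + h ≤ b ∧
      f (r + h) + f (r - h) = 2 * Real.cosh h * f r) : ∀ r ∈ Set.Icc a b, f r ≤ 0 := by
  obtain ⟨m, hm1, hm2⟩ := isCompact_Icc.exists_isMaxOn (Set.nonempty_Icc.2 hab) hf
  intro r hr
  refine (hm2 hr).trans ?_
  rcases eq_or_lt_of_le hm1.1 with rfl | h1
  · exact hfa
  rcases eq_or_lt_of_le hm1.2 with rfl | h2
  · exact hfb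
  obtain ⟨h, hh, ha, hb, e⟩ := hm m ⟨h1, h2⟩
  have l1 : f (m + h) ≤ f m := hm2 ⟨by linarith, hb⟩
  have l2 : f (m - h) ≤ f m := hm2 ⟨ha, by linarith⟩
  -- At a positive interior maximum the sum of two values at most f m would equal 2 cosh(h) f m > 2
  -- f m.
  have := Real.one_lt_cosh.2 hh.ne'
  by_contra hc
  push Not at hc
  nlinarith

end
end RightAngled

namespace RightAngled
noncomputable section

open Real

set_option linter.unusedSectionVars false

/-! ### The trigonometry of the polygon -/

lemma eq_zero_of_cosh_eq_one {x : ℝ} (h : Real.cosh x = 1) : x = 0 := by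
  by_contra hx
  exact (Real.one_lt_cosh.2 hx).ne' h

/-- The parameters `q`, `t` define a polygon `P(t, q)`. -/
class Good (q : ℕ) (t : ℝ) : Prop where
  three_le : 3 ≤ q
  pos : 0 < t

/-- The relations between the apothem `a` of the sides of length `ℓ` of a semi-regular right-angled
`2 q`-gon and the length `m` of the other sides. -/
structure SideRelations (q : ℕ) (a ℓ m : ℝ) : Prop where
  three_le : 3 ≤ q
  pos : 0 < ℓ
  pos' : 0 < m
  sin_mul_cosh : Real.sin (π / q) * Real.cosh a = Real.cosh (m / 2)
  sin_mul_sinh : Real.sin (π / q) * Real.sinh a = Real.sinh (m / 2) * Real.cosh (ℓ / 2)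
  cos_eq : Real.cos (π / q) = Real.sinh (m / 2) * Real.sinh (ℓ / 2)

lemma angle_pos {q : ℕ} (hq : 3 ≤ q) : 0 < π / q := div_pos pi_pos (by positivity)

lemma angle_le {q : ℕ} (hq : 3 ≤ q) : π / q ≤ π / 3 :=
  div_le_div_of_nonneg_left pi_pos.le (by norm_num) (by exact_mod_cast hq)

lemma mul_angle {q : ℕ} (hq : 3 ≤ q) : (q : ℝ) * (π / q) = π := by
  have : (q : ℝ) ≠ 0 := by positivity
  field_simp

lemma sin_angle_pos {q : ℕ} (hq : 3 ≤ q) : 0 < Real.sin (π / q) :=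
  Real.sin_pos_of_pos_of_lt_pi (angle_pos hq) (by linarith [angle_le hq, pi_pos])

lemma cos_angle_pos {q : ℕ} (hq : 3 ≤ q) : 0 < Real.cos (π / q) :=
  Real.cos_pos_of_mem_Ioo ⟨by linarith [angle_pos hq, pi_pos], by linarith [angle_le hq, pi_pos]⟩

lemma sin_natCast_mul_pos {q k : ℕ} (hq : 3 ≤ q) (h1 : 1 ≤ k) (h2 : k < q) :
    0 < Real.sin (k * (π / q)) := by
  have h := angle_pos hq
  have h3 : (1 : ℝ) ≤ k := by exact_mod_cast h1
  have h4 : (k : ℝ) < q := by exact_mod_cast h2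
  apply Real.sin_pos_of_pos_of_lt_pi (by positivity)
  calc (k : ℝ) * (π / q) < q * (π / q) := by gcongr
    _ = π := mul_angle hq

lemma sin_natCast_mul_nonneg {q k : ℕ} (hq : 3 ≤ q) (h2 : k ≤ q) :
    0 ≤ Real.sin (k * (π / q)) := by
  have h := angle_pos hq
  have h4 : (k : ℝ) ≤ q := by exact_mod_cast h2
  apply Real.sin_nonneg_of_nonneg_of_le_pi (by positivity)
  calc (k : ℝ) * (π / q) ≤ q * (π / q) := by gcongr
    _ = π := mul_angle hq

lemma abs_cos_natCast_mul_le {q k : ℕ} (hq : 3 ≤ q) (h1 : 1 ≤ k) (h2 : k < q) :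
    |Real.cos (k * (π / q))| ≤ Real.cos (π / q) := by
  have h := angle_pos hq
  have h3 : (1 : ℝ) ≤ k := by exact_mod_cast h1
  have h4 : (k : ℝ) + 1 ≤ q := by exact_mod_cast h2
  have e := mul_angle hq
  have u1 : π / q ≤ k * (π / q) := by nlinarith
  have u2 : k * (π / q) ≤ π - π / q := by nlinarith
  rw [abs_le, ← Real.cos_pi_sub]
  exact ⟨Real.cos_le_cos_of_nonneg_of_le_pi (by linarith) (by linarith) u2,
    Real.cos_le_cos_of_nonneg_of_le_pi h.le (by linarith) u1⟩

lemma abs_cos_natCast_mul_lt {q k : ℕ} (hq : 3 ≤ q) (h1 : 2 ≤ k) (h2 : k + 1 < q) :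
    |Real.cos (k * (π / q))| < Real.cos (π / q) := by
  have h := angle_pos hq
  have h3 : (2 : ℝ) ≤ k := by exact_mod_cast h1
  have h4 : (k : ℝ) + 2 ≤ q := by exact_mod_cast h2
  have e := mul_angle hq
  have u1 : π / q < k * (π / q) := by nlinarith
  have u2 : k * (π / q) < π - π / q := by nlinarith
  rw [abs_lt, ← Real.cos_pi_sub]
  exact ⟨Real.cos_lt_cos_of_nonneg_of_le_pi (by linarith) (by linarith) u2,
    Real.cos_lt_cos_of_nonneg_of_le_pi h.le (by linarith) u1⟩

/-! ### Distances between sides of the same colour in the right-angled polygon -/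

namespace SideRelations

variable {q : ℕ} {a ℓ m : ℝ}

lemma sinh_pos (h : SideRelations q a ℓ m) : 0 < Real.sinh a := by
  have h1 := h.sin_mul_sinh
  have h2 : 0 < Real.sinh (m / 2) := Real.sinh_pos_iff.2 (half_pos h.pos')
  have h3 := Real.cosh_pos (ℓ / 2)
  have : 0 < Real.sin (π / q) * Real.sinh a := by rw [h1]; positivity
  exact (mul_pos_iff_of_pos_left (sin_angle_pos h.three_le)).1 this

/-- Half-angles factor the height, which allows the two factors to be bounded separately. -/
lemma height_perp (a u θ : ℝ) : height a (2 * θ) (perp a u) =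
    2 * Real.cosh a * Real.sin θ *
      (Real.cosh u * Real.sinh a * Real.sin θ - Real.sinh u * Real.cos θ) := by
  unfold height
  rw [cT_perp, cX_perp, cY_perp, Real.sin_two_mul, Real.cos_two_mul']
  linear_combination (-(Real.cosh a * Real.cosh u * Real.sinh a)) * Real.sin_sq_add_cos_sq θ

lemma height_one (h : SideRelations q a ℓ m) (u : ℝ) :
    height a (2 * (π / q)) (perp a u) = Real.sinh m * Real.cosh (ℓ / 2 - u) := by
  rw [height_perp, Real.cosh_sub]
  have e : Real.sinh m = 2 * Real.sinh (m / 2) * Real.cosh (m / 2) := by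
    rw [← Real.sinh_two_mul]; congr 1; ring
  rw [e, ← h.sin_mul_cosh]
  linear_combination 2 * Real.cosh a * Real.sin (π / q) * (Real.cosh u * h.sin_mul_sinh -
    Real.sinh u * h.cos_eq)

lemma height_neg_one (h : SideRelations q a ℓ m) (u : ℝ) :
    height a (2 * -(π / q)) (perp a u) = Real.sinh m * Real.cosh (ℓ / 2 + u) := by
  have := h.height_one (-u)
  rw [← mirror_perp, height_mirror, sub_neg_eq_add] at this
  rw [← this]; congr 1; ring

/-- Every point of a side is at height at least `sinh m` over the geodesics of the other sides of
the same colour. -/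
lemma sinh_le_height (h : SideRelations q a ℓ m) (u : ℝ) {k : ℕ} (h1 : 1 ≤ k)
    (h2 : k < q) : Real.sinh m ≤ height a (2 * (k * (π / q))) (perp a u) ∧
      (2 ≤ k → k + 1 < q → Real.sinh m < height a (2 * (k * (π / q))) (perp a u)) := by
  rw [height_perp]
  have e : Real.sinh m = 2 * Real.sinh (m / 2) * Real.cosh (m / 2) := by
    rw [← Real.sinh_two_mul]; congr 1; ring
  have hS := sin_angle_pos h.three_le
  have hSk := sin_natCast_mul_pos h.three_le h1 h2
  have hc := abs_cos_natCast_mul_le h.three_le h1 h2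
  have hss : 0 < Real.sinh (m / 2) := Real.sinh_pos_iff.2 (half_pos h.pos')
  have q1 := Real.sin_sq_add_cos_sq (π / q)
  have q2 := Real.sin_sq_add_cos_sq (k * (π / q))
  have hsin : Real.sin (π / q) ≤ Real.sin (k * (π / q)) := by
    apply le_of_sq_le_sq _ hSk.le
    nlinarith [sq_abs (Real.cos (k * (π / q))), abs_nonneg (Real.cos (k * (π / q)))]
  -- The bracket is compared with its value for k = 1 at |u|, which is sinh(m/2) cosh(ℓ/2 - |u|).
  -- Together with the bound cosh(m/2) on the other factor this gives 2 sinh(m/2) cosh(m/2) = sinh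
  -- m.
  have hbr : Real.sinh (m / 2) ≤
      Real.cosh u * Real.sinh a * Real.sin (k * (π / q)) - Real.sinh u * Real.cos (k * (π / q)) := by
    have b1 : Real.sinh u * Real.cos (k * (π / q)) ≤ Real.sinh |u| * Real.cos (π / q) := by
      calc _ ≤ |Real.sinh u * Real.cos (k * (π / q))| := le_abs_self _
        _ = Real.sinh |u| * |Real.cos (k * (π / q))| := by rw [abs_mul, Real.abs_sinh]
        _ ≤ _ := mul_le_mul_of_nonneg_left hc (Real.sinh_nonneg_iff.2 (abs_nonneg u))
    have b2 : Real.cosh u * Real.sinh a * Real.sin (π / q) ≤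
        Real.cosh u * Real.sinh a * Real.sin (k * (π / q)) :=
      mul_le_mul_of_nonneg_left hsin (mul_nonneg (Real.cosh_pos u).le h.sinh_pos.le)
    have b3 : Real.cosh u * Real.sinh a * Real.sin (π / q) - Real.sinh |u| * Real.cos (π / q) =
        Real.sinh (m / 2) * Real.cosh (ℓ / 2 - |u|) := by
      rw [Real.cosh_sub, Real.cosh_abs]
      linear_combination Real.cosh u * h.sin_mul_sinh - Real.sinh |u| * h.cos_eq
    have b4 := Real.one_le_cosh (ℓ / 2 - |u|)
    nlinarith
  have hca := Real.cosh_pos a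
  have hmul : Real.cosh (m / 2) ≤ Real.cosh a * Real.sin (k * (π / q)) := by
    rw [← h.sin_mul_cosh, mul_comm]
    exact mul_le_mul_of_nonneg_left hsin hca.le
  have hcm := Real.cosh_pos (m / 2)
  constructor
  · rw [e]; nlinarith
  · intro k1 k2
    have hc' := abs_cos_natCast_mul_lt h.three_le k1 k2
    have hsin' : Real.sin (π / q) < Real.sin (k * (π / q)) := by
      apply lt_of_pow_lt_pow_left₀ 2 hSk.le
      nlinarith [sq_abs (Real.cos (k * (π / q))), abs_nonneg (Real.cos (k * (π / q)))]
    have hmul' : Real.cosh (m / 2) < Real.cosh a * Real.sin (k * (π / q)) := by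
      rw [← h.sin_mul_cosh, mul_comm]
      exact mul_lt_mul_of_pos_left hsin' hca
    rw [e]; nlinarith

/-- Strictness excludes all but the two neighbouring sides. Over these the height is sinh m times a
hyperbolic cosine that equals 1 only at one end of the side. -/
lemma height_eq_iff (h : SideRelations q a ℓ m) (u : ℝ) {k : ℕ} (h1 : 1 ≤ k)
    (h2 : k < q) (he : height a (2 * (k * (π / q))) (perp a u) = Real.sinh m) :
    (k = 1 ∧ u = ℓ / 2) ∨ (k = q - 1 ∧ u = -(ℓ / 2)) := by
  have hm : 0 < Real.sinh m := Real.sinh_pos_iff.2 h.pos'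
  rcases Nat.lt_or_ge k 2 with hk | hk
  · left
    obtain rfl : k = 1 := by omega
    refine ⟨rfl, ?_⟩
    rw [Nat.cast_one, one_mul, h.height_one] at he
    have : Real.cosh (ℓ / 2 - u) = 1 := by
      apply mul_left_cancel₀ hm.ne'; rw [he, mul_one]
    have := eq_zero_of_cosh_eq_one this
    linarith
  · rcases Nat.lt_or_ge (k + 1) q with hk' | hk'
    · exact absurd he ((h.sinh_le_height u h1 h2).2 hk hk').ne'
    · right
      obtain rfl : k = q - 1 := by omega
      refine ⟨rfl, ?_⟩
      have e1 : 2 * (((q - 1 : ℕ) : ℝ) * (π / q)) = 2 * -(π / q) + (1 : ℤ) * (2 * π) := by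
        have := mul_angle h.three_le
        rw [Nat.cast_sub (by have := h.three_le; omega)]
        push_cast
        linear_combination 2 * this
      rw [e1, height_add_int, h.height_neg_one] at he
      have : Real.cosh (ℓ / 2 + u) = 1 := by
        apply mul_left_cancel₀ hm.ne'; rw [he, mul_one]
      have := eq_zero_of_cosh_eq_one this
      linarith

/-- The distance between two sides of the same colour is at least the length of the sides of the
other colour. -/
lemma le_dist (h : SideRelations q a ℓ m) (u v : ℝ) {k : ℕ}
    (h1 : 1 ≤ k) (h2 : k < q) :
    m ≤ dist (perp a u) (rotation (2 * (k * (π / q))) • perp a v) ∧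
    (dist (perp a u) (rotation (2 * (k * (π / q))) • perp a v) = m →
      (k = 1 ∧ u = ℓ / 2 ∧ v = -(ℓ / 2)) ∨ (k = q - 1 ∧ u = -(ℓ / 2) ∧ v = ℓ / 2)) := by
  set w := rotation (2 * (k * (π / q))) • perp a v with hw
  have hq := h.three_le
  have hz0 : ∀ u, height a 0 (perp a u) = 0 := fun u => by
    have := height_perp a u 0
    simpa using this
  have hw0 : height a (2 * (k * (π / q))) w = 0 := by
    rw [hw, height_rotation, sub_self, hz0]
  have b1 := (h.sinh_le_height u h1 h2).1
  have b2 := le_abs_self (height a (2 * (k * (π / q))) (perp a u))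
  have b3 := abs_height_le_sinh_dist (z := perp a u) hw0
  refine ⟨Real.sinh_le_sinh.1 (b1.trans (b2.trans b3)), fun he => ?_⟩
  rw [he] at b3
  have c1 := h.height_eq_iff u h1 h2 (le_antisymm (b2.trans b3) b1)
  -- The same estimate with the roles exchanged: seen from the side of w, the other side has number
  -- q - k. Equality in both estimates fixes both points.
  have e1 : height a 0 w = height a (2 * ((q - k : ℕ) * (π / q))) (perp a v) := by
    rw [hw, height_rotation, ← height_add_int a _ 1]
    congr 1
    have := mul_angle h.three_le
    rw [Nat.cast_sub h2.le]
    push_cast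
    linear_combination (-2) * this
  have d1 := (h.sinh_le_height v (k := q - k) (by omega) (by omega)).1
  have d3 := abs_height_le_sinh_dist (z := w) (hz0 u)
  rw [dist_comm, he, e1] at d3
  have c2 := h.height_eq_iff v (k := q - k) (by omega) (by omega)
    (le_antisymm ((le_abs_self _).trans d3) d1)
  rcases c1 with ⟨rfl, hu'⟩ | ⟨hk, hu'⟩ <;> rcases c2 with ⟨hk2, hv'⟩ | ⟨hk2, hv'⟩
  · omega
  · exact Or.inl ⟨rfl, hu', hv'⟩
  · exact Or.inr ⟨hk, hu', hv'⟩
  · omega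

end SideRelations

variable {q : ℕ} {t : ℝ}

lemma s_pos (q : ℕ) (t : ℝ) [G : Good q t] : 0 < s q t := by
  have h1 := cos_angle_pos G.three_le
  have h2 : 0 < Real.sinh (t / 2) := Real.sinh_pos_iff.2 (half_pos G.pos)
  unfold s
  have : 0 < Real.arsinh (Real.cos (π / q) / Real.sinh (t / 2)) :=
    Real.arsinh_pos_iff.2 (by positivity)
  linarith

lemma cos_eq_sinh_mul_sinh (q : ℕ) (t : ℝ) [G : Good q t] :
    Real.cos (π / q) = Real.sinh (t / 2) * Real.sinh (s q t / 2) := by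
  have h2 : 0 < Real.sinh (t / 2) := Real.sinh_pos_iff.2 (half_pos G.pos)
  unfold s
  rw [mul_div_cancel_left₀ _ two_ne_zero, Real.sinh_arsinh]
  field_simp

/-- The defining equation is symmetric in ℓ and m, so one computation serves both colours. The
relation for cosh follows from the one for sinh by comparing squares. -/
lemma sideRelations_of {ℓ m : ℝ} (hq : 3 ≤ q) (hℓ : 0 < ℓ) (hm : 0 < m)
    (h : Real.cos (π / q) = Real.sinh (m / 2) * Real.sinh (ℓ / 2)) :
    SideRelations q (apothem q ℓ) ℓ m := by
  have h2 : 0 < Real.sinh (ℓ / 2) := Real.sinh_pos_iff.2 (half_pos hℓ)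
  have hS := sin_angle_pos hq
  have e : Real.sin (π / q) * Real.sinh (apothem q ℓ) =
      Real.sinh (m / 2) * Real.cosh (ℓ / 2) := by
    unfold apothem
    rw [Real.sinh_arsinh, Real.cot_eq_cos_div_sin, Real.tanh_eq_sinh_div_cosh, h]
    have := Real.cosh_pos (ℓ / 2)
    field_simp
  refine ⟨hq, hℓ, hm, ?_, e, h⟩
  have hc := Real.cosh_pos (apothem q ℓ)
  refine (pow_left_inj₀ (by positivity) (Real.cosh_pos _).le two_ne_zero).1 ?_
  rw [mul_pow, cosh_sq_sub (apothem q ℓ), cosh_sq_sub (m / 2)]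
  have q1 := Real.sin_sq_add_cos_sq (π / q)
  rw [h] at q1
  have := cosh_sq_sub (ℓ / 2)
  linear_combination (Real.sin (π / q) * Real.sinh (apothem q ℓ) +
    Real.sinh (m / 2) * Real.cosh (ℓ / 2)) * e + q1 + Real.sinh (m / 2) ^ 2 * this

lemma blueRelations (q : ℕ) (t : ℝ) [G : Good q t] : SideRelations q (apothem q t) t (s q t) :=
  sideRelations_of G.three_le G.pos (s_pos q t)
    ((cos_eq_sinh_mul_sinh q t).trans (mul_comm _ _))

lemma redRelations (q : ℕ) (t : ℝ) [G : Good q t] :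
    SideRelations q (apothem q (s q t)) (s q t) t :=
  sideRelations_of G.three_le (s_pos q t) G.pos (cos_eq_sinh_mul_sinh q t)

/-- The height over the blue side number `k`. -/
def blueH (q : ℕ) (t : ℝ) (k : ℤ) (z : ℍ) : ℝ := height (apothem q t) (2 * k * π / q) z

/-- The height over the red side number `k`. -/
def redH (q : ℕ) (t : ℝ) (k : ℤ) (z : ℍ) : ℝ := height (apothem q (s q t)) ((2 * k + 1) * π / q) z

/-- The rotation by `k` steps. -/
def turn (q : ℕ) (k : ℤ) (z : ℍ) : ℍ := rotation (2 * k * π / q) • z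

lemma mem_polygon {z : ℍ} : z ∈ polygon q t ↔ ∀ k : ℤ, 0 ≤ blueH q t k z ∧ 0 ≤ redH q t k z := by
  simp only [polygon, Set.mem_ofPred_eq, norm_rotation_inv_le_iff, blueH, redH]

lemma blueH_turn (j k : ℤ) (z : ℍ) : blueH q t k (turn q j z) = blueH q t (k - j) z := by
  unfold blueH turn
  rw [height_rotation]; congr 1; push_cast; ring

lemma redH_turn (j k : ℤ) (z : ℍ) : redH q t k (turn q j z) = redH q t (k - j) z := by
  unfold redH turn
  rw [height_rotation]; congr 1; push_cast; ring

lemma blueH_mirror (k : ℤ) (z : ℍ) : blueH q t k (mirror z) = blueH q t (-k) z := by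
  unfold blueH
  rw [height_mirror]; congr 1; push_cast; ring

lemma redH_mirror (k : ℤ) (z : ℍ) : redH q t k (mirror z) = redH q t (-k - 1) z := by
  unfold redH
  rw [height_mirror]; congr 1; push_cast; ring

lemma turn_turn (j k : ℤ) (z : ℍ) : turn q j (turn q k z) = turn q (j + k) z := by
  unfold turn
  rw [rotation_smul_smul]; congr 2; push_cast; ring

@[simp] lemma turn_zero (z : ℍ) : turn q 0 z = z := by
  unfold turn; simpa using rotation_zero_smul z

lemma dist_turn (k : ℤ) (z w : ℍ) : dist (turn q k z) (turn q k w) = dist z w :=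
  dist_rotation _ _ _

lemma turn_eq_iff {k : ℤ} {z w : ℍ} : turn q k z = w ↔ z = turn q (-k) w := by
  constructor
  · rintro rfl; simp [turn_turn]
  · rintro rfl; simp [turn_turn]

lemma exists_nat_index (hq : 3 ≤ q) (k : ℤ) : ∃ j : ℕ, j < q ∧ ∃ n : ℤ, k = j + q * n := by
  have h1 := Int.emod_nonneg k (b := q) (by omega)
  have h2 := Int.emod_lt_of_pos k (b := q) (by omega)
  refine ⟨(k % q).toNat, by omega, k / q, ?_⟩
  rw [Int.toNat_of_nonneg h1]
  exact (Int.emod_add_mul_ediv k q).symm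

lemma turn_mem {z : ℍ} (hz : z ∈ polygon q t) (k : ℤ) : turn q k z ∈ polygon q t := by
  rw [mem_polygon] at hz ⊢
  intro j
  rw [blueH_turn, redH_turn]
  exact hz _

lemma mirror_mem {z : ℍ} (hz : z ∈ polygon q t) : mirror z ∈ polygon q t := by
  rw [mem_polygon] at hz ⊢
  intro j
  rw [blueH_mirror, redH_mirror]
  exact ⟨(hz _).1, (hz _).2⟩

/-- The red geodesic number `0`. -/
lemma redSide_eq (u : ℝ) : redSide q t u = rotation (π / q) • perp (apothem q (s q t)) u := rfl

lemma blueH_zero_perp (u : ℝ) : blueH q t 0 (perp (apothem q t) u) = 0 := by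
  have := SideRelations.height_perp (apothem q t) u 0
  simp only [blueH]
  simpa using this

lemma redH_zero_redSide (u : ℝ) : redH q t 0 (redSide q t u) = 0 := by
  have := SideRelations.height_perp (apothem q (s q t)) u 0
  simp only [redH, redSide_eq, height_rotation]
  simpa using this

section
variable [G : Good q t]

lemma q_ne_zero (q : ℕ) (t : ℝ) [G : Good q t] : (q : ℝ) ≠ 0 := by
  have := G.three_le
  positivity

lemma turn_mul (t : ℝ) [Good q t] (n : ℤ) (z : ℍ) : turn q (q * n) z = z := by
  have := q_ne_zero q t
  unfold turn
  rw [show 2 * ((q * n : ℤ) : ℝ) * π / q = n * (2 * π) by push_cast; field_simp,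
    rotation_int_smul]

lemma blueH_add_mul (k n : ℤ) (z : ℍ) : blueH q t (k + q * n) z = blueH q t k z := by
  have := blueH_turn (q := q) (t := t) (q * -n) k z
  rw [turn_mul t] at this
  rw [this]; congr 1; ring

lemma redH_add_mul (k n : ℤ) (z : ℍ) : redH q t (k + q * n) z = redH q t k z := by
  have := redH_turn (q := q) (t := t) (q * -n) k z
  rw [turn_mul t] at this
  rw [this]; congr 1; ring

/-- Two perpendicular sides are orthogonal vectors of Minkowski space. -/
lemma sinh_mul_sinh_apothem : Real.sinh (apothem q t) * Real.sinh (apothem q (s q t)) =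
    Real.cosh (apothem q t) * Real.cosh (apothem q (s q t)) * Real.cos (π / q) := by
  have h := blueRelations q t
  have h' := redRelations q t
  have hS := (sin_angle_pos G.three_le).ne'
  apply mul_left_cancel₀ (mul_ne_zero hS hS)
  rw [h.cos_eq]
  linear_combination (Real.sin (π / q) * Real.sinh (apothem q (s q t))) * h.sin_mul_sinh +
    (Real.sinh (s q t / 2) * Real.cosh (t / 2)) * h'.sin_mul_sinh -
    (Real.sin (π / q) * Real.cosh (apothem q (s q t))) *
      (Real.sinh (s q t / 2) * Real.sinh (t / 2)) * h.sin_mul_cosh -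
    (Real.cosh (s q t / 2)) * (Real.sinh (s q t / 2) * Real.sinh (t / 2)) * h'.sin_mul_cosh

/-- The blue line meets the red line at a right angle at u = t/2, so the distance to the red line is
the arc length to this corner. -/
lemma redH_zero_perp (u : ℝ) : redH q t 0 (perp (apothem q t) u) = Real.sinh (t / 2 - u) := by
  have h := blueRelations q t
  have h' := redRelations q t
  have hS := (sin_angle_pos G.three_le).ne'
  have q1 := Real.sin_sq_add_cos_sq (π / q)
  have q2 := cosh_sq_sub (t / 2)
  have q3 := cosh_sq_sub (s q t / 2)
  unfold redH height
  rw [cT_perp, cX_perp, cY_perp, Real.sinh_sub]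
  simp only [Int.cast_zero, mul_zero, zero_add, one_mul]
  have e1 : Real.cosh (apothem q (s q t)) * Real.sin (π / q) = Real.cosh (t / 2) := by
    rw [mul_comm, h'.sin_mul_cosh]
  have e2 : Real.cosh (apothem q t) * Real.sinh (apothem q (s q t)) - Real.cosh (apothem q (s q t)) *
      Real.sinh (apothem q t) * Real.cos (π / q) = Real.sinh (t / 2) := by
    apply mul_left_cancel₀ (mul_ne_zero hS hS)
    have : Real.sin (π / q) * Real.sin (π / q) * (Real.cosh (apothem q t) *
      Real.sinh (apothem q (s q t)) - Real.cosh (apothem q (s q t)) *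
      Real.sinh (apothem q t) * Real.cos (π / q)) =
      (Real.sin (π / q) * Real.cosh (apothem q t)) * (Real.sin (π / q) *
        Real.sinh (apothem q (s q t))) - (Real.sin (π / q) * Real.cosh (apothem q (s q t))) *
      (Real.sin (π / q) * Real.sinh (apothem q t)) * Real.cos (π / q) := by ring
    rw [this, h.sin_mul_cosh, h.sin_mul_sinh, h'.sin_mul_cosh, h'.sin_mul_sinh, h.cos_eq]
    rw [h.cos_eq] at q1
    linear_combination (-Real.sinh (t / 2)) * q1 + Real.sinh (t / 2) * q3 - Real.sinh (t / 2) *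
      Real.sinh (s q t / 2) ^ 2 * q2
  linear_combination Real.cosh u * e2 - Real.sinh u * e1

lemma redH_neg_one_perp (u : ℝ) :
    redH q t (-1) (perp (apothem q t) u) = Real.sinh (t / 2 + u) := by
  have := redH_zero_perp (q := q) (t := t) (-u)
  rw [← mirror_perp, redH_mirror, sub_neg_eq_add] at this
  simpa using this

/-- The corner shared by the blue and the red side number `0`. -/
lemma redSide_neg_half : redSide q t (-(s q t / 2)) = perp (apothem q t) (t / 2) := by
  have h := blueRelations q t
  have h' := redRelations q t
  have hS := (sin_angle_pos G.three_le).ne'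
  have q1 := Real.sin_sq_add_cos_sq (π / q)
  have q2 := cosh_sq_sub (t / 2)
  have q3 := cosh_sq_sub (s q t / 2)
  apply ext_coords
  · rw [redSide_eq, cX_rotation, cX_perp, cY_perp, cX_perp, Real.cosh_neg, Real.sinh_neg]
    apply mul_left_cancel₀ hS
    have e : Real.sin (π / q) * (Real.sinh (apothem q (s q t)) * Real.cosh (s q t / 2) *
        Real.cos (π / q) - -Real.sinh (s q t / 2) * Real.sin (π / q)) =
        (Real.sin (π / q) * Real.sinh (apothem q (s q t))) * Real.cosh (s q t / 2) *
        Real.cos (π / q) + Real.sinh (s q t / 2) * Real.sin (π / q) ^ 2 := by ring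
    rw [e, h'.sin_mul_sinh, ← mul_assoc, h.sin_mul_sinh, h.cos_eq]
    rw [h.cos_eq] at q1
    linear_combination Real.sinh (s q t / 2) * q1 - Real.sinh (s q t / 2) * q2 +
      Real.sinh (t / 2) ^ 2 * Real.sinh (s q t / 2) * q3
  · rw [redSide_eq, cY_rotation, cX_perp, cY_perp, cY_perp, Real.cosh_neg, Real.sinh_neg]
    have e : Real.sinh (apothem q (s q t)) * Real.cosh (s q t / 2) * Real.sin (π / q) +
        -Real.sinh (s q t / 2) * Real.cos (π / q) = (Real.sin (π / q) *
        Real.sinh (apothem q (s q t))) * Real.cosh (s q t / 2) -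
        Real.sinh (s q t / 2) * Real.cos (π / q) := by ring
    rw [e, h'.sin_mul_sinh, h.cos_eq]
    linear_combination Real.sinh (t / 2) * q3

/-- The composition is the reflection in the axis through the midpoint of the red side; it transfers
facts about one corner of the side to the other. -/
lemma turn_one_mirror_redSide (u : ℝ) : turn q 1 (mirror (redSide q t u)) = redSide q t (-u) := by
  rw [redSide_eq, mirror_rotation, mirror_perp, redSide_eq, turn, rotation_smul_smul]
  congr 2; push_cast; ring

lemma redSide_half : redSide q t (s q t / 2) = turn q 1 (perp (apothem q t) (-(t / 2))) := by
  rw [← neg_neg (s q t / 2), ← turn_one_mirror_redSide, redSide_neg_half, mirror_perp]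

lemma blueH_zero_redSide (u : ℝ) : blueH q t 0 (redSide q t u) = Real.sinh (s q t / 2 + u) := by
  have h := blueRelations q t
  have h' := redRelations q t
  have hS := (sin_angle_pos G.three_le).ne'
  have q1 := Real.sin_sq_add_cos_sq (π / q)
  have q2 := cosh_sq_sub (t / 2)
  have q3 := cosh_sq_sub (s q t / 2)
  unfold blueH
  rw [redSide_eq, height_rotation]
  unfold height
  rw [cT_perp, cX_perp, cY_perp, Real.sinh_add]
  simp only [Int.cast_zero, mul_zero, zero_mul, zero_div, zero_sub, Real.cos_neg, Real.sin_neg]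
  have e1 : Real.cosh (apothem q t) * Real.sin (π / q) = Real.cosh (s q t / 2) := by
    rw [mul_comm, h.sin_mul_cosh]
  have e2 : Real.cosh (apothem q (s q t)) * Real.sinh (apothem q t) - Real.cosh (apothem q t) *
      Real.sinh (apothem q (s q t)) * Real.cos (π / q) = Real.sinh (s q t / 2) := by
    apply mul_left_cancel₀ (mul_ne_zero hS hS)
    have : Real.sin (π / q) * Real.sin (π / q) * (Real.cosh (apothem q (s q t)) *
      Real.sinh (apothem q t) - Real.cosh (apothem q t) *
      Real.sinh (apothem q (s q t)) * Real.cos (π / q)) =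
      (Real.sin (π / q) * Real.cosh (apothem q (s q t))) * (Real.sin (π / q) *
        Real.sinh (apothem q t)) - (Real.sin (π / q) * Real.cosh (apothem q t)) *
      (Real.sin (π / q) * Real.sinh (apothem q (s q t))) * Real.cos (π / q) := by ring
    rw [this, h.sin_mul_cosh, h.sin_mul_sinh, h'.sin_mul_cosh, h'.sin_mul_sinh, h.cos_eq]
    rw [h.cos_eq] at q1
    linear_combination (-Real.sinh (s q t / 2)) * q1 + Real.sinh (s q t / 2) * q2 -
      Real.sinh (s q t / 2) * Real.sinh (t / 2) ^ 2 * q3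
  linear_combination Real.cosh u * e2 + Real.sinh u * e1

lemma blueH_one_redSide (u : ℝ) : blueH q t 1 (redSide q t u) = Real.sinh (s q t / 2 - u) := by
  have := blueH_zero_redSide (q := q) (t := t) (-u)
  rw [← turn_one_mirror_redSide, blueH_turn, blueH_mirror, ← sub_eq_add_neg] at this
  simpa using this

/-- On this line `cY` is the hyperbolic sine of arc length, which gives the parameter; the two
adjacent red sides bound it by t/2. -/
lemma exists_perp {z : ℍ} (hz : z ∈ polygon q t) (h0 : blueH q t 0 z = 0) :
    ∃ u, |u| ≤ t / 2 ∧ z = perp (apothem q t) u := by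
  have e : z = perp (apothem q t) (Real.arsinh (cY z)) := by
    have hT := cT_pos z
    have hq := cT_sq z
    have hc := Real.cosh_pos (apothem q t)
    have hs := (blueRelations q t).sinh_pos
    have k1 := cosh_sq_sub (apothem q t)
    simp only [blueH, height, Int.cast_zero, mul_zero, zero_mul, zero_div, Real.cos_zero,
      Real.sin_zero, mul_one, add_zero] at h0
    apply ext_coords
    · rw [cX_perp, Real.cosh_arsinh]
      have hX : 0 < cX z := by
        have : 0 < Real.cosh (apothem q t) * cX z := by nlinarith
        exact (mul_pos_iff_of_pos_left hc).1 this
      refine (pow_left_inj₀ hX.le (by positivity) two_ne_zero).1 ?_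
      rw [mul_pow, Real.sq_sqrt (by positivity)]
      linear_combination (-(cX z) ^ 2) * k1 + Real.sinh (apothem q t) ^ 2 * hq -
        (cT z * Real.sinh (apothem q t) + Real.cosh (apothem q t) * cX z) * h0
    · rw [cY_perp, Real.sinh_arsinh]
  refine ⟨Real.arsinh (cY z), ?_, e⟩
  have h1 := (mem_polygon.1 hz 0).2
  have h2 := (mem_polygon.1 hz (-1)).2
  rw [e, redH_zero_perp, Real.sinh_nonneg_iff] at h1
  rw [e, redH_neg_one_perp, Real.sinh_nonneg_iff] at h2
  exact abs_le.2 ⟨by linarith, by linarith⟩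

lemma exists_redSide {z : ℍ} (hz : z ∈ polygon q t) (h0 : redH q t 0 z = 0) :
    ∃ u, |u| ≤ s q t / 2 ∧ z = redSide q t u := by
  obtain ⟨w, hw⟩ : ∃ w, w = rotation (-(π / q)) • z := ⟨_, rfl⟩
  have hzw : z = rotation (π / q) • w := by
    rw [hw, rotation_smul_smul, add_neg_cancel, rotation_zero_smul]
  have h0' : height (apothem q (s q t)) 0 w = 0 := by
    rw [hzw] at h0
    simp only [redH, height_rotation, Int.cast_zero, mul_zero, zero_add, one_mul, sub_self] at h0
    exact h0
  have e : w = perp (apothem q (s q t)) (Real.arsinh (cY w)) := by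
    have hT := cT_pos w
    have hq := cT_sq w
    have hc := Real.cosh_pos (apothem q (s q t))
    have hs := (redRelations q t).sinh_pos
    have k1 := cosh_sq_sub (apothem q (s q t))
    simp only [height, Real.cos_zero, Real.sin_zero, mul_one, mul_zero, add_zero] at h0'
    apply ext_coords
    · rw [cX_perp, Real.cosh_arsinh]
      have hX : 0 < cX w := by
        have : 0 < Real.cosh (apothem q (s q t)) * cX w := by nlinarith
        exact (mul_pos_iff_of_pos_left hc).1 this
      refine (pow_left_inj₀ hX.le (by positivity) two_ne_zero).1 ?_
      rw [mul_pow, Real.sq_sqrt (by positivity)]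
      linear_combination (-(cX w) ^ 2) * k1 + Real.sinh (apothem q (s q t)) ^ 2 * hq -
        (cT w * Real.sinh (apothem q (s q t)) + Real.cosh (apothem q (s q t)) * cX w) * h0'
    · rw [cY_perp, Real.sinh_arsinh]
  have e' : z = redSide q t (Real.arsinh (cY w)) := by rw [redSide_eq, ← e, hzw]
  refine ⟨_, ?_, e'⟩
  have h1 := (mem_polygon.1 hz 0).1
  have h2 := (mem_polygon.1 hz 1).1
  rw [e', blueH_zero_redSide, Real.sinh_nonneg_iff] at h1
  rw [e', blueH_one_redSide, Real.sinh_nonneg_iff] at h2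
  exact abs_le.2 ⟨by linarith, by linarith⟩

/-! ### The fundamental sector -/

/-- The sector between the directions of the blue and of the red side number `0`. -/
def Sector (q : ℕ) (z : ℍ) : Prop :=
  0 ≤ cY z ∧ 0 ≤ cX z * Real.sin (π / q) - cY z * Real.cos (π / q)

lemma blueH_sub_blueH_zero (k : ℤ) (z : ℍ) : blueH q t k z - blueH q t 0 z =
    2 * Real.cosh (apothem q t) * Real.sin (k * (π / q)) *
      (cX z * Real.sin (k * (π / q)) - cY z * Real.cos (k * (π / q))) := by
  unfold blueH height
  rw [show 2 * (k : ℝ) * π / q = 2 * (k * (π / q)) by ring]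
  simp only [Int.cast_zero, mul_zero, zero_mul, zero_div, Real.cos_zero, Real.sin_zero,
    Real.sin_two_mul, Real.cos_two_mul']
  linear_combination (-Real.cosh (apothem q t) * cX z) * Real.sin_sq_add_cos_sq (k * (π / q))

lemma redH_sub_redH_zero (k : ℤ) (z : ℍ) : redH q t k z - redH q t 0 z =
    2 * Real.cosh (apothem q (s q t)) * Real.sin (k * (π / q)) *
      (cX z * Real.sin ((k + 1) * (π / q)) - cY z * Real.cos ((k + 1) * (π / q))) := by
  unfold redH height
  rw [show (2 * (k : ℝ) + 1) * π / q = (k + 1) * (π / q) + k * (π / q) by ring,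
    show (2 * ((0 : ℤ) : ℝ) + 1) * π / q = (k + 1) * (π / q) - k * (π / q) by push_cast; ring]
  simp only [Real.cos_add ((k + 1) * (π / q)), Real.sin_add ((k + 1) * (π / q)),
    Real.cos_sub, Real.sin_sub]
  ring

/-- Multiplied by sin(π/q), the bracket is the combination of the two sector inequalities with the
nonnegative coefficients sin((k - 1)π/q) and sin(kπ/q). -/
lemma sector_bracket_nonneg {z : ℍ} (hz : Sector q z) (hq : 3 ≤ q) {k : ℕ} (h1 : 1 ≤ k)
    (h2 : k ≤ q) :
    0 ≤ cX z * Real.sin (k * (π / q)) - cY z * Real.cos (k * (π / q)) := by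
  have hS := sin_angle_pos hq
  have a1 := sin_natCast_mul_nonneg hq h2
  have a2 := sin_natCast_mul_nonneg (k := k - 1) hq (by omega)
  rw [Nat.cast_sub h1, Nat.cast_one, sub_mul, one_mul, Real.sin_sub] at a2
  have := mul_nonneg hz.2 a1
  have := mul_nonneg hz.1 a2
  have h3 : 0 ≤ Real.sin (π / q) *
      (cX z * Real.sin (k * (π / q)) - cY z * Real.cos (k * (π / q))) := by linarith
  exact (mul_nonneg_iff_of_pos_left hS).1 h3

lemma blueH_zero_le_of_sector {z : ℍ} (hz : Sector q z) {k : ℕ} (h2 : k < q) :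
    blueH q t 0 z ≤ blueH q t k z := by
  rcases Nat.eq_zero_or_pos k with rfl | h1
  · simp
  have e := blueH_sub_blueH_zero (q := q) (t := t) k z
  rw [Int.cast_natCast] at e
  have a1 := sin_natCast_mul_nonneg G.three_le h2.le
  have a2 := sector_bracket_nonneg hz G.three_le h1 h2.le
  have := Real.cosh_pos (apothem q t)
  have : 0 ≤ 2 * Real.cosh (apothem q t) * Real.sin (k * (π / q)) *
      (cX z * Real.sin (k * (π / q)) - cY z * Real.cos (k * (π / q))) := by positivity
  linarith

lemma redH_zero_le_of_sector {z : ℍ} (hz : Sector q z) {k : ℕ} (h2 : k < q) :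
    redH q t 0 z ≤ redH q t k z := by
  have e := redH_sub_redH_zero (q := q) (t := t) k z
  rw [Int.cast_natCast] at e
  have a1 := sin_natCast_mul_nonneg G.three_le h2.le
  have a2 := sector_bracket_nonneg hz G.three_le (k := k + 1) (by omega) h2
  push_cast at a2
  have := Real.cosh_pos (apothem q (s q t))
  have : 0 ≤ 2 * Real.cosh (apothem q (s q t)) * Real.sin (k * (π / q)) *
      (cX z * Real.sin ((k + 1) * (π / q)) - cY z * Real.cos ((k + 1) * (π / q))) := by positivity
  linarith

/-- For a point of the sector the sides number 0 have the smallest heights, so only these two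
conditions have to be checked. -/
lemma mem_polygon_of_sector {z : ℍ} (hz : Sector q z) (h1 : 0 ≤ blueH q t 0 z)
    (h2 : 0 ≤ redH q t 0 z) : z ∈ polygon q t := by
  rw [mem_polygon]
  intro k
  obtain ⟨j, hj, n, rfl⟩ := exists_nat_index G.three_le k
  rw [blueH_add_mul, redH_add_mul]
  exact ⟨h1.trans (blueH_zero_le_of_sector hz hj), h2.trans (redH_zero_le_of_sector hz hj)⟩

/-- The points of the polygon that are on no other side than the blue and the red side
number `0`. -/
def Core (q : ℕ) (t : ℝ) (z : ℍ) : Prop :=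
  z ∈ polygon q t ∧ ∀ k : ℕ, 1 ≤ k → k < q → 0 < blueH q t k z ∧ 0 < redH q t k z

lemma blueH_pos_of_blueH_zero {z : ℍ} (hz : z ∈ polygon q t) (h0 : blueH q t 0 z = 0) {k : ℕ}
    (h1 : 1 ≤ k) (h2 : k < q) : 0 < blueH q t k z := by
  obtain ⟨u, hu, rfl⟩ := exists_perp hz h0
  have := ((blueRelations q t).sinh_le_height u h1 h2).1
  have e : blueH q t k (perp (apothem q t) u) =
      height (apothem q t) (2 * (k * (π / q))) (perp (apothem q t) u) := by
    unfold blueH; congr 1; push_cast; ring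
  rw [e]
  exact (Real.sinh_pos_iff.2 (s_pos q t)).trans_le this

lemma redH_pos_of_redH_zero {z : ℍ} (hz : z ∈ polygon q t) (h0 : redH q t 0 z = 0) {k : ℕ}
    (h1 : 1 ≤ k) (h2 : k < q) : 0 < redH q t k z := by
  obtain ⟨u, hu, rfl⟩ := exists_redSide hz h0
  have := ((redRelations q t).sinh_le_height u h1 h2).1
  have e : redH q t k (redSide q t u) =
      height (apothem q (s q t)) (2 * (k * (π / q))) (perp (apothem q (s q t)) u) := by
    unfold redH; rw [redSide_eq, height_rotation]; congr 1; push_cast; ring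
  rw [e]
  exact (Real.sinh_pos_iff.2 G.pos).trans_le this

/-- A point of the sector on a side number k would also be on the side number 0 of this colour,
whose height is no larger; but different sides of one colour are disjoint. -/
lemma core_of_sector {z : ℍ} (hz : z ∈ polygon q t) (h : Sector q z) : Core q t z := by
  refine ⟨hz, fun k h1 h2 => ⟨?_, ?_⟩⟩
  · refine lt_of_le_of_ne (mem_polygon.1 hz k).1 fun h0 => ?_
    have := blueH_zero_le_of_sector (t := t) h h2
    have := blueH_pos_of_blueH_zero hz (le_antisymm (this.trans h0.ge) (mem_polygon.1 hz 0).1) h1 h2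
    linarith
  · refine lt_of_le_of_ne (mem_polygon.1 hz k).2 fun h0 => ?_
    have := redH_zero_le_of_sector (t := t) h h2
    have := redH_pos_of_redH_zero hz (le_antisymm (this.trans h0.ge) (mem_polygon.1 hz 0).2) h1 h2
    linarith

/-- `mirror` if `o` is true, the identity otherwise. -/
def flipIf (o : Bool) (z : ℍ) : ℍ := if o then mirror z else z

@[simp] lemma flipIf_true (z : ℍ) : flipIf true z = mirror z := rfl
@[simp] lemma flipIf_false (z : ℍ) : flipIf false z = z := rfl
@[simp] lemma flipIf_flipIf (o : Bool) (z : ℍ) : flipIf o (flipIf o z) = z := by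
  cases o <;> simp

lemma dist_flipIf (o : Bool) (z w : ℍ) : dist (flipIf o z) (flipIf o w) = dist z w := by
  cases o <;> simp [dist_mirror]

lemma flipIf_mem {z : ℍ} (hz : z ∈ polygon q t) (o : Bool) : flipIf o z ∈ polygon q t := by
  cases o
  · exact hz
  · exact mirror_mem hz

lemma mirror_flipIf (o : Bool) (z : ℍ) : mirror (flipIf o z) = flipIf (!o) z := by
  cases o <;> simp

/-- The sector is a fundamental domain of the dihedral group of the polygon: rounding the argument
to a multiple of 2π/q leaves an angle of size at most π/q, whose sign decides about the mirror. -/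
lemma exists_sector (hq : 3 ≤ q) (z : ℍ) :
    ∃ (k : ℤ) (o : Bool), Sector q (flipIf o (turn q k z)) := by
  set φ := π / q with hφ
  have hφ0 : 0 < φ := angle_pos hq
  have hφ1 : φ ≤ π / 3 := angle_le hq
  let ζ : ℂ := ⟨cX z, cY z⟩
  set r := ‖ζ‖ with hr
  set ψ := Complex.arg ζ with hψ
  have hX : cX z = r * Real.cos ψ := (Complex.norm_mul_cos_arg ζ).symm
  have hY : cY z = r * Real.sin ψ := (Complex.norm_mul_sin_arg ζ).symm
  have hr0 : 0 ≤ r := norm_nonneg _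
  set k := round (ψ / (2 * φ)) with hk
  have hround := abs_sub_round (ψ / (2 * φ))
  rw [← hk] at hround
  set ψ' := ψ - 2 * k * φ with hψ'
  have hb : |ψ'| ≤ φ := by
    have : ψ' = (ψ / (2 * φ) - k) * (2 * φ) := by rw [hψ']; field_simp
    rw [this, abs_mul, abs_of_pos (by positivity : 0 < 2 * φ)]
    nlinarith
  have hX' : cX (turn q (-k) z) = r * Real.cos ψ' := by
    rw [turn, cX_rotation, hX, hY, hψ', Real.cos_sub]
    have : 2 * ((-k : ℤ) : ℝ) * π / q = -(2 * k * φ) := by rw [hφ]; push_cast; ring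
    rw [this, Real.cos_neg, Real.sin_neg]; ring
  have hY' : cY (turn q (-k) z) = r * Real.sin ψ' := by
    rw [turn, cY_rotation, hX, hY, hψ', Real.sin_sub]
    have : 2 * ((-k : ℤ) : ℝ) * π / q = -(2 * k * φ) := by rw [hφ]; push_cast; ring
    rw [this, Real.cos_neg, Real.sin_neg]; ring
  have hpi := pi_pos
  rcases le_total 0 ψ' with h | h
  · rw [abs_of_nonneg h] at hb
    refine ⟨-k, false, ?_, ?_⟩
    · rw [flipIf_false, hY']
      exact mul_nonneg hr0 (Real.sin_nonneg_of_nonneg_of_le_pi h (by linarith))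
    · rw [flipIf_false, hX', hY']
      have := mul_nonneg hr0 (Real.sin_nonneg_of_nonneg_of_le_pi (x := φ - ψ') (by linarith)
        (by linarith))
      rw [Real.sin_sub] at this
      linarith
  · rw [abs_of_nonpos h] at hb
    refine ⟨-k, true, ?_, ?_⟩
    · rw [flipIf_true, cY_mirror, hY', ← mul_neg, ← Real.sin_neg]
      exact mul_nonneg hr0 (Real.sin_nonneg_of_nonneg_of_le_pi (by linarith) (by linarith))
    · rw [flipIf_true, cX_mirror, cY_mirror, hX', hY']
      have := mul_nonneg hr0 (Real.sin_nonneg_of_nonneg_of_le_pi (x := φ - -ψ') (by linarith)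
        (by linarith))
      rw [Real.sin_sub, Real.cos_neg, Real.sin_neg] at this
      linarith

lemma sector_perp {u : ℝ} (h0 : 0 ≤ u) : Sector q (perp (apothem q t) u) := by
  have h := blueRelations q t
  refine ⟨by rw [cY_perp]; exact Real.sinh_nonneg_iff.2 h0, ?_⟩
  rw [cX_perp, cY_perp, h.cos_eq]
  have : Real.sinh (apothem q t) * Real.cosh u * Real.sin (π / q) -
      Real.sinh u * (Real.sinh (s q t / 2) * Real.sinh (t / 2)) =
      Real.sinh (s q t / 2) * Real.cosh (t / 2 - u) := by
    rw [Real.cosh_sub]; linear_combination Real.cosh u * h.sin_mul_sinh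
  rw [this]
  exact mul_nonneg (Real.sinh_nonneg_iff.2 (half_pos (s_pos q t)).le) (Real.cosh_pos _).le

lemma sector_redSide {u : ℝ} (h0 : u ≤ 0) : Sector q (redSide q t u) := by
  have h := redRelations q t
  constructor
  · rw [redSide_eq, cY_rotation, cX_perp, cY_perp, h.cos_eq]
    have : Real.sinh (apothem q (s q t)) * Real.cosh u * Real.sin (π / q) +
      Real.sinh u * (Real.sinh (t / 2) * Real.sinh (s q t / 2)) =
      Real.sinh (t / 2) * Real.cosh (s q t / 2 + u) := by
      rw [Real.cosh_add]; linear_combination Real.cosh u * h.sin_mul_sinh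
    rw [this]
    exact mul_nonneg (Real.sinh_nonneg_iff.2 (half_pos G.pos).le) (Real.cosh_pos _).le
  · rw [redSide_eq, cY_rotation, cX_rotation, cX_perp, cY_perp]
    have : 0 ≤ -Real.sinh u := by
      rw [← Real.sinh_neg]; exact Real.sinh_nonneg_iff.2 (by linarith)
    nlinarith [Real.sin_sq_add_cos_sq (π / q)]

lemma perp_mem {u : ℝ} (hu : |u| ≤ t / 2) : perp (apothem q t) u ∈ polygon q t := by
  have key : ∀ u, 0 ≤ u → u ≤ t / 2 → perp (apothem q t) u ∈ polygon q t := fun u h0 h1 =>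
    mem_polygon_of_sector (sector_perp h0) (blueH_zero_perp u).ge
      (by rw [redH_zero_perp]; exact Real.sinh_nonneg_iff.2 (by linarith))
  rcases le_total 0 u with h | h
  · exact key u h (by rwa [abs_of_nonneg h] at hu)
  · rw [← mirror_mirror (perp _ u), mirror_perp]
    exact mirror_mem (key (-u) (by linarith) (by rwa [abs_of_nonpos h] at hu))

lemma redSide_mem {u : ℝ} (hu : |u| ≤ s q t / 2) : redSide q t u ∈ polygon q t := by
  have key : ∀ u, u ≤ 0 → -u ≤ s q t / 2 → redSide q t u ∈ polygon q t := fun u h0 h1 =>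
    mem_polygon_of_sector (sector_redSide h0)
      (by rw [blueH_zero_redSide]; exact Real.sinh_nonneg_iff.2 (by linarith))
      (redH_zero_redSide u).ge
  rcases le_total u 0 with h | h
  · exact key u h (by rwa [abs_of_nonpos h] at hu)
  · rw [← neg_neg u, ← turn_one_mirror_redSide]
    exact turn_mem (mirror_mem (key (-u) (by linarith) (by rwa [neg_neg, ← abs_of_nonneg h]))) 1

/-! ### Reflections in the sides number `0` -/

/-- The reflection in the blue side number `0`. -/
def blueRefl (q : ℕ) (t : ℝ) (z : ℍ) : ℍ := reflect (apothem q t) 0 z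

/-- The reflection in the red side number `0`. -/
def redRefl (q : ℕ) (t : ℝ) (z : ℍ) : ℍ := reflect (apothem q (s q t)) (π / q) z

lemma blueH_zero_eq (z : ℍ) : blueH q t 0 z = height (apothem q t) 0 z := by simp [blueH]

lemma redH_zero_eq (z : ℍ) : redH q t 0 z = height (apothem q (s q t)) (π / q) z := by
  simp [redH]

lemma blueH_blueRefl (z : ℍ) : blueH q t 0 (blueRefl q t z) = -blueH q t 0 z := by
  rw [blueH_zero_eq, blueH_zero_eq, blueRefl, height_reflect]

lemma redH_redRefl (z : ℍ) : redH q t 0 (redRefl q t z) = -redH q t 0 z := by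
  rw [redH_zero_eq, redH_zero_eq, redRefl, height_reflect]

lemma redH_blueRefl (z : ℍ) : redH q t 0 (blueRefl q t z) = redH q t 0 z := by
  rw [redH_zero_eq, redH_zero_eq, blueRefl, height_reflect_other]
  rw [sinh_mul_sinh_apothem, zero_sub, Real.cos_neg]

lemma blueH_redRefl (z : ℍ) : blueH q t 0 (redRefl q t z) = blueH q t 0 z := by
  rw [blueH_zero_eq, blueH_zero_eq, redRefl, height_reflect_other]
  rw [mul_comm, sinh_mul_sinh_apothem, sub_zero]; ring

lemma blueH_one_redRefl (z : ℍ) : blueH q t 1 (redRefl q t z) = blueH q t 1 z := by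
  rw [blueH, blueH, redRefl, height_reflect_other]
  rw [mul_comm, sinh_mul_sinh_apothem,
    show π / q - 2 * ((1 : ℤ) : ℝ) * π / q = -(π / q) by push_cast; ring, Real.cos_neg]
  ring

@[simp] lemma blueRefl_blueRefl (z : ℍ) : blueRefl q t (blueRefl q t z) = z :=
  reflect_reflect _ _ _

@[simp] lemma redRefl_redRefl (z : ℍ) : redRefl q t (redRefl q t z) = z := reflect_reflect _ _ _

lemma sinh_add_eq (x v : ℝ) :
    Real.sinh (x + v) = Real.sinh (x - v) + 2 * Real.sinh v * Real.cosh x := by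
  rw [Real.sinh_add, Real.sinh_sub]; ring

lemma cosh_add_eq (x v : ℝ) :
    Real.cosh (x + v) = Real.cosh (x - v) + 2 * Real.sinh v * Real.sinh x := by
  rw [Real.cosh_add, Real.cosh_sub]; ring

/-- The red line is perpendicular to the blue line, so its reflection preserves the blue line and
reverses it about the corner u = t/2. This is why blue sides continue straight into the other copy.
-/
lemma redRefl_perp (u : ℝ) : redRefl q t (perp (apothem q t) u) = perp (apothem q t) (t - u) := by
  have h := blueRelations q t
  have h' := redRelations q t
  have hS := (sin_angle_pos G.three_le).ne'
  have e1 := redH_zero_perp (q := q) (t := t) u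
  rw [redH_zero_eq] at e1
  have t1 : Real.sinh (t - u) = Real.sinh u + 2 * Real.sinh (t / 2 - u) * Real.cosh (t / 2) := by
    convert sinh_add_eq (t / 2) (t / 2 - u) using 2
    · ring
    · congr 1; ring
  have t2 : Real.cosh (t - u) = Real.cosh u + 2 * Real.sinh (t / 2 - u) * Real.sinh (t / 2) := by
    convert cosh_add_eq (t / 2) (t / 2 - u) using 2
    · ring
    · congr 1; ring
  apply ext_coords
  · rw [redRefl, cX_reflect, e1, cX_perp, cX_perp, t2]
    apply mul_left_cancel₀ hS
    rw [h.cos_eq]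
    linear_combination (2 * Real.sinh (t / 2 - u) * Real.sinh (s q t / 2) * Real.sinh (t / 2)) *
      h'.sin_mul_cosh - 2 * Real.sinh (t / 2 - u) * Real.sinh (t / 2) * h.sin_mul_sinh
  · rw [redRefl, cY_reflect, e1, cY_perp, cY_perp, t1]
    linear_combination (2 * Real.sinh (t / 2 - u)) * h'.sin_mul_cosh

lemma blueRefl_redSide (u : ℝ) : blueRefl q t (redSide q t u) = redSide q t (-s q t - u) := by
  have h := blueRelations q t
  have h' := redRelations q t
  have hS := (sin_angle_pos G.three_le).ne'
  have q1 := Real.sin_sq_add_cos_sq (π / q)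
  have e1 := blueH_zero_redSide (q := q) (t := t) u
  rw [blueH_zero_eq] at e1
  set m := s q t with hm
  have t1 : Real.sinh (-m - u) = Real.sinh u - 2 * Real.sinh (m / 2 + u) * Real.cosh (m / 2) := by
    have := sinh_add_eq (m / 2) (m / 2 + u)
    rw [show m / 2 + (m / 2 + u) = -(-m - u) by ring, show m / 2 - (m / 2 + u) = -u by ring,
      Real.sinh_neg, Real.sinh_neg] at this
    linarith
  have t2 : Real.cosh (-m - u) = Real.cosh u + 2 * Real.sinh (m / 2 + u) * Real.sinh (m / 2) := by
    have := cosh_add_eq (m / 2) (m / 2 + u)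
    rwa [show m / 2 + (m / 2 + u) = -(-m - u) by ring, show m / 2 - (m / 2 + u) = -u by ring,
      Real.cosh_neg, Real.cosh_neg] at this
  apply ext_coords
  · rw [blueRefl, cX_reflect, e1, redSide_eq, redSide_eq, cX_rotation, cX_rotation, cX_perp,
      cX_perp, cY_perp, cY_perp, t1, t2, Real.cos_zero, h.cos_eq]
    rw [h.cos_eq] at q1
    apply mul_left_cancel₀ hS
    have k := Real.cosh_sq (m / 2)
    linear_combination 2 * Real.sinh (m / 2 + u) * h.sin_mul_cosh -
      2 * Real.sinh (m / 2 + u) * Real.sinh (m / 2) * (Real.sinh (m / 2) * Real.sinh (t / 2)) *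
        h'.sin_mul_sinh - 2 * Real.sinh (m / 2 + u) * Real.cosh (m / 2) * q1
  · rw [blueRefl, cY_reflect, e1, redSide_eq, redSide_eq, cY_rotation, cY_rotation, cX_perp,
      cX_perp, cY_perp, cY_perp, t1, t2, Real.sin_zero, h.cos_eq]
    linear_combination (-2) * Real.sinh (m / 2 + u) * Real.sinh (m / 2) * h'.sin_mul_sinh

end

end
end RightAngled

namespace RightAngled
noncomputable section

open Real

set_option linter.unusedSectionVars false

/-! ### The identifications -/

variable {D : Type*}

/-- Every vertex has degree `q`, and there are no loops. -/
class Loopless (M : SurfaceMap D) (q : ℕ) : Prop where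
  period : ∀ d, Function.minimalPeriod M.rot d = q
  not_sameVertex : ∀ d, ¬ M.SameVertex d (M.rev d)

section
variable (M : SurfaceMap D) {q : ℕ} [L : Loopless M q]

lemma rot_zpow_eq_iff (k : ℤ) (d : D) : (M.rot ^ k) d = d ↔ (q : ℤ) ∣ k := by
  have := MulAction.zpow_smul_eq_iff_minimalPeriod_dvd (a := M.rot) (b := d) (n := k)
  rw [Equiv.Perm.smul_def] at this
  rw [this, ← L.period d]
  rfl

lemma rot_zpow_zpow (j k : ℤ) (d : D) : (M.rot ^ j) ((M.rot ^ k) d) = (M.rot ^ (j + k)) d := by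
  rw [zpow_add, Equiv.Perm.mul_apply]

/-- The absence of loops in the form in which it is used: the polygons on the two sides of a blue
side belong to different vertices. -/
lemma not_rot_rev (q : ℕ) [L : Loopless M q] {d e : D} {j k : ℤ} (h1 : d = (M.rot ^ j) e)
    (h2 : M.rev d = (M.rot ^ k) e) : False := by
  refine L.not_sameVertex d ⟨k - j, ?_⟩
  rw [h2, h1, rot_zpow_zpow, sub_add_cancel]

end

/-- The point is on some red side. -/
def OnRed (q : ℕ) (t : ℝ) (z : ℍ) : Prop := ∃ k : ℤ, redH q t k z = 0

section
variable {q : ℕ} {t : ℝ}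

lemma OnRed.turn {z : ℍ} (h : OnRed q t z) (k : ℤ) : OnRed q t (turn q k z) := by
  obtain ⟨j, hj⟩ := h
  exact ⟨j + k, by rw [redH_turn, add_sub_cancel_right, hj]⟩

lemma OnRed.mirror {z : ℍ} (h : OnRed q t z) : OnRed q t (mirror z) := by
  obtain ⟨j, hj⟩ := h
  exact ⟨-j - 1, by rw [redH_mirror, ← hj]; congr 1; ring⟩

lemma OnRed.flipIf {z : ℍ} (h : OnRed q t z) (o : Bool) : OnRed q t (flipIf o z) := by
  cases o
  · exact h
  · exact h.mirror

variable [G : Good q t]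

lemma dvd_of_blueH {z : ℍ} (hz : z ∈ polygon q t) (h0 : blueH q t 0 z = 0) {k : ℤ}
    (hk : blueH q t k z = 0) : (q : ℤ) ∣ k := by
  obtain ⟨j, hj, n, rfl⟩ := exists_nat_index G.three_le k
  rw [blueH_add_mul] at hk
  rcases Nat.eq_zero_or_pos j with rfl | h1
  · simp
  · exact absurd hk (blueH_pos_of_blueH_zero hz h0 h1 hj).ne'

lemma Core.dvd_of_blueH {z : ℍ} (hz : Core q t z) {k : ℤ} (hk : blueH q t k z = 0) :
    (q : ℤ) ∣ k := by
  obtain ⟨j, hj, n, rfl⟩ := exists_nat_index G.three_le k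
  rw [blueH_add_mul] at hk
  rcases Nat.eq_zero_or_pos j with rfl | h1
  · simp
  · exact absurd hk (hz.2 j h1 hj).1.ne'

lemma Core.dvd_of_redH {z : ℍ} (hz : Core q t z) {k : ℤ} (hk : redH q t k z = 0) :
    (q : ℤ) ∣ k := by
  obtain ⟨j, hj, n, rfl⟩ := exists_nat_index G.three_le k
  rw [redH_add_mul] at hk
  rcases Nat.eq_zero_or_pos j with rfl | h1
  · simp
  · exact absurd hk (hz.2 j h1 hj).2.ne'

lemma turn_of_dvd (t : ℝ) [Good q t] {k : ℤ} (h : (q : ℤ) ∣ k) (z : ℍ) : turn q k z = z := by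
  obtain ⟨n, rfl⟩ := h
  exact turn_mul t n z

lemma Core.redH_zero_of_onRed {z : ℍ} (hz : Core q t z) (h : OnRed q t z) : redH q t 0 z = 0 := by
  obtain ⟨k, hk⟩ := h
  obtain ⟨n, rfl⟩ := hz.dvd_of_redH hk
  have := redH_add_mul (q := q) (t := t) 0 n z
  rw [zero_add] at this
  rw [← this, hk]

lemma Core.blueH_zero {z : ℍ} (hz : Core q t z) {k : ℤ} (hk : blueH q t k z = 0) :
    blueH q t 0 z = 0 := by
  obtain ⟨n, rfl⟩ := hz.dvd_of_blueH hk
  have := blueH_add_mul (q := q) (t := t) 0 n z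
  rw [zero_add] at this
  rw [← this, hk]

end

section
variable (M : SurfaceMap D) (q : ℕ) (t : ℝ)

/-- Two positions of the same point of a polygon, possibly in the two copies if the point is on a
red side. -/
def SamePiece (x y : Pieces D q t) : Prop :=
  ∃ k : ℤ, y.1.1 = (M.rot ^ k) x.1.1 ∧ (x.2 : ℍ) = turn q k y.2 ∧
    (x.1.2 = y.1.2 ∨ OnRed q t x.2)

/-- The two points are identified across the blue side number `0`. -/
def AcrossBlue (x y : Pieces D q t) : Prop :=
  blueH q t 0 x.2 = 0 ∧ y.1 = (M.rev x.1.1, x.1.2) ∧ (y.2 : ℍ) = mirror x.2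

/-- The explicit form of the equivalence relation generated by the identifications. -/
def Identified (x y : Pieces D q t) : Prop :=
  SamePiece M q t x y ∨
    ∃ x' y', SamePiece M q t x x' ∧ AcrossBlue M q t x' y' ∧ SamePiece M q t y' y

variable {M q t}

lemma SamePiece.refl (x : Pieces D q t) : SamePiece M q t x x :=
  ⟨0, by simp, by simp, Or.inl rfl⟩

lemma SamePiece.symm {x y : Pieces D q t} (h : SamePiece M q t x y) : SamePiece M q t y x := by
  obtain ⟨k, h1, h2, h3⟩ := h
  refine ⟨-k, ?_, ?_, ?_⟩
  · rw [h1, rot_zpow_zpow]; simp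
  · rw [h2, turn_turn]; simp
  · rcases h3 with h3 | h3
    · exact Or.inl h3.symm
    · right
      have := h3.turn (-k)
      rwa [h2, turn_turn, neg_add_cancel, turn_zero] at this

lemma SamePiece.trans {x y z : Pieces D q t} (h : SamePiece M q t x y)
    (h' : SamePiece M q t y z) : SamePiece M q t x z := by
  obtain ⟨k, h1, h2, h3⟩ := h
  obtain ⟨j, g1, g2, g3⟩ := h'
  refine ⟨j + k, ?_, ?_, ?_⟩
  · rw [g1, h1, rot_zpow_zpow]
  · rw [h2, g2, turn_turn, add_comm]
  · rcases h3 with h3 | h3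
    · rcases g3 with g3 | g3
      · exact Or.inl (h3.trans g3)
      · right
        rw [h2]; exact g3.turn k
    · exact Or.inr h3

lemma AcrossBlue.symm {x y : Pieces D q t} (h : AcrossBlue M q t x y) : AcrossBlue M q t y x := by
  obtain ⟨h1, h2, h3⟩ := h
  refine ⟨?_, ?_, ?_⟩
  · rw [h3, blueH_mirror, neg_zero, h1]
  · rw [h2]; ext <;> simp [M.rev_rev]
  · rw [h3, mirror_mirror]

/-- A point is on at most one blue side of its polygon, so the place where it arrives after crossing
is determined up to a change of position. -/
lemma AcrossBlue.same [Good q t] [Loopless M q] {x y x' y' : Pieces D q t}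
    (h : AcrossBlue M q t x y) (h' : AcrossBlue M q t x' y') (hs : SamePiece M q t x x') :
    SamePiece M q t y y' := by
  obtain ⟨h1, h2, h3⟩ := h
  obtain ⟨g1, g2, g3⟩ := h'
  obtain ⟨k, k1, k2, k3⟩ := hs
  have hk : blueH q t k x.2 = 0 := by rw [k2, blueH_turn, sub_self, g1]
  have hd := dvd_of_blueH x.2.2 h1 hk
  rw [turn_of_dvd t hd] at k2
  rw [(rot_zpow_eq_iff M k _).2 hd] at k1
  refine ⟨0, ?_, ?_, ?_⟩
  · simp [h2, g2, k1]
  · simp [h3, g3, k2]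
  · rw [h2, g2, h3]
    exact k3.imp id OnRed.mirror

lemma identified_of_glue {x y : Pieces D q t} (h : Glue M q t x y) :
    Identified M q t x y := by
  cases h with
  | turn d b z w h =>
    left
    refine ⟨-1, by simp, ?_, Or.inl rfl⟩
    have : (w : ℍ) = RightAngled.turn q 1 z := by rw [h, RightAngled.turn]; simp
    show (z : ℍ) = RightAngled.turn q (-1) w
    rw [this, turn_turn]; simp
  | blue d b u z w hu hz hw =>
    right
    refine ⟨_, _, SamePiece.refl _, ⟨?_, rfl, ?_⟩, SamePiece.refl _⟩
    · show blueH q t 0 z = 0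
      rw [hz]; exact blueH_zero_perp u
    · show (w : ℍ) = mirror z
      rw [hz, hw, blueSide, blueSide, mirror_perp]
  | red d u z hu hz =>
    left
    refine ⟨0, by simp, by simp, Or.inr ⟨0, ?_⟩⟩
    show redH q t 0 z = 0
    rw [hz]; exact redH_zero_redSide u

lemma Identified.symm {x y : Pieces D q t} (h : Identified M q t x y) : Identified M q t y x := by
  rcases h with h | ⟨x', y', h1, h2, h3⟩
  · exact Or.inl h.symm
  · exact Or.inr ⟨y', x', h3.symm, h2.symm, h1.symm⟩

lemma Identified.trans [Good q t] [Loopless M q] {x y z : Pieces D q t}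
    (h : Identified M q t x y) (h' : Identified M q t y z) : Identified M q t x z := by
  rcases h with h | ⟨x', y', h1, h2, h3⟩ <;> rcases h' with g | ⟨x'', y'', g1, g2, g3⟩
  · exact Or.inl (h.trans g)
  · exact Or.inr ⟨x'', y'', h.trans g1, g2, g3⟩
  · exact Or.inr ⟨x', y', h1, h2, h3.trans g⟩
  -- Two crossings in a row use the same blue side, and the second undoes the first.
  · exact Or.inl (h1.trans ((h2.symm.same g2 (h3.trans g1)).trans g3))

lemma identified_of_eq [Good q t] [Loopless M q] {x y : Pieces D q t}
    (h : (Quot.mk _ x : X M q t) = Quot.mk _ y) : Identified M q t x y := by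
  have := Quot.eqvGen_exact h
  clear h
  induction this with
  | rel x y h => exact identified_of_glue h
  | refl x => exact Or.inl (SamePiece.refl x)
  | symm x y _ ih => exact ih.symm
  | trans x y z _ _ ih1 ih2 => exact ih1.trans ih2

end

end
end RightAngled

namespace RightAngled
noncomputable section

open Real

set_option linter.unusedSectionVars false

/-! ### Points of the surface -/

variable {D : Type*} (M : SurfaceMap D) (q : ℕ) (t : ℝ)

lemma center_mem [G : Good q t] : UpperHalfPlane.I ∈ polygon q t := by
  rw [mem_polygon]
  intro k
  simp only [blueH, redH, height, cX_I, cY_I, cT_I, one_mul, zero_mul, add_zero, mul_zero, sub_zero]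
  exact ⟨(blueRelations q t).sinh_pos.le, (redRelations q t).sinh_pos.le⟩

/-- The point of the surface at position `z` of the polygon of `d` in the copy `b`, where the
polygon is reversed if `o` is true. -/
def pt [Good q t] (d : D) (o b : Bool) (z : ℍ) : X M q t :=
  open Classical in
  if h : z ∈ polygon q t then X.mk M q t d b ⟨flipIf o z, flipIf_mem h o⟩
  -- The centre is a dummy value, so that `pt` is defined on the whole plane.
  else X.mk M q t d b ⟨UpperHalfPlane.I, center_mem q t⟩

variable {M q t}

variable [G : Good q t]

lemma pt_eq {z : ℍ} (h : z ∈ polygon q t) (d : D) (o b : Bool) :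
    pt M q t d o b z = X.mk M q t d b ⟨flipIf o z, flipIf_mem h o⟩ := by
  unfold pt; rw [dif_pos h]

lemma pt_false {z : ℍ} (h : z ∈ polygon q t) (d : D) (b : Bool) :
    pt M q t d false b z = X.mk M q t d b ⟨z, h⟩ := pt_eq h d false b

lemma pt_flip {z : ℍ} (h : z ∈ polygon q t) (d : D) (o b : Bool) :
    pt M q t d o b z = pt M q t d false b (flipIf o z) := by
  rw [pt_eq h, pt_false (flipIf_mem h o)]

lemma exists_pt (x : X M q t) : ∃ d b, ∃ z ∈ polygon q t, x = pt M q t d false b z := by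
  induction x using Quot.ind with
  | mk x =>
    obtain ⟨⟨d, b⟩, z, hz⟩ := x
    exact ⟨d, b, z, hz, (pt_false hz d b).symm⟩

lemma pt_rot {z : ℍ} (h : z ∈ polygon q t) (d : D) (b : Bool) :
    pt M q t (M.rot d) false b z = pt M q t d false b (turn q 1 z) := by
  rw [pt_false h, pt_false (turn_mem h 1)]
  refine Quot.sound (Glue.turn d b _ _ ?_)
  simp [turn]

lemma pt_rot_zpow {z : ℍ} (h : z ∈ polygon q t) (d : D) (b : Bool) (k : ℤ) :
    pt M q t ((M.rot ^ k) d) false b z = pt M q t d false b (turn q k z) := by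
  induction k using Int.induction_on generalizing d z with
  | zero => simp
  | succ n ih =>
    rw [zpow_add, Equiv.Perm.mul_apply, ih h, zpow_one, pt_rot (turn_mem h _), turn_turn, add_comm]
  | pred n ih =>
    rw [sub_eq_add_neg, zpow_add, Equiv.Perm.mul_apply, ih h, zpow_neg_one]
    have := pt_rot (M := M) (t := t) (turn_mem (turn_mem h (-n)) (-1)) (M.rot⁻¹ d) b
    rw [show M.rot (M.rot⁻¹ d) = d from M.rot.apply_symm_apply d, turn_turn, turn_turn] at this
    rw [show -(n : ℤ) + -1 = -1 + -n by ring, this]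
    congr 1; congr 1; ring

lemma pt_red_copy {z : ℍ} (h : z ∈ polygon q t) (hr : OnRed q t z) (d : D) (b b' : Bool) :
    pt M q t d false b z = pt M q t d false b' z := by
  obtain ⟨k, hk⟩ := hr
  have h' := turn_mem h (-k)
  obtain ⟨u, hu, e⟩ := exists_redSide h' (by rw [redH_turn, sub_neg_eq_add, zero_add, hk])
  have key : ∀ b, pt M q t d false b z = pt M q t ((M.rot ^ k) d) false b (turn q (-k) z) := by
    intro b
    rw [pt_rot_zpow h', turn_turn]; simp
  have : pt M q t ((M.rot ^ k) d) false false (turn q (-k) z) =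
      pt M q t ((M.rot ^ k) d) false true (turn q (-k) z) := by
    rw [pt_false h', pt_false h']
    exact Quot.sound (Glue.red _ u _ hu e)
  cases b <;> cases b' <;> simp [key, this]

lemma pt_red {z : ℍ} (h : z ∈ polygon q t) (hr : redH q t 0 z = 0) (d : D) (o b b' : Bool) :
    pt M q t d o b z = pt M q t d o b' z := by
  rw [pt_flip h, pt_flip h, pt_red_copy (flipIf_mem h o) (OnRed.flipIf ⟨0, hr⟩ o)]

lemma blueH_zero_flipIf (o : Bool) (z : ℍ) : blueH q t 0 (flipIf o z) = blueH q t 0 z := by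
  cases o
  · rfl
  · rw [flipIf_true, blueH_mirror, neg_zero]

/-- The gluing reverses the parameter of the side. If the neighbour is taken with the opposite
orientation, the position does not change, so the two polygons are related by the reflection in the
blue side. -/
lemma pt_blue {z : ℍ} (h : z ∈ polygon q t) (hb : blueH q t 0 z = 0) (d : D) (o b : Bool) :
    pt M q t d o b z = pt M q t (M.rev d) (!o) b z := by
  have h' := flipIf_mem h o
  obtain ⟨u, hu, e⟩ := exists_perp h' (by rw [blueH_zero_flipIf, hb])
  rw [pt_eq h, pt_eq h]
  refine Quot.sound (Glue.blue d b u _ _ hu e ?_)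
  show flipIf (!o) z = perp (apothem q t) (-u)
  rw [← mirror_flipIf, e, mirror_perp]

section
variable [L : Loopless M q]

/-- Equality of points of the surface. -/
lemma pt_eq_pt {d e : D} {b c : Bool} {z w : ℍ} (hz : z ∈ polygon q t) (hw : w ∈ polygon q t)
    (h : pt M q t d false b z = pt M q t e false c w) :
    (∃ k : ℤ, e = (M.rot ^ k) d ∧ z = turn q k w ∧ (b = c ∨ OnRed q t z)) ∨
    ∃ j k : ℤ, blueH q t j z = 0 ∧ e = (M.rot ^ k) (M.rev ((M.rot ^ j) d)) ∧
      mirror (turn q (-j) z) = turn q k w ∧ (b = c ∨ OnRed q t z) := by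
  rw [pt_false hz, pt_false hw] at h
  rcases identified_of_eq h with h | ⟨⟨⟨d', b'⟩, z'⟩, ⟨⟨e', c'⟩, w'⟩, ⟨j, h1, h2, h3⟩,
    ⟨g0, g1, g2⟩, ⟨k, f1, f2, f3⟩⟩
  · exact Or.inl h
  · right
    simp only at h1 h2 h3 g0 g1 g2 f1 f2 f3
    simp only [Prod.mk.injEq] at g1
    have hz' : (z' : ℍ) = turn q (-j) z := by rw [h2, turn_turn]; simp
    refine ⟨j, k, ?_, ?_, ?_, ?_⟩
    · rw [h2, blueH_turn, sub_self, g0]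
    · rw [f1, g1.1, h1]
    · rw [← f2, g2, hz']
    · rcases h3 with h3 | h3
      · rcases f3 with f3 | f3
        · left; rw [h3, ← g1.2, f3]
        · right
          rw [g2] at f3
          have := f3.mirror.turn j
          rwa [mirror_mirror, ← h2] at this
      · exact Or.inr h3

/-- The polygon coordinate of a point relative to a dart is unique. -/
lemma pt_inj {d : D} {b c : Bool} {z w : ℍ} (hz : z ∈ polygon q t) (hw : w ∈ polygon q t)
    (h : pt M q t d false b z = pt M q t d false c w) : z = w ∧ (b = c ∨ OnRed q t z) := by
  rcases pt_eq_pt hz hw h with ⟨k, h1, h2, h3⟩ | ⟨j, k, -, h1, -, -⟩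
  · rw [turn_of_dvd t ((rot_zpow_eq_iff M k d).1 h1.symm)] at h2
    exact ⟨h2, h3⟩
  -- A crossing would lead to the polygon of another vertex, since there are no loops.
  · exfalso
    refine not_rot_rev M q (d := (M.rot ^ j) d) (e := d) (k := -k) rfl ?_
    conv_rhs => rw [h1]
    rw [rot_zpow_zpow]; simp

/-- A point of the core can only be crossed over at the sides number 0, so a single dart and its
reverse account for all its positions. -/
lemma core_pt_eq {d e : D} {o b c : Bool} {z w : ℍ} (hz : Core q t z) (hw : w ∈ polygon q t)
    (h : pt M q t d o b z = pt M q t e false c w) :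
    (∃ k : ℤ, d = (M.rot ^ k) e ∧ w = turn q k (flipIf o z) ∧ (c = b ∨ redH q t 0 z = 0)) ∨
    (blueH q t 0 z = 0 ∧ ∃ k : ℤ, M.rev d = (M.rot ^ k) e ∧ w = turn q k (flipIf (!o) z) ∧
      (c = b ∨ redH q t 0 z = 0)) := by
  rw [pt_flip hz.1] at h
  have hred : OnRed q t (flipIf o z) → redH q t 0 z = 0 := fun h =>
    hz.redH_zero_of_onRed (by simpa using h.flipIf o)
  rcases pt_eq_pt (flipIf_mem hz.1 o) hw h with ⟨k, h1, h2, h3⟩ | ⟨j, k, h0, h1, h2, h3⟩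
  · left
    refine ⟨-k, ?_, ?_, ?_⟩
    · rw [h1, rot_zpow_zpow]; simp
    · rw [h2, turn_turn]; simp
    · exact h3.imp Eq.symm hred
  · right
    have hj : (q : ℤ) ∣ j := by
      cases o
      · exact hz.dvd_of_blueH h0
      · rw [flipIf_true, blueH_mirror] at h0
        exact (dvd_neg.1 (hz.dvd_of_blueH h0))
    have hb : blueH q t 0 z = 0 := by
      cases o
      · exact hz.blueH_zero h0
      · rw [flipIf_true, blueH_mirror] at h0
        exact hz.blueH_zero h0
    rw [(rot_zpow_eq_iff M j d).2 hj] at h1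
    rw [turn_of_dvd t (dvd_neg.2 hj), mirror_flipIf] at h2
    refine ⟨hb, -k, ?_, ?_, ?_⟩
    · rw [h1, rot_zpow_zpow]; simp
    · rw [h2, turn_turn]; simp
    · exact h3.imp Eq.symm hred

end

/-! ### The charts around the corners -/

/-- Folding the plane along the geodesics of the blue and of the red side number `0`. -/
def fold (q : ℕ) (t : ℝ) (x : ℍ) : ℍ :=
  foldLine (apothem q (s q t)) (π / q) (foldLine (apothem q t) 0 x)

lemma dist_fold_le (x y : ℍ) : dist (fold q t x) (fold q t y) ≤ dist x y :=
  (dist_foldLine_le _ _ _ _).trans (dist_foldLine_le _ _ _ _)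

lemma continuous_fold (q : ℕ) (t : ℝ) : Continuous (fold q t) :=
  (continuous_foldLine _ _).comp (continuous_foldLine _ _)

/-- The composition of the reflections in the blue and red sides number `0` selected by `i`
and `j`. -/
def quadRefl (q : ℕ) (t : ℝ) (i j : Bool) (x : ℍ) : ℍ :=
  if j then redRefl q t (if i then blueRefl q t x else x) else if i then blueRefl q t x else x

lemma dist_blueRefl (x y : ℍ) : dist (blueRefl q t x) (blueRefl q t y) = dist x y :=
  dist_reflect _ _ _ _

lemma dist_redRefl (x y : ℍ) : dist (redRefl q t x) (redRefl q t y) = dist x y :=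
  dist_reflect _ _ _ _

lemma dist_quadRefl (i j : Bool) (x y : ℍ) :
    dist (quadRefl q t i j x) (quadRefl q t i j y) = dist x y := by
  cases i <;> cases j <;> simp [quadRefl, dist_blueRefl, dist_redRefl]

/-- The closed quadrant of the points `x` for which `quadRefl i j x` is in the quadrant of the
polygon. -/
def Quadrant (q : ℕ) (t : ℝ) (i j : Bool) (x : ℍ) : Prop :=
  0 ≤ (if i then -blueH q t 0 x else blueH q t 0 x) ∧ 0 ≤ (if j then -redH q t 0 x else redH q t 0 x)

lemma fold_eq_quadRefl {i j : Bool} {x : ℍ} (h : Quadrant q t i j x) :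
    fold q t x = quadRefl q t i j x := by
  obtain ⟨h1, h2⟩ := h
  have e1 : foldLine (apothem q t) 0 x = if i then blueRefl q t x else x := by
    unfold foldLine
    rw [← blueH_zero_eq]
    cases i
    · simp at h1 ⊢; intro h; linarith
    · simp only [if_true] at h1 ⊢
      split_ifs with hlt
      · rfl
      · have : height (apothem q t) 0 x = 0 := by rw [← blueH_zero_eq]; linarith
        exact (reflect_of_height_eq_zero this).symm
  have e2 : redH q t 0 (if i then blueRefl q t x else x) = redH q t 0 x := by
    cases i
    · rfl
    · exact redH_blueRefl x
  unfold fold quadRefl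
  rw [e1]
  generalize (if i then blueRefl q t x else x) = y at e2
  unfold foldLine
  rw [← redH_zero_eq, e2]
  cases j
  · simp at h2 ⊢; intro h; linarith
  · simp only [if_true] at h2 ⊢
    split_ifs with hlt
    · rfl
    · have : height (apothem q (s q t)) (π / q) y = 0 := by rw [← redH_zero_eq, e2]; linarith
      exact (reflect_of_height_eq_zero this).symm

lemma exists_quadrant (x : ℍ) : ∃ i j, Quadrant q t i j x := by
  refine ⟨decide (blueH q t 0 x < 0), decide (redH q t 0 x < 0), ?_, ?_⟩
  · split_ifs with h
    · simp at h; linarith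
    · simpa using h
  · split_ifs with h
    · simp at h; linarith
    · simpa using h

lemma blueH_quadRefl (i j : Bool) (x : ℍ) : blueH q t 0 (quadRefl q t i j x) =
    if i then -blueH q t 0 x else blueH q t 0 x := by
  cases i <;> cases j <;> simp [quadRefl, blueH_redRefl, blueH_blueRefl]

lemma redH_quadRefl (i j : Bool) (x : ℍ) : redH q t 0 (quadRefl q t i j x) =
    if j then -redH q t 0 x else redH q t 0 x := by
  cases i <;> cases j <;> simp [quadRefl, redH_redRefl, redH_blueRefl]

lemma blueH_fold (x : ℍ) : blueH q t 0 (fold q t x) = |blueH q t 0 x| := by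
  obtain ⟨i, j, h⟩ := exists_quadrant (q := q) (t := t) x
  rw [fold_eq_quadRefl h, blueH_quadRefl]
  have := h.1
  cases i
  · simp at this ⊢; exact (abs_of_nonneg this).symm
  · simp at this ⊢; exact (abs_of_nonpos this).symm

lemma redH_fold (x : ℍ) : redH q t 0 (fold q t x) = |redH q t 0 x| := by
  obtain ⟨i, j, h⟩ := exists_quadrant (q := q) (t := t) x
  rw [fold_eq_quadRefl h, redH_quadRefl]
  have := h.2
  cases j
  · simp at this ⊢; exact (abs_of_nonneg this).symm
  · simp at this ⊢; exact (abs_of_nonpos this).symm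

/-- The two lines are perpendicular, so the reflections commute and all their compositions are
involutions. -/
lemma quadRefl_eq_iff {x y : ℍ} (i j : Bool) :
    quadRefl q t i j x = y ↔ x = quadRefl q t i j y := by
  have comm : ∀ x, blueRefl q t (redRefl q t x) = redRefl q t (blueRefl q t x) := by
    intro x
    have hB : height (apothem q t) 0 (redRefl q t x) = height (apothem q t) 0 x := by
      rw [← blueH_zero_eq, blueH_redRefl, blueH_zero_eq]
    have hR : height (apothem q (s q t)) (π / q) (blueRefl q t x) =
        height (apothem q (s q t)) (π / q) x := by
      rw [← redH_zero_eq, redH_blueRefl, redH_zero_eq]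
    apply ext_coords
    · rw [blueRefl, cX_reflect, hB, redRefl, cX_reflect, redRefl, cX_reflect, hR, blueRefl,
        cX_reflect]; ring
    · rw [blueRefl, cY_reflect, hB, redRefl, cY_reflect, redRefl, cY_reflect, hR, blueRefl,
        cY_reflect]; ring
  have key : ∀ x, quadRefl q t i j (quadRefl q t i j x) = x := by
    intro x
    cases i <;> cases j <;> simp [quadRefl, comm]
  constructor
  · rintro rfl; rw [key]
  · rintro rfl; rw [key]

/-- The domain of the charts: the points that are folded into the core of the polygon. -/
def U (q : ℕ) (t : ℝ) : Set ℍ :=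
  {x | ∀ k : ℕ, 1 ≤ k → k < q → 0 < blueH q t k (fold q t x) ∧ 0 < redH q t k (fold q t x)}

lemma isOpen_U (q : ℕ) (t : ℝ) : IsOpen (U q t) := by
  have : U q t = ⋂ k ∈ Finset.Ico 1 q, {x | 0 < blueH q t k (fold q t x)} ∩
      {x | 0 < redH q t k (fold q t x)} := by
    ext x; simp [U]
  rw [this]
  exact isOpen_biInter_finset fun k _ =>
    (isOpen_lt continuous_const ((continuous_height _ _).comp (continuous_fold q t))).inter
    (isOpen_lt continuous_const ((continuous_height _ _).comp (continuous_fold q t)))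

lemma core_fold {x : ℍ} (hx : x ∈ U q t) : Core q t (fold q t x) := by
  refine ⟨?_, hx⟩
  rw [mem_polygon]
  intro k
  obtain ⟨j, hj, n, rfl⟩ := exists_nat_index G.three_le k
  rw [blueH_add_mul, redH_add_mul]
  rcases Nat.eq_zero_or_pos j with rfl | h1
  · rw [Nat.cast_zero, blueH_fold, redH_fold]
    exact ⟨abs_nonneg _, abs_nonneg _⟩
  · exact ⟨(hx j h1 hj).1.le, (hx j h1 hj).2.le⟩

lemma quadrant_of_core {z : ℍ} (hz : Core q t z) : Quadrant q t false false z :=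
  mem_polygon.1 hz.1 0

lemma fold_of_core {z : ℍ} (hz : Core q t z) : fold q t z = z :=
  fold_eq_quadRefl (quadrant_of_core hz)

lemma mem_U_of_core {z : ℍ} (hz : Core q t z) : z ∈ U q t := by
  intro k h1 h2
  rw [fold_of_core hz]
  exact hz.2 k h1 h2

variable (M q t) in
/-- The inverse of the chart around a corner of the polygon of `d`. -/
def chartMap (d : D) (o b : Bool) (x : ℍ) : X M q t :=
  -- Four right angles meet at a corner. The side of the blue line decides between the polygon of d
  -- and the reversed polygon of its neighbour, the side of the red line decides about the copy.
  open Classical in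
  pt M q t (if blueH q t 0 x < 0 then M.rev d else d) (if blueH q t 0 x < 0 then !o else o)
    (if redH q t 0 x < 0 then !b else b) (fold q t x)

/-- On the lines between the quadrants several descriptions are available, and the gluing makes them
agree. Closed quadrants can thus be used in continuity and length arguments. -/
lemma chartMap_eq {x : ℍ} (hx : x ∈ U q t) {i j : Bool} (h : Quadrant q t i j x) (d : D)
    (o b : Bool) : chartMap M q t d o b x =
      pt M q t (if i then M.rev d else d) (o ^^ i) (b ^^ j) (fold q t x) := by
  have hc := core_fold hx
  have hred : redH q t 0 x = 0 → ∀ d o b b', pt M q t d o b (fold q t x) =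
      pt M q t d o b' (fold q t x) := fun h0 d o b b' =>
    pt_red hc.1 (by rw [redH_fold, h0, abs_zero]) d o b b'
  have hblue : blueH q t 0 x = 0 → ∀ d o b, pt M q t d o b (fold q t x) =
      pt M q t (M.rev d) (!o) b (fold q t x) := fun h0 d o b =>
    pt_blue hc.1 (by rw [blueH_fold, h0, abs_zero]) d o b
  have hfst : ∀ b, pt M q t (if blueH q t 0 x < 0 then M.rev d else d)
      (if blueH q t 0 x < 0 then !o else o) b (fold q t x) =
      pt M q t (if i then M.rev d else d) (o ^^ i) b (fold q t x) := by
    intro b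
    obtain ⟨h1, -⟩ := h
    cases i
    · simp only [Bool.false_eq_true, if_false] at h1
      rw [if_neg (not_lt.2 h1), if_neg (not_lt.2 h1)]; simp
    · simp only [if_true] at h1
      rcases lt_or_eq_of_le (show blueH q t 0 x ≤ 0 by linarith) with h2 | h2
      · rw [if_pos h2, if_pos h2]; simp
      · rw [if_neg (by simp [h2]), if_neg (by simp [h2]), hblue h2]; simp
  unfold chartMap
  rw [hfst]
  obtain ⟨-, h1⟩ := h
  cases j
  · simp only [Bool.false_eq_true, if_false] at h1
    rw [if_neg (not_lt.2 h1)]; simp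
  · simp only [if_true] at h1
    rcases lt_or_eq_of_le (show redH q t 0 x ≤ 0 by linarith) with h2 | h2
    · rw [if_pos h2]; simp
    · exact hred h2 _ _ _ _

lemma chartMap_core {z : ℍ} (hz : Core q t z) (d : D) (o b : Bool) :
    chartMap M q t d o b z = pt M q t d o b z := by
  rw [chartMap_eq (mem_U_of_core hz) (quadrant_of_core hz), fold_of_core hz]
  simp

lemma fold_blueRefl (x : ℍ) : fold q t (blueRefl q t x) = fold q t x := by
  obtain ⟨i, j, h⟩ := exists_quadrant (q := q) (t := t) x
  have h' : Quadrant q t (!i) j (blueRefl q t x) := by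
    unfold Quadrant at h ⊢
    rw [blueH_blueRefl, redH_blueRefl]
    cases i <;> simpa using h
  rw [fold_eq_quadRefl h, fold_eq_quadRefl h']
  cases i <;> cases j <;> simp [quadRefl]

lemma blueRefl_mem_U {x : ℍ} (hx : x ∈ U q t) : blueRefl q t x ∈ U q t := by
  intro k h1 h2
  rw [fold_blueRefl]; exact hx k h1 h2

/-- The chart seen from the other side of the blue side. -/
lemma chartMap_swap {x : ℍ} (hx : x ∈ U q t) (d : D) (o b : Bool) :
    chartMap M q t d o b x = chartMap M q t (M.rev d) (!o) b (blueRefl q t x) := by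
  obtain ⟨i, j, h⟩ := exists_quadrant (q := q) (t := t) x
  have h' : Quadrant q t (!i) j (blueRefl q t x) := by
    unfold Quadrant at h ⊢
    rw [blueH_blueRefl, redH_blueRefl]
    cases i <;> simpa using h
  rw [chartMap_eq hx h, chartMap_eq (blueRefl_mem_U hx) h', fold_blueRefl]
  cases i <;> simp [M.rev_rev]

/-- The isometry that puts a polygon into a chart. -/
def placeIso (q : ℕ) (t : ℝ) (k : ℤ) (o j : Bool) : ℍ ≃ᵢ ℍ :=
  (rotationIso (2 * (-k : ℤ) * π / q)).trans
    ((if o then mirrorIso else IsometryEquiv.refl ℍ).trans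
      (if j then reflectIso (apothem q (s q t)) (π / q) else IsometryEquiv.refl ℍ))

lemma placeIso_apply (k : ℤ) (o j : Bool) (z : ℍ) :
    placeIso q t k o j z = quadRefl q t false j (flipIf o (turn q (-k) z)) := by
  cases o <;> cases j <;> rfl

section
variable [L : Loopless M q]

/-- Each copy of the polygon appears in the chart only once and rigidly. Injectivity, openness and
the isometry property of the charts all reduce to this. -/
lemma chartMap_eq_pt_iff_of_rot {d e : D} {k : ℤ} (hk : d = (M.rot ^ k) e) (o b c : Bool) {x z : ℍ}
    (hz : z ∈ polygon q t) (hx : x ∈ U q t) :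
    pt M q t e false c z = chartMap M q t d o b x ↔ placeIso q t k o (b ^^ c) z = x := by
  rw [placeIso_apply]
  constructor
  · intro h
    obtain ⟨i, j, hij⟩ := exists_quadrant (q := q) (t := t) x
    have hc := core_fold hx
    have hi : i = true → blueH q t 0 x = 0 → Quadrant q t false j x := fun h1 h2 =>
      ⟨by simp [h2], hij.2⟩
    obtain ⟨hi, k', h1, h2, h3⟩ : Quadrant q t false j x ∧ ∃ k' : ℤ, d = (M.rot ^ k') e ∧
        z = turn q k' (flipIf o (fold q t x)) ∧ (c = (b ^^ j) ∨ redH q t 0 (fold q t x) = 0) := by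
      rw [chartMap_eq hx hij] at h
      rcases core_pt_eq hc hz h.symm with ⟨k', h1, h2, h3⟩ | ⟨h0, k', h1, h2, h3⟩
      · cases i
        · simp only [Bool.false_eq_true, if_false, Bool.xor_false] at h1 h2
          exact ⟨hij, k', h1, h2, h3⟩
        -- A point strictly beyond the blue line belongs to another vertex.
        · exact (not_rot_rev M q hk (by simpa using h1)).elim
      · cases i
        · exact (not_rot_rev M q hk (by simpa using h1)).elim
        · rw [blueH_fold, abs_eq_zero] at h0
          simp only [if_true, M.rev_rev, Bool.xor_true, Bool.not_not] at h1 h2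
          exact ⟨hi rfl h0, k', h1, h2, h3⟩
    have hkk : (q : ℤ) ∣ -k + k' := by
      rw [← rot_zpow_eq_iff M _ e, ← rot_zpow_zpow, ← h1, hk, rot_zpow_zpow]; simp
    rw [h2, turn_turn, turn_of_dvd t hkk, flipIf_flipIf]
    rw [quadRefl_eq_iff]
    rcases h3 with rfl | h3
    · rw [fold_eq_quadRefl hi]; congr 1
      cases b <;> cases j <;> rfl
    · rw [redH_fold, abs_eq_zero] at h3
      rw [fold_eq_quadRefl (i := false) (j := (b ^^ c)) ⟨hi.1, by simp [h3]⟩]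
  · intro h
    set y := flipIf o (turn q (-k) z) with hy
    have hyP : y ∈ polygon q t := flipIf_mem (turn_mem hz _) o
    have hq : Quadrant q t false (b ^^ c) x := by
      rw [← h]
      unfold Quadrant
      rw [blueH_quadRefl, redH_quadRefl]
      have := mem_polygon.1 hyP 0
      refine ⟨by simpa using this.1, ?_⟩
      split_ifs <;> simpa using this.2
    have hf : fold q t x = y := by
      rw [fold_eq_quadRefl hq, quadRefl_eq_iff]; exact h.symm
    rw [chartMap_eq hx hq, hf, pt_flip hyP, hy]
    simp only [Bool.false_eq_true, if_false, Bool.xor_false]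
    rw [flipIf_flipIf, hk, pt_rot_zpow (turn_mem hz _), turn_turn]
    simp

/-- A polygon is disjoint from a chart, or placed into it by an isometry. -/
lemma chart_piece (d : D) (o b : Bool) (e : D) (c : Bool) :
    (∀ x ∈ U q t, ∀ z ∈ polygon q t, pt M q t e false c z ≠ chartMap M q t d o b x) ∨
    ∃ g : ℍ ≃ᵢ ℍ, ∀ x ∈ U q t, ∀ z ∈ polygon q t,
      pt M q t e false c z = chartMap M q t d o b x ↔ g z = x := by
  by_cases h1 : ∃ k : ℤ, d = (M.rot ^ k) e
  · obtain ⟨k, hk⟩ := h1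
    exact Or.inr ⟨placeIso q t k o (b ^^ c), fun x hx z hz =>
      chartMap_eq_pt_iff_of_rot hk o b c hz hx⟩
  by_cases h2 : ∃ k : ℤ, M.rev d = (M.rot ^ k) e
  · obtain ⟨k, hk⟩ := h2
    -- The polygon lies beyond the blue line: it is placed in the chart of the reversed dart, which
    -- differs by the blue reflection.
    refine Or.inr ⟨(placeIso q t k (!o) (b ^^ c)).trans (reflectIso (apothem q t) 0),
      fun x hx z hz => ?_⟩
    rw [chartMap_swap hx, chartMap_eq_pt_iff_of_rot hk (!o) b c hz (blueRefl_mem_U hx)]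
    show _ ↔ blueRefl q t (placeIso q t k (!o) (b ^^ c) z) = x
    constructor
    · intro h; rw [h, blueRefl_blueRefl]
    · intro h; rw [← h, blueRefl_blueRefl]
  · left
    intro x hx z hz h
    obtain ⟨i, j, hij⟩ := exists_quadrant (q := q) (t := t) x
    rw [chartMap_eq hx hij] at h
    rcases core_pt_eq (core_fold hx) hz h.symm with ⟨k, h3, -⟩ | ⟨-, k, h3, -⟩ <;> cases i
    · exact h1 ⟨k, by simpa using h3⟩
    · exact h2 ⟨k, by simpa using h3⟩
    · exact h2 ⟨k, by simpa using h3⟩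
    · exact h1 ⟨k, by simpa [M.rev_rev] using h3⟩

end

end
end RightAngled

namespace RightAngled
noncomputable section

open Real

set_option linter.unusedSectionVars false

/-! ### Topology of the surface -/

variable {D : Type*} {M : SurfaceMap D} {q : ℕ} {t : ℝ} [G : Good q t]

lemma continuous_flipIf (o : Bool) : Continuous (flipIf o) :=
  (Isometry.of_dist_eq (dist_flipIf o)).continuous

lemma isClosed_quadrant (i j : Bool) : IsClosed {x | Quadrant q t i j x} := by
  have h1 : Continuous fun x => if i then -blueH q t 0 x else blueH q t 0 x := by
    cases i
    · exact continuous_height _ _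
    · exact (continuous_height _ _).neg
  have h2 : Continuous fun x => if j then -redH q t 0 x else redH q t 0 x := by
    cases j
    · exact continuous_height _ _
    · exact (continuous_height _ _).neg
  exact (isClosed_le continuous_const h1).inter (isClosed_le continuous_const h2)

/-- Pasting over the four closed quadrants, on each of which the map goes through a single polygon.
-/
lemma continuousOn_chartMap (d : D) (o b : Bool) : ContinuousOn (chartMap M q t d o b) (U q t) := by
  rw [continuousOn_iff_continuous_domRestrict]
  refine (locallyFinite_of_finite fun p : Bool × Bool =>
    {x : U q t | Quadrant q t p.1 p.2 (x : ℍ)}).continuous ?_ ?_ ?_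
  · ext x
    obtain ⟨i, j, h⟩ := exists_quadrant (q := q) (t := t) (x : ℍ)
    simp only [Set.mem_iUnion, Set.mem_univ, iff_true]
    exact ⟨(i, j), h⟩
  · rintro ⟨i, j⟩
    exact (isClosed_quadrant i j).preimage continuous_subtype_val
  · rintro ⟨i, j⟩
    have hc : Continuous fun x : U q t => X.mk M q t (if i then M.rev d else d) (b ^^ j)
        ⟨flipIf (o ^^ i) (fold q t x), flipIf_mem (core_fold x.2).1 _⟩ :=
      continuous_quot_mk.comp (continuous_sigmaMk.comp (Continuous.subtype_mk
        ((continuous_flipIf _).comp ((continuous_fold q t).comp continuous_subtype_val)) _))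
    refine hc.continuousOn.congr fun x hx => ?_
    show chartMap M q t d o b x = _
    rw [chartMap_eq x.2 hx, pt_eq (core_fold x.2).1]

lemma exists_core {w : ℍ} (hw : w ∈ polygon q t) :
    ∃ (k : ℤ) (o : Bool), Core q t (flipIf o (turn q k w)) := by
  obtain ⟨k, o, h⟩ := exists_sector G.three_le w
  exact ⟨k, o, core_of_sector (flipIf_mem (turn_mem hw k) o) h⟩

lemma pt_eq_chartMap {w : ℍ} (hw : w ∈ polygon q t) {k : ℤ} {o : Bool}
    (h : Core q t (flipIf o (turn q k w))) (e : D) (c : Bool) :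
    pt M q t e false c w = chartMap M q t ((M.rot ^ (-k)) e) o c (flipIf o (turn q k w)) := by
  rw [chartMap_core h, pt_flip h.1, flipIf_flipIf, pt_rot_zpow (turn_mem hw k), turn_turn]
  simp

lemma exists_chart (x : X M q t) : ∃ d o b z, Core q t z ∧ x = chartMap M q t d o b z := by
  obtain ⟨e, c, w, hw, rfl⟩ := exists_pt x
  obtain ⟨k, o, h⟩ := exists_core hw
  exact ⟨_, _, _, _, h, pt_eq_chartMap hw h e c⟩

section
variable [L : Loopless M q]

lemma injOn_chartMap (d : D) (o b : Bool) : Set.InjOn (chartMap M q t d o b) (U q t) := by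
  intro x hx x' hx' h
  obtain ⟨e, c, z, hz, e1⟩ := exists_pt (chartMap M q t d o b x)
  rcases chart_piece (M := M) (q := q) (t := t) d o b e c with h1 | ⟨g, hg⟩
  · exact (h1 x hx z hz e1.symm).elim
  · rw [← (hg x hx z hz).1 e1.symm, ← (hg x' hx' z hz).1 (by rw [← e1, h])]

/-- Openness in the quotient is tested on each polygon, where the trace of the image is empty or the
preimage of V under an isometry. -/
lemma isOpen_chartMap_image (d : D) (o b : Bool) {V : Set ℍ} (hV : V ⊆ U q t) (hVo : IsOpen V) :
    IsOpen (chartMap M q t d o b '' V) := by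
  rw [← isQuotientMap_quot_mk.isOpen_preimage, isOpen_sigma_iff]
  rintro ⟨e, c⟩
  rcases chart_piece (M := M) (q := q) (t := t) d o b e c with h1 | ⟨g, hg⟩
  · convert isOpen_empty
    ext z
    simp only [Set.mem_preimage, Set.mem_image, Set.mem_empty_iff_false, iff_false]
    rintro ⟨x, hx, h⟩
    exact h1 x (hV hx) z z.2 (by rw [pt_false z.2, h]; rfl)
  · convert hVo.preimage (g.continuous.comp continuous_subtype_val) using 1
    ext z
    simp only [Set.mem_preimage, Set.mem_image, Function.comp_apply]
    constructor
    · rintro ⟨x, hx, h⟩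
      rw [(hg x (hV hx) z z.2).1 (by rw [pt_false z.2, h]; rfl)]
      exact hx
    · intro h
      exact ⟨_, h, by rw [← (hg _ (hV h) z z.2).2 rfl, pt_false z.2]; rfl⟩

lemma isClosed_chartMap_image (d : D) (o b : Bool) {V : Set ℍ} (hV : V ⊆ U q t)
    (hVo : IsClosed V) : IsClosed (chartMap M q t d o b '' V) := by
  rw [← isQuotientMap_quot_mk.isClosed_preimage, isClosed_sigma_iff]
  rintro ⟨e, c⟩
  rcases chart_piece (M := M) (q := q) (t := t) d o b e c with h1 | ⟨g, hg⟩
  · convert isClosed_empty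
    ext z
    simp only [Set.mem_preimage, Set.mem_image, Set.mem_empty_iff_false, iff_false]
    rintro ⟨x, hx, h⟩
    exact h1 x (hV hx) z z.2 (by rw [pt_false z.2, h]; rfl)
  · convert hVo.preimage (g.continuous.comp continuous_subtype_val) using 1
    ext z
    simp only [Set.mem_preimage, Set.mem_image, Function.comp_apply]
    constructor
    · rintro ⟨x, hx, h⟩
      rw [(hg x (hV hx) z z.2).1 (by rw [pt_false z.2, h]; rfl)]
      exact hx
    · intro h
      exact ⟨_, h, by rw [← (hg _ (hV h) z z.2).2 rfl, pt_false z.2]; rfl⟩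

/-- The image of a small closed disc of a chart around x is closed in the surface and avoids y, so
its complement separates y from the image of the open disc. -/
lemma t2Space_surface (M : SurfaceMap D) (q : ℕ) (t : ℝ) [Good q t] [Loopless M q] :
    T2Space (X M q t) := by
  refine ⟨fun x y hxy => ?_⟩
  obtain ⟨d, o, b, z, hz, rfl⟩ := exists_chart x
  obtain ⟨η, hη, hball⟩ : ∃ η > 0, Metric.closedBall z η ⊆ U q t ∧
      y ∉ chartMap M q t d o b '' Metric.closedBall z η := by
    obtain ⟨η, hη, hη'⟩ := Metric.isOpen_iff.1 (isOpen_U q t) z (mem_U_of_core hz)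
    by_cases hy : ∃ w ∈ U q t, y = chartMap M q t d o b w
    · obtain ⟨w, hw, rfl⟩ := hy
      have hzw : 0 < dist w z := dist_pos.2 fun h => hxy (by rw [h])
      refine ⟨min (η / 2) (dist w z / 2), by positivity, ?_, ?_⟩
      · exact (Metric.closedBall_subset_ball ((min_le_left _ _).trans_lt (half_lt_self hη))).trans
          hη'
      · rintro ⟨w', hw', h⟩
        have : w' = w := injOn_chartMap d o b
          ((Metric.closedBall_subset_ball
            ((min_le_left _ _).trans_lt (half_lt_self hη))).trans hη' hw') hw h
        subst this
        have := (Metric.mem_closedBall.1 hw').trans (min_le_right _ _)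
        linarith
    · refine ⟨η / 2, half_pos hη,
        (Metric.closedBall_subset_ball (half_lt_self hη)).trans hη', ?_⟩
      rintro ⟨w', hw', h⟩
      exact hy ⟨w', (Metric.closedBall_subset_ball (half_lt_self hη)).trans hη' hw', h.symm⟩
  refine ⟨chartMap M q t d o b '' Metric.ball z η, (chartMap M q t d o b '' Metric.closedBall z η)ᶜ,
    isOpen_chartMap_image d o b (Metric.ball_subset_closedBall.trans hball.1) Metric.isOpen_ball,
    (isClosed_chartMap_image d o b hball.1 Metric.isClosed_closedBall).isOpen_compl,
    ⟨z, Metric.mem_ball_self hη, rfl⟩, hball.2, ?_⟩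
  rw [Set.disjoint_compl_right_iff_subset]
  exact Set.image_mono Metric.ball_subset_closedBall

variable (M q t) in
/-- The charts around the corners. -/
def chart (d : D) (o b : Bool) : OpenPartialHomeomorph (X M q t) ℍ :=
  (OpenPartialHomeomorph.ofContinuousOpenRestrict
    ((injOn_chartMap (M := M) (t := t) d o b).toPartialEquiv (chartMap M q t d o b) (U q t))
    (continuousOn_chartMap d o b)
    (by
      intro V hV
      have e : (U q t).domRestrict (chartMap M q t d o b) '' V =
          chartMap M q t d o b '' (Subtype.val '' V) := by
        rw [Set.image_image]; rfl
      show IsOpen ((U q t).domRestrict (chartMap M q t d o b) '' V)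
      rw [e]
      exact isOpen_chartMap_image d o b (by rintro _ ⟨x, -, rfl⟩; exact x.2)
        ((isOpen_U q t).isOpenEmbedding_subtypeVal.isOpenMap V hV))
    (isOpen_U q t)).symm

lemma chart_source (d : D) (o b : Bool) :
    (chart M q t d o b).source = chartMap M q t d o b '' U q t := rfl

lemma chart_chartMap (d : D) (o b : Bool) {x : ℍ} (hx : x ∈ U q t) :
    chart M q t d o b (chartMap M q t d o b x) = x :=
  PartialEquiv.left_inv
    ((injOn_chartMap (M := M) (t := t) d o b).toPartialEquiv (chartMap M q t d o b) (U q t)) hx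

lemma chartMap_chart (d : D) (o b : Bool) {x : X M q t} (hx : x ∈ (chart M q t d o b).source) :
    chartMap M q t d o b (chart M q t d o b x) = x := by
  rw [chart_source] at hx
  obtain ⟨z, hz, rfl⟩ := hx
  rw [chart_chartMap d o b hz]

lemma chart_mem_U (d : D) (o b : Bool) {x : X M q t} (hx : x ∈ (chart M q t d o b).source) :
    chart M q t d o b x ∈ U q t := by
  rw [chart_source] at hx
  obtain ⟨z, hz, rfl⟩ := hx
  rwa [chart_chartMap d o b hz]

lemma isHyperbolicChart_chart (d : D) (o b : Bool) :
    IsHyperbolicChart M q t (chart M q t d o b) := by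
  intro e c
  rcases chart_piece (M := M) (q := q) (t := t) d o b e c with h1 | ⟨g, hg⟩
  · refine ⟨IsometryEquiv.refl ℍ, fun z hz => ?_⟩
    rw [chart_source] at hz
    obtain ⟨x, hx, h⟩ := hz
    exact (h1 x hx z z.2 (by rw [pt_false z.2, h])).elim
  · refine ⟨g, fun z hz => ?_⟩
    rw [chart_source] at hz
    obtain ⟨x, hx, h⟩ := hz
    rw [← h, chart_chartMap d o b hx, (hg x hx z z.2).1 (by rw [pt_false z.2, h])]

/-! ### Lifts of geodesics to charts -/

variable {γ : ℝ → X M q t}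

lemma IsGeodesic.continuous (hγ : IsGeodesic M q t γ) : Continuous γ := by
  rw [continuous_iff_continuousAt]
  intro r
  obtain ⟨φ, -, ε, hε, h⟩ := hγ r
  have hI : Set.Ioo (r - ε) (r + ε) ∈ nhds r := Ioo_mem_nhds (by linarith) (by linarith)
  have h1 : ContinuousOn (fun a => φ (γ a)) (Set.Ioo (r - ε) (r + ε)) :=
    UnitSpeedOn.continuousOn fun a ha b hb => (h a ha b hb).2.2
  have h2 : ContinuousOn (fun a => φ.symm (φ (γ a))) (Set.Ioo (r - ε) (r + ε)) :=
    φ.continuousOn_symm.comp h1 fun a ha => φ.map_source (h a ha a ha).1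
  have h3 : ContinuousOn γ (Set.Ioo (r - ε) (r + ε)) :=
    h2.congr fun a ha => (φ.left_inv (h a ha a ha).1).symm
  exact h3.continuousAt hI

/-- The transition maps are isometric on the quadrants. -/
lemma dist_transition {φ : OpenPartialHomeomorph (X M q t) ℍ} (hφ : IsHyperbolicChart M q t φ)
    (d : D) (o b : Bool) {i j : Bool} {x y : ℍ} (hx : x ∈ U q t) (hy : y ∈ U q t)
    (hxs : chartMap M q t d o b x ∈ φ.source) (hys : chartMap M q t d o b y ∈ φ.source)
    (hxq : Quadrant q t i j x) (hyq : Quadrant q t i j y) :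
    dist (φ (chartMap M q t d o b x)) (φ (chartMap M q t d o b y)) = dist x y := by
  obtain ⟨g, hg⟩ := hφ (if i then M.rev d else d) (b ^^ j)
  rw [chartMap_eq hx hxq, pt_eq (core_fold hx).1] at hxs ⊢
  rw [chartMap_eq hy hyq, pt_eq (core_fold hy).1] at hys ⊢
  rw [hg _ hxs, hg _ hys, g.dist_eq, dist_flipIf, fold_eq_quadRefl hxq, fold_eq_quadRefl hyq,
    dist_quadRefl]

/-- The definition provides some chart φ. Its transition to the corner chart is isometric on each
closed quadrant, hence does not lengthen paths in either direction, and so preserves distances along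
the geodesic. -/
lemma IsGeodesic.exists_lift (hγ : IsGeodesic M q t γ) {r₀ : ℝ} {d : D} {o b : Bool} {x₀ : ℍ}
    (hx₀ : x₀ ∈ U q t) (h₀ : γ r₀ = chartMap M q t d o b x₀) :
    ∃ ε > 0, ∃ c : ℝ → ℍ, c r₀ = x₀ ∧ UnitSpeedOn c (Set.Ioo (r₀ - ε) (r₀ + ε)) ∧
      ∀ r ∈ Set.Ioo (r₀ - ε) (r₀ + ε), c r ∈ U q t ∧ γ r = chartMap M q t d o b (c r) := by
  obtain ⟨φ, hφ, ε₁, hε₁, h1⟩ := hγ r₀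
  have hr₀ : r₀ ∈ Set.Ioo (r₀ - ε₁) (r₀ + ε₁) := ⟨by linarith, by linarith⟩
  set e := chart M q t d o b with he
  set W := U q t ∩ chartMap M q t d o b ⁻¹' φ.source with hW
  have hWo : IsOpen W := (continuousOn_chartMap d o b).isOpen_inter_preimage (isOpen_U q t)
    φ.open_source
  have hxW : x₀ ∈ W := ⟨hx₀, by
    show chartMap M q t d o b x₀ ∈ φ.source
    rw [← h₀]; exact (h1 r₀ hr₀ r₀ hr₀).1⟩
  obtain ⟨η, hη, hηW⟩ := Metric.isOpen_iff.1 hWo x₀ hxW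
  have hsrc : γ r₀ ∈ e.source := by rw [h₀]; exact ⟨x₀, hx₀, rfl⟩
  have hce : ContinuousAt (fun r => e (γ r)) r₀ :=
    (e.continuousAt hsrc).comp hγ.continuous.continuousAt
  have hc0 : e (γ r₀) = x₀ := by rw [h₀, he, chart_chartMap d o b hx₀]
  have hev : ∀ᶠ r in nhds r₀, γ r ∈ e.source ∧ dist (e (γ r)) x₀ < η / 3 ∧
      r ∈ Set.Ioo (r₀ - ε₁) (r₀ + ε₁) := by
    refine (hγ.continuous.continuousAt.eventually_mem (e.open_source.mem_nhds hsrc)).and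
      (Filter.Eventually.and ?_ (Ioo_mem_nhds hr₀.1 hr₀.2))
    have := Metric.tendsto_nhds.1 hce (η / 3) (by positivity)
    simp only [hc0] at this
    exact this
  obtain ⟨ε, hε, hεh⟩ := Metric.eventually_nhds_iff.1 hev
  have hI : ∀ r ∈ Set.Ioo (r₀ - ε) (r₀ + ε), γ r ∈ e.source ∧ dist (e (γ r)) x₀ < η / 3 ∧
      r ∈ Set.Ioo (r₀ - ε₁) (r₀ + ε₁) := fun r hr => hεh (by
    rw [Real.dist_eq, abs_lt]; exact ⟨by linarith [hr.1], by linarith [hr.2]⟩)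
  have hcU : ∀ r ∈ Set.Ioo (r₀ - ε) (r₀ + ε), e (γ r) ∈ U q t ∧
      γ r = chartMap M q t d o b (e (γ r)) := fun r hr =>
    ⟨chart_mem_U d o b (hI r hr).1, (chartMap_chart d o b (hI r hr).1).symm⟩
  have hcW : ∀ r ∈ Set.Ioo (r₀ - ε) (r₀ + ε), e (γ r) ∈ W := fun r hr =>
    hηW (Metric.mem_ball.2 ((hI r hr).2.1.trans (by linarith)))
  have hcc : ContinuousOn (fun r => e (γ r)) (Set.Ioo (r₀ - ε) (r₀ + ε)) :=
    e.continuousOn.comp hγ.continuous.continuousOn fun r hr => (hI r hr).1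
  have key : ∀ a ∈ Set.Ioo (r₀ - ε) (r₀ + ε), ∀ b' ∈ Set.Ioo (r₀ - ε) (r₀ + ε), a ≤ b' →
      dist (e (γ a)) (e (γ b')) = b' - a := by
    intro a ha b' hb' hab
    have hsub : Set.Icc a b' ⊆ Set.Ioo (r₀ - ε) (r₀ + ε) := fun r hr =>
      ⟨ha.1.trans_le hr.1, hr.2.trans_lt hb'.2⟩
    have hT : ∀ r ∈ Set.Ioo (r₀ - ε) (r₀ + ε), φ (chartMap M q t d o b (e (γ r))) = φ (γ r) :=
      fun r hr => by rw [← (hcU r hr).2]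
    apply le_antisymm
    -- Upper bound: the geodesic itself, cut according to the quadrants of the corner chart.
    · refine dist_le_of_closed_cover (f := fun r => e (γ r)) hab
        (fun p : Bool × Bool => {r | Quadrant q t p.1 p.2 (e (γ r))}) ?_ ?_ ?_
      · rintro ⟨i, j⟩
        have := (hcc.mono hsub).preimage_isClosed_of_isClosed isClosed_Icc
          (isClosed_quadrant (q := q) (t := t) i j)
        rwa [Set.inter_comm] at this
      · intro r _
        obtain ⟨i, j, h⟩ := exists_quadrant (q := q) (t := t) (e (γ r))
        exact ⟨(i, j), h⟩
      · rintro ⟨i, j⟩ r ⟨hr, hr'⟩ r' ⟨hs, hs'⟩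
        have := dist_transition hφ d o b (hcU r (hsub hr')).1 (hcU r' (hsub hs')).1
          (hcW r (hsub hr')).2 (hcW r' (hsub hs')).2 hr hs
        rw [← this, hT r (hsub hr'), hT r' (hsub hs'),
          (h1 r (hI r (hsub hr')).2.2 r' (hI r' (hsub hs')).2.2).2.2, abs_sub_comm]
    · have hdist := (h1 a (hI a ha).2.2 b' (hI b' hb').2.2).2.2
      rw [abs_sub_comm, abs_of_nonneg (by linarith)] at hdist
      rw [← hdist, ← hT a ha, ← hT b' hb']
      rcases eq_or_ne (e (γ a)) (e (γ b')) with heq | hne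
      · rw [heq]; simp
      -- Lower bound: the segment between the two points of the corner chart is transported into φ.
      -- Its ends are within η/3 of x₀, so it stays in the ball of radius η where the transition is
      -- defined.
      obtain ⟨τ, τ0, τ1, hτ⟩ := exists_segment hne
      set ℓ := dist (e (γ a)) (e (γ b')) with hℓ
      have hℓ0 : 0 ≤ ℓ := dist_nonneg
      have hℓη : ℓ < 2 * (η / 3) := by
        have := dist_triangle_right (e (γ a)) (e (γ b')) x₀
        linarith [(hI a ha).2.1, (hI b' hb').2.1]
      have hτW : ∀ r ∈ Set.Icc 0 ℓ, τ r ∈ W := by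
        intro r hr
        apply hηW
        rw [Metric.mem_ball]
        have h2 := hτ r hr 0 ⟨le_rfl, hℓ0⟩
        rw [sub_zero, abs_of_nonneg hr.1, τ0] at h2
        have h3 := dist_triangle (τ r) (e (γ a)) x₀
        linarith [(hI a ha).2.1, hr.2]
      have := dist_le_of_closed_cover (f := fun r => φ (chartMap M q t d o b (τ r))) hℓ0
        (fun p : Bool × Bool => {r | Quadrant q t p.1 p.2 (τ r)}) (by
          rintro ⟨i, j⟩
          have := hτ.continuousOn.preimage_isClosed_of_isClosed isClosed_Icc
            (isClosed_quadrant (q := q) (t := t) i j)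
          rwa [Set.inter_comm] at this) (by
          intro r _
          obtain ⟨i, j, h⟩ := exists_quadrant (q := q) (t := t) (τ r)
          exact ⟨(i, j), h⟩) (by
          rintro ⟨i, j⟩ r ⟨hr, hr'⟩ r' ⟨hs, hs'⟩
          rw [dist_transition hφ d o b (hτW r hr').1 (hτW r' hs').1 (hτW r hr').2 (hτW r' hs').2
            hr hs, hτ r hr' r' hs', abs_sub_comm])
      simpa [τ0, τ1] using this
  refine ⟨ε, hε, fun r => e (γ r), hc0, ?_, hcU⟩
  intro a ha b' hb'
  rcases le_total a b' with h | h
  · rw [key a ha b' hb' h, abs_sub_comm, abs_of_nonneg (by linarith)]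
  · rw [dist_comm, key b' hb' a ha h, abs_of_nonneg (by linarith)]

/-- Two geodesics that agree on an interval are equal. -/
lemma IsGeodesic.eq_of_eqOn (hγ : IsGeodesic M q t γ) {γ' : ℝ → X M q t}
    (hγ' : IsGeodesic M q t γ') {a b : ℝ} (hab : a < b) (h : Set.EqOn γ γ' (Set.Ioo a b)) :
    γ = γ' := by
  have := t2Space_surface M q t
  -- Unique continuation by connectedness. At a limit point both curves lift to one chart, and two
  -- nearby times of agreement determine both lifts.
  let S : Set ℝ := {r | ∀ᶠ r' in nhds r, γ r' = γ' r'}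
  have hSo : IsOpen S := isOpen_setOfPred_eventually_nhds
  have hSc : IsClosed S := by
    rw [← closure_subset_iff_isClosed]
    intro r hr
    have heq : γ r = γ' r := by
      have hcl : IsClosed {r | γ r = γ' r} := isClosed_eq hγ.continuous hγ'.continuous
      exact hcl.closure_subset_iff.2 (fun r hr => hr.self_of_nhds) hr
    obtain ⟨d, o, b, z, hz, hc⟩ := exists_chart (γ r)
    obtain ⟨ε, hε, c, hc0, hcu, hcγ⟩ := hγ.exists_lift (mem_U_of_core hz) hc
    obtain ⟨ε', hε', c', hc0', hcu', hcγ'⟩ := hγ'.exists_lift (mem_U_of_core hz) (heq ▸ hc)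
    set δ := min ε ε' with hδ
    have hδ0 : 0 < δ := lt_min hε hε'
    have s1 : Set.Ioo (r - δ) (r + δ) ⊆ Set.Ioo (r - ε) (r + ε) :=
      Set.Ioo_subset_Ioo (by linarith [min_le_left ε ε']) (by linarith [min_le_left ε ε'])
    have s2 : Set.Ioo (r - δ) (r + δ) ⊆ Set.Ioo (r - ε') (r + ε') :=
      Set.Ioo_subset_Ioo (by linarith [min_le_right ε ε']) (by linarith [min_le_right ε ε'])
    obtain ⟨r₁, hr₁, hr₁S⟩ := mem_closure_iff.1 hr (Set.Ioo (r - δ) (r + δ)) isOpen_Ioo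
      ⟨by linarith, by linarith⟩
    have hev : ∀ᶠ r' in nhds r₁, γ r' = γ' r' ∧ r' ∈ Set.Ioo (r - δ) (r + δ) :=
      Filter.Eventually.and hr₁S (isOpen_Ioo.mem_nhds hr₁)
    obtain ⟨κ, hκ, hκh⟩ := Metric.eventually_nhds_iff.1 hev
    have hk1 := hκh (y := r₁) (by simpa using hκ)
    have hk2 := hκh (y := r₁ + κ / 2) (by
      rw [Real.dist_eq, add_sub_cancel_left, abs_of_pos (half_pos hκ)]; linarith)
    have agree : ∀ r' ∈ Set.Ioo (r - δ) (r + δ), γ r' = γ' r' → c r' = c' r' := by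
      intro r' hr' h'
      apply injOn_chartMap (M := M) (q := q) (t := t) d o b (hcγ r' (s1 hr')).1 (hcγ' r' (s2 hr')).1
      rw [← (hcγ r' (s1 hr')).2, h', (hcγ' r' (s2 hr')).2]
    have e1 := agree _ hk1.2 hk1.1
    have e2 := agree _ hk2.2 hk2.1
    filter_upwards [Ioo_mem_nhds (show r - δ < r by linarith) (show r < r + δ by linarith)]
      with r' hr'
    have hcc : c r' = c' r' := by
      refine eq_of_dist_eq (A := c r₁) (B := c (r₁ + κ / 2)) (a := r₁) (b := r₁ + κ / 2) (r := r')
        (by linarith) ?_ ?_ ?_ ?_ ?_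
      · rw [hcu _ (s1 hk1.2) _ (s1 hk2.2), abs_sub_comm]
      · rw [hcu _ (s1 hk1.2) _ (s1 hr'), abs_sub_comm]
      · rw [hcu _ (s1 hk2.2) _ (s1 hr')]
      · rw [e1, hcu' _ (s2 hk1.2) _ (s2 hr'), abs_sub_comm]
      · rw [e2, hcu' _ (s2 hk2.2) _ (s2 hr')]
    rw [(hcγ r' (s1 hr')).2, hcc, (hcγ' r' (s2 hr')).2]
  have hne : S.Nonempty := ⟨(a + b) / 2, by
    filter_upwards [Ioo_mem_nhds (show a < (a + b) / 2 by linarith)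
      (show (a + b) / 2 < b by linarith)] with r hr using h hr⟩
  have hS : S = Set.univ := IsClopen.eq_univ ⟨hSc, hSo⟩ hne
  funext r
  have : r ∈ S := by rw [hS]; trivial
  exact this.self_of_nhds

lemma IsGeodesic.comp_affine (hγ : IsGeodesic M q t γ) {δ : ℝ} (hδ : |δ| = 1) (u : ℝ) :
    IsGeodesic M q t fun r => γ (δ * r + u) := by
  intro r
  obtain ⟨φ, hφ, ε, hε, h⟩ := hγ (δ * r + u)
  refine ⟨φ, hφ, ε, hε, fun a ha b hb => ?_⟩
  have key : ∀ a ∈ Set.Ioo (r - ε) (r + ε), δ * a + u ∈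
      Set.Ioo (δ * r + u - ε) (δ * r + u + ε) := by
    intro a ha
    have : |δ * (a - r)| < ε := by
      rw [abs_mul, hδ, one_mul, abs_lt]; exact ⟨by linarith [ha.1], by linarith [ha.2]⟩
    obtain ⟨h1, h2⟩ := abs_lt.1 this
    exact ⟨by linarith, by linarith⟩
  obtain ⟨h1, h2, h3⟩ := h _ (key a ha) _ (key b hb)
  refine ⟨h1, h2, h3.trans ?_⟩
  rw [show δ * a + u - (δ * b + u) = δ * (a - b) by ring, abs_mul, hδ, one_mul]

end

end
end RightAngled

namespace RightAngled
noncomputable section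

open Real

set_option linter.unusedSectionVars false

/-! ### The blue and red curves are closed geodesics -/

variable {D : Type*} {M : SurfaceMap D} {q : ℕ} {t : ℝ} [G : Good q t]

/-- The concatenation of the curves `P j`, each on the interval from `j * ℓ` to `(j + 1) * ℓ`. -/
def concat {Y : Type*} (ℓ : ℝ) (P : ℤ → ℝ → Y) (r : ℝ) : Y := P ⌊r / ℓ⌋ r

lemma concat_eq {Y : Type*} {ℓ : ℝ} (hℓ : 0 < ℓ) {P : ℤ → ℝ → Y}
    (h : ∀ j : ℤ, P j ((j + 1) * ℓ) = P (j + 1) ((j + 1) * ℓ)) {j : ℤ} {r : ℝ} (h1 : j * ℓ ≤ r)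
    (h2 : r ≤ (j + 1) * ℓ) : concat ℓ P r = P j r := by
  unfold concat
  rcases eq_or_lt_of_le h2 with rfl | h2
  · rw [mul_div_cancel_right₀ _ hℓ.ne', h, ← Int.cast_one, ← Int.cast_add, Int.floor_intCast]
  · rw [Int.floor_eq_iff.2 ⟨(le_div_iff₀ hℓ).2 h1, (div_lt_iff₀ hℓ).2 h2⟩]

lemma exists_concat_eq {Y : Type*} {ℓ : ℝ} (hℓ : 0 < ℓ) (P : ℤ → ℝ → Y) (r : ℝ) :
    ∃ j : ℤ, j * ℓ ≤ r ∧ r ≤ (j + 1) * ℓ ∧ concat ℓ P r = P j r :=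
  ⟨⌊r / ℓ⌋, (le_div_iff₀ hℓ).1 (Int.floor_le _), ((div_lt_iff₀ hℓ).1 (Int.lt_floor_add_one _)).le,
    rfl⟩

lemma concat_periodic {Y : Type*} {ℓ : ℝ} (hℓ : 0 < ℓ) {P : ℤ → ℝ → Y} {n : ℤ}
    (h : ∀ j r, P (j + n) (r + n * ℓ) = P j r) : Function.Periodic (concat ℓ P) (n * ℓ) := by
  intro r
  unfold concat
  rw [add_div, mul_div_cancel_right₀ _ hℓ.ne', Int.floor_add_intCast, h]

/-- The lift c passes straight through the joint j, from the middle of one piece to the middle of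
the next. These half-pieces cover all times, so the corner charts suffice; `round` selects the
nearest joint. -/
lemma isGeodesic_concat [Loopless M q] {ℓ : ℝ} (hℓ : 0 < ℓ) {P : ℤ → ℝ → X M q t}
    (h : ∀ j : ℤ, P j ((j + 1) * ℓ) = P (j + 1) ((j + 1) * ℓ))
    (hP : ∀ j : ℤ, ∃ (d : D) (o b : Bool) (c : ℝ → ℍ), (∀ r r', dist (c r) (c r') = |r - r'|) ∧
      (∀ r, |r| ≤ ℓ / 2 → c r ∈ U q t) ∧
      (∀ r, c r ∈ U q t → 0 ≤ r → r ≤ ℓ → P j (j * ℓ + r) = chartMap M q t d o b (c r)) ∧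
      (∀ r, c r ∈ U q t → -ℓ ≤ r → r ≤ 0 →
        P (j - 1) (j * ℓ + r) = chartMap M q t d o b (c r))) :
    IsGeodesic M q t (concat ℓ P) := by
  intro r₀
  set j := round (r₀ / ℓ) with hj
  have hr₀ : |r₀ - j * ℓ| ≤ ℓ / 2 := by
    have := abs_sub_round (r₀ / ℓ)
    rw [← hj] at this
    have e : r₀ - j * ℓ = (r₀ / ℓ - j) * ℓ := by field_simp
    rw [e, abs_mul, abs_of_pos hℓ]
    nlinarith
  obtain ⟨d, o, b, c, hc, hU, h1, h2⟩ := hP j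
  have hcc : Continuous fun r => c (r - j * ℓ) := by
    have : Isometry c := Isometry.of_dist_eq fun r r' => by rw [hc, Real.dist_eq]
    exact this.continuous.comp (continuous_id.sub continuous_const)
  obtain ⟨ε, hε, hε'⟩ := Metric.isOpen_iff.1 ((isOpen_U q t).preimage hcc) r₀ (hU _ hr₀)
  refine ⟨chart M q t d o b, isHyperbolicChart_chart d o b, min ε (ℓ / 2), by positivity, ?_⟩
  have key : ∀ r ∈ Set.Ioo (r₀ - min ε (ℓ / 2)) (r₀ + min ε (ℓ / 2)), c (r - j * ℓ) ∈ U q t ∧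
      concat ℓ P r = chartMap M q t d o b (c (r - j * ℓ)) := by
    intro r hr
    have hU : c (r - j * ℓ) ∈ U q t := hε' (by
      rw [Metric.mem_ball, Real.dist_eq, abs_lt]
      constructor <;> linarith [hr.1, hr.2, min_le_left ε (ℓ / 2)])
    refine ⟨hU, ?_⟩
    obtain ⟨h3, h4⟩ := abs_le.1 hr₀
    have e : r = j * ℓ + (r - j * ℓ) := by ring
    rcases le_total (j * ℓ) r with hle | hle
    · rw [concat_eq hℓ h hle (by linarith [hr.2, min_le_right ε (ℓ / 2)])]
      conv_lhs => rw [e]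
      exact h1 _ hU (by linarith) (by linarith [hr.2, min_le_right ε (ℓ / 2)])
    · rw [concat_eq hℓ (j := j - 1) h
        (by push_cast; linarith [hr.1, min_le_right ε (ℓ / 2)]) (by push_cast; linarith)]
      conv_lhs => rw [e]
      exact h2 _ hU (by linarith [hr.1, min_le_right ε (ℓ / 2)]) (by linarith)
  intro r hr r' hr'
  obtain ⟨u1, e1⟩ := key r hr
  obtain ⟨u2, e2⟩ := key r' hr'
  refine ⟨?_, ?_, ?_⟩
  · rw [e1]; exact ⟨_, u1, rfl⟩
  · rw [e2]; exact ⟨_, u2, rfl⟩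
  · rw [e1, e2, chart_chartMap d o b u1, chart_chartMap d o b u2, hc]; congr 1; ring

lemma mem_U_of_fold {x z : ℍ} (h : fold q t x = z) (hz : Core q t z) : x ∈ U q t := by
  intro k h1 h2
  rw [h]; exact hz.2 k h1 h2

/-! ### The blue curves -/

section Blue

lemma fold_perp_of_nonneg {u : ℝ} (hu : u ≤ t / 2) :
    Quadrant q t false false (perp (apothem q t) u) ∧
      fold q t (perp (apothem q t) u) = perp (apothem q t) u := by
  have h : Quadrant q t false false (perp (apothem q t) u) := by
    refine ⟨by simp [blueH_zero_perp], ?_⟩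
    simp only [Bool.false_eq_true, if_false, redH_zero_perp]
    exact Real.sinh_nonneg_iff.2 (by linarith)
  exact ⟨h, fold_eq_quadRefl h⟩

lemma fold_perp_of_le {u : ℝ} (hu : t / 2 ≤ u) :
    Quadrant q t false true (perp (apothem q t) u) ∧
      fold q t (perp (apothem q t) u) = perp (apothem q t) (t - u) := by
  have h : Quadrant q t false true (perp (apothem q t) u) := by
    refine ⟨by simp [blueH_zero_perp], ?_⟩
    simp only [if_true, redH_zero_perp]
    rw [← Real.sinh_neg]
    exact Real.sinh_nonneg_iff.2 (by linarith)
  refine ⟨h, ?_⟩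
  rw [fold_eq_quadRefl h]
  simp [quadRefl, redRefl_perp]

/-- The range goes from the midpoint of the side, through the corner t/2, to the midpoint of its
mirror image; at u = 0 the fold still lands in the sector. -/
lemma perp_mem_U {u : ℝ} (h0 : 0 ≤ u) (h1 : u ≤ t) : perp (apothem q t) u ∈ U q t := by
  rcases le_total u (t / 2) with h | h
  · exact mem_U_of_fold (fold_perp_of_nonneg h).2 (core_of_sector
      (perp_mem (by rwa [abs_of_nonneg h0])) (sector_perp h0))
  · exact mem_U_of_fold (fold_perp_of_le h).2 (core_of_sector
      (perp_mem (by rw [abs_of_nonneg (by linarith)]; linarith)) (sector_perp (by linarith)))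

variable (M q t) in
/-- The part of the blue curve in one of the two copies, by arc length. -/
def blueArc (d : D) (j : ℤ) (r : ℝ) : X M q t :=
  pt M q t d (decide (Odd j)) (decide (Odd j)) (perp (apothem q t) (r - j * t - t / 2))

variable (M q t) in
/-- The blue curve, by arc length. -/
def blueGeodesic (d : D) : ℝ → X M q t := concat t (blueArc M q t d)

lemma odd_add_one (j : ℤ) : decide (Odd (j + 1)) = !decide (Odd j) := by
  rw [← decide_not, decide_eq_decide, Int.odd_iff, Int.odd_iff]
  omega

lemma pt_perp_not {u : ℝ} (hu : |u| ≤ t / 2) (d : D) (o b : Bool) :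
    pt M q t d (!o) b (perp (apothem q t) u) = pt M q t d o b (perp (apothem q t) (-u)) := by
  rw [pt_flip (perp_mem hu), pt_flip (perp_mem (by rwa [abs_neg])), ← mirror_perp]
  cases o <;> simp

lemma blueArc_joint (d : D) (j : ℤ) :
    blueArc M q t d j ((j + 1) * t) = blueArc M q t d (j + 1) ((j + 1) * t) := by
  have ht := G.pos
  have hu : |t / 2| ≤ t / 2 := by rw [abs_of_pos (half_pos ht)]
  unfold blueArc
  rw [odd_add_one, show (j + 1) * t - ((j + 1 : ℤ) : ℝ) * t - t / 2 = -(t / 2) by push_cast; ring,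
    show (j + 1) * t - j * t - t / 2 = t / 2 by ring, pt_perp_not (by rwa [abs_neg]), neg_neg]
  exact pt_red (perp_mem hu) (by rw [redH_zero_perp]; simp) _ _ _ _

lemma blueGeodesic_eq (d : D) {j : ℤ} {r : ℝ} (h1 : j * t ≤ r) (h2 : r ≤ (j + 1) * t) :
    blueGeodesic M q t d r = blueArc M q t d j r :=
  concat_eq G.pos (blueArc_joint d) h1 h2

lemma isClosedGeodesic_blue [Loopless M q] (d : D) :
    IsClosedGeodesic M q t (2 * t) (blueGeodesic M q t d) := by
  have ht := G.pos
  refine ⟨by linarith, ?_, isGeodesic_concat ht (blueArc_joint d) fun j => ?_⟩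
  · have := concat_periodic (P := blueArc M q t d) (n := 2) ht fun j r => by
      have e : r + ((2 : ℤ) : ℝ) * t - ((j + 2 : ℤ) : ℝ) * t - t / 2 = r - j * t - t / 2 := by
        push_cast; ring
      unfold blueArc
      rw [e, show j + 2 = j + 1 + 1 by ring, odd_add_one, odd_add_one, Bool.not_not]
    exact_mod_cast this
  -- The joint is the corner t/2. The lift moves down from this corner while the arc is parametrized
  -- upwards, hence the orientation opposite to that of `blueArc`.
  · refine ⟨d, !decide (Odd j), decide (Odd j), fun r => perp (apothem q t) (t / 2 - r), ?_, ?_, ?_,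
      ?_⟩
    · intro r r'
      rw [dist_perp, abs_sub_comm]; congr 1; ring
    · intro r hr
      obtain ⟨h1, h2⟩ := abs_le.1 hr
      exact perp_mem_U (by linarith) (by linarith)
    · intro r hU h0 h1
      obtain ⟨hq, hf⟩ := fold_perp_of_nonneg (q := q) (t := t) (u := t / 2 - r) (by linarith)
      rw [chartMap_eq hU hq, hf]
      simp only [Bool.false_eq_true, if_false, Bool.xor_false]
      rw [pt_perp_not (abs_le.2 ⟨by linarith, by linarith⟩)]
      unfold blueArc; congr 2; ring
    · intro r hU h0 h1
      obtain ⟨hq, hf⟩ := fold_perp_of_le (q := q) (t := t) (u := t / 2 - r) (by linarith)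
      rw [chartMap_eq hU hq, hf]
      simp only [Bool.false_eq_true, if_false, Bool.xor_false, Bool.xor_true]
      have := odd_add_one (j - 1)
      rw [sub_add_cancel] at this
      rw [this, Bool.not_not]
      unfold blueArc; congr 2; push_cast; ring

lemma range_blueGeodesic (d : D) : Set.range (blueGeodesic M q t d) = blueCurve M q t d := by
  have ht := G.pos
  ext x
  constructor
  · rintro ⟨r, rfl⟩
    obtain ⟨j, h1, h2, h3⟩ := exists_concat_eq ht (blueArc M q t d) r
    rw [blueGeodesic, h3, blueArc]
    have hm : |r - j * t - t / 2| ≤ t / 2 := abs_le.2 ⟨by linarith, by linarith⟩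
    rw [pt_eq (perp_mem hm)]
    cases decide (Odd j)
    · exact ⟨_, _, _, hm, rfl, rfl⟩
    · exact ⟨_, _, _, by rwa [abs_neg], mirror_perp _ _, rfl⟩
  · rintro ⟨b, u, ⟨z, hz⟩, hu, e, rfl⟩
    obtain rfl : z = perp (apothem q t) u := e
    obtain ⟨h1, h2⟩ := abs_le.1 hu
    rw [← pt_false hz]
    cases b
    · refine ⟨u + t / 2, ?_⟩
      rw [blueGeodesic_eq d (j := 0) (by push_cast; linarith) (by push_cast; linarith), blueArc]
      simp
    · refine ⟨t + (t / 2 - u), ?_⟩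
      rw [blueGeodesic_eq d (j := 1) (by push_cast; linarith) (by push_cast; linarith), blueArc,
        show t + (t / 2 - u) - ((1 : ℤ) : ℝ) * t - t / 2 = -u by push_cast; ring]
      have := pt_perp_not (M := M) (q := q) hu d true true
      simpa using this.symm

end Blue

/-! ### The red curves -/

section Red

lemma dist_redSide (u v : ℝ) : dist (redSide q t u) (redSide q t v) = |u - v| := by
  rw [redSide_eq, redSide_eq, dist_rotation, dist_perp]

lemma fold_redSide_of_le {u : ℝ} (hu : -(s q t / 2) ≤ u) :
    Quadrant q t false false (redSide q t u) ∧ fold q t (redSide q t u) = redSide q t u := by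
  have h : Quadrant q t false false (redSide q t u) := by
    refine ⟨?_, by simp [redH_zero_redSide]⟩
    simp only [Bool.false_eq_true, if_false, blueH_zero_redSide]
    exact Real.sinh_nonneg_iff.2 (by linarith)
  exact ⟨h, fold_eq_quadRefl h⟩

lemma fold_redSide_of_ge {u : ℝ} (hu : u ≤ -(s q t / 2)) :
    Quadrant q t true false (redSide q t u) ∧
      fold q t (redSide q t u) = redSide q t (-s q t - u) := by
  have h : Quadrant q t true false (redSide q t u) := by
    refine ⟨?_, by simp [redH_zero_redSide]⟩
    simp only [if_true, blueH_zero_redSide]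
    rw [← Real.sinh_neg]
    exact Real.sinh_nonneg_iff.2 (by linarith)
  refine ⟨h, ?_⟩
  rw [fold_eq_quadRefl h]
  simp [quadRefl, blueRefl_redSide]

lemma redSide_mem_U {u : ℝ} (h0 : -s q t ≤ u) (h1 : u ≤ 0) : redSide q t u ∈ U q t := by
  rcases le_total (-(s q t / 2)) u with h | h
  · exact mem_U_of_fold (fold_redSide_of_le h).2 (core_of_sector
      (redSide_mem (by rw [abs_of_nonpos h1]; linarith)) (sector_redSide h1))
  · exact mem_U_of_fold (fold_redSide_of_ge h).2 (core_of_sector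
      (redSide_mem (by rw [abs_of_nonpos (by linarith)]; linarith)) (sector_redSide (by linarith)))

variable (M q t) in
/-- One of the red sides along the face of `d`, by arc length. -/
def redArc (d : D) (j : ℤ) (r : ℝ) : X M q t :=
  pt M q t (((M.rev * M.rot) ^ j) d) false false (redSide q t (r - j * s q t - s q t / 2))

variable (M q t) in
/-- The red curve, by arc length. -/
def redGeodesic (d : D) : ℝ → X M q t := concat (s q t) (redArc M q t d)

lemma face_zpow_add_one (j : ℤ) (d : D) :
    ((M.rev * M.rot) ^ (j + 1)) d = M.rev (M.rot (((M.rev * M.rot) ^ j) d)) := by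
  rw [add_comm, zpow_add, zpow_one]; rfl

/-- The red side that follows d is the one that precedes `rot d`; in the reversed polygon of `rot d`
it is number 0 with the opposite parameter. -/
lemma pt_redSide_rev {u : ℝ} (hu : |u| ≤ s q t / 2) (d : D) (b : Bool) :
    pt M q t (M.rot d) true b (redSide q t u) = pt M q t d false b (redSide q t (-u)) := by
  rw [pt_flip (redSide_mem hu), flipIf_true, pt_rot (mirror_mem (redSide_mem hu)),
    turn_one_mirror_redSide]

lemma redArc_joint (d : D) (j : ℤ) :
    redArc M q t d j ((j + 1) * s q t) = redArc M q t d (j + 1) ((j + 1) * s q t) := by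
  have hs := s_pos q t
  have hu : |-(s q t / 2)| ≤ s q t / 2 := by rw [abs_neg, abs_of_pos (half_pos hs)]
  unfold redArc
  rw [face_zpow_add_one,
    show (j + 1) * s q t - ((j + 1 : ℤ) : ℝ) * s q t - s q t / 2 = -(s q t / 2) by push_cast; ring,
    show (j + 1) * s q t - j * s q t - s q t / 2 = - -(s q t / 2) by ring, ← pt_redSide_rev hu,
    pt_blue (redSide_mem hu) (by rw [blueH_zero_redSide]; simp)]
  rfl

lemma redGeodesic_eq (d : D) {j : ℤ} {r : ℝ} (h1 : j * s q t ≤ r) (h2 : r ≤ (j + 1) * s q t) :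
    redGeodesic M q t d r = redArc M q t d j r :=
  concat_eq (s_pos q t) (redArc_joint d) h1 h2

/-- The blue side is perpendicular to the red one, so the reflection in it prolongs the red side by
that of the next polygon along the face. After p steps the face closes. -/
lemma isClosedGeodesic_red [Loopless M q] (d : D) {p : ℕ} (hp : 0 < p)
    (hd : ((M.rev * M.rot) ^ p) d = d) :
    IsClosedGeodesic M q t (p * s q t) (redGeodesic M q t d) := by
  have hs := s_pos q t
  refine ⟨by positivity, ?_, isGeodesic_concat hs (redArc_joint d) fun j => ?_⟩
  · have := concat_periodic (P := redArc M q t d) (n := p) hs fun j r => by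
      unfold redArc
      rw [zpow_add, Equiv.Perm.mul_apply, zpow_natCast, hd]
      congr 2; push_cast; ring
    exact_mod_cast this
  · refine ⟨((M.rev * M.rot) ^ j) d, false, false, fun r => redSide q t (-(s q t / 2) + r),
      ?_, ?_, ?_, ?_⟩
    · intro r r'
      rw [dist_redSide]; congr 1; ring
    · intro r hr
      obtain ⟨h1, h2⟩ := abs_le.1 hr
      exact redSide_mem_U (by linarith) (by linarith)
    · intro r hU h0 h1
      obtain ⟨hq, hf⟩ := fold_redSide_of_le (q := q) (t := t) (u := -(s q t / 2) + r) (by linarith)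
      rw [chartMap_eq hU hq, hf]
      simp only [Bool.false_eq_true, if_false, Bool.xor_false]
      unfold redArc; congr 2; ring
    · intro r hU h0 h1
      obtain ⟨hq, hf⟩ := fold_redSide_of_ge (q := q) (t := t) (u := -(s q t / 2) + r) (by linarith)
      rw [chartMap_eq hU hq, hf]
      simp only [if_true, Bool.xor_false, Bool.xor_true, Bool.not_false]
      have := face_zpow_add_one (M := M) (j - 1) d
      rw [sub_add_cancel] at this
      rw [this, M.rev_rev, pt_redSide_rev (abs_le.2 ⟨by linarith, by linarith⟩)]
      unfold redArc; congr 2; push_cast; ring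

lemma range_redGeodesic (d : D) : Set.range (redGeodesic M q t d) = redCurve M q t d := by
  have hs := s_pos q t
  ext x
  constructor
  · rintro ⟨r, rfl⟩
    obtain ⟨j, h1, h2, h3⟩ := exists_concat_eq hs (redArc M q t d) r
    rw [redGeodesic, h3, redArc]
    have hm : |r - j * s q t - s q t / 2| ≤ s q t / 2 := abs_le.2 ⟨by linarith, by linarith⟩
    rw [pt_false (redSide_mem hm)]
    exact ⟨_, _, _, _, ⟨j, rfl⟩, hm, rfl, rfl⟩
  · rintro ⟨e, b, u, ⟨z, hz⟩, ⟨j, rfl⟩, hu, e, rfl⟩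
    obtain rfl : z = redSide q t u := e
    obtain ⟨h1, h2⟩ := abs_le.1 hu
    refine ⟨j * s q t + s q t / 2 + u, ?_⟩
    rw [redGeodesic_eq d (j := j) (by linarith) (by linarith), redArc, ← pt_false hz,
      pt_red_copy hz ⟨0, redH_zero_redSide u⟩ _ b false]
    congr 2; ring

end Red

end
end RightAngled

namespace RightAngled
noncomputable section

open Real

set_option linter.unusedSectionVars false

/-! ### The doubled polygon of a vertex -/

variable {D : Type*} {M : SurfaceMap D} {q : ℕ} {t : ℝ} [G : Good q t]

variable (M q t) in
/-- The union of the two copies of the polygon of the initial vertex of `e`. -/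
def star (e : D) : Set (X M q t) := {x | ∃ b, ∃ z ∈ polygon q t, x = pt M q t e false b z}

variable (M q t) in
/-- The position in the polygon of a point of the doubled polygon. -/
def foldAt (e : D) (x : X M q t) : ℍ :=
  open Classical in if h : ∃ z ∈ polygon q t, ∃ b, x = pt M q t e false b z then h.choose else
    UpperHalfPlane.I

/-- A lift of a curve, near the time `r₀`, to the chart of a corner. -/
structure IsLift (γ : ℝ → X M q t) (r₀ ε : ℝ) (d : D) (o b : Bool) (c : ℝ → ℍ) : Prop where
  pos : 0 < ε
  speed : UnitSpeedOn c (Set.Ioo (r₀ - ε) (r₀ + ε))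
  mem : ∀ r ∈ Set.Ioo (r₀ - ε) (r₀ + ε), c r ∈ U q t
  eq : ∀ r ∈ Set.Ioo (r₀ - ε) (r₀ + ε), γ r = chartMap M q t d o b (c r)

/-- The reflection in the red side number `m`. -/
def redReflAt (q : ℕ) (t : ℝ) (m : ℤ) (z : ℍ) : ℍ := turn q m (redRefl q t (turn q (-m) z))

lemma mirror_redRefl (z : ℍ) : mirror (redRefl q t z) = redReflAt q t (-1) (mirror z) := by
  have h : height (apothem q (s q t)) (π / q) (turn q 1 (mirror z)) =
      height (apothem q (s q t)) (π / q) z := by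
    rw [turn, height_rotation, height_mirror]; congr 1; push_cast; ring
  have e : 2 * ((1 : ℤ) : ℝ) * π / q = 2 * (π / q) := by push_cast; ring
  refine (turn_eq_iff.2 ?_).symm
  rw [neg_neg]
  have h1 := Real.sin_sq_add_cos_sq (π / q)
  apply ext_coords
  · rw [redRefl, cX_reflect, h, turn, turn, cX_rotation, cX_rotation, cX_mirror, cY_mirror,
      cX_mirror, cY_mirror, redRefl, cX_reflect, cY_reflect, e, Real.sin_two_mul, Real.cos_two_mul']
    linear_combination (-2 * height (apothem q (s q t)) (π / q) z * cosh (apothem q (s q t)) *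
      cos (π / q)) * h1
  · rw [redRefl, cY_reflect, h, turn, turn, cY_rotation, cY_rotation, cX_mirror, cY_mirror,
      cX_mirror, cY_mirror, redRefl, cX_reflect, cY_reflect, e, Real.sin_two_mul, Real.cos_two_mul']
    linear_combination (-2 * height (apothem q (s q t)) (π / q) z * cosh (apothem q (s q t)) *
      sin (π / q)) * h1

lemma turn_redReflAt (k m : ℤ) (z : ℍ) :
    turn q k (redReflAt q t m z) = redReflAt q t (k + m) (turn q k z) := by
  unfold redReflAt
  rw [turn_turn, turn_turn]; congr 3; ring

lemma redReflAt_zero (z : ℍ) : redReflAt q t 0 z = redRefl q t z := by simp [redReflAt]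

/-- The red side number `0`, seen after a symmetry of the polygon. -/
lemma symm_redRefl (k : ℤ) (o : Bool) (z : ℍ) : turn q k (flipIf o (redRefl q t z)) =
    redReflAt q t (if o then k - 1 else k) (turn q k (flipIf o z)) := by
  cases o
  · simp only [flipIf_false, Bool.false_eq_true, if_false]
    rw [← redReflAt_zero, turn_redReflAt, add_zero]
  · simp only [flipIf_true, if_true]
    rw [mirror_redRefl, turn_redReflAt, sub_eq_add_neg]

lemma redH_symm (k : ℤ) (o : Bool) (z : ℍ) :
    redH q t (if o then k - 1 else k) (turn q k (flipIf o z)) = redH q t 0 z := by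
  cases o
  · simp [redH_turn]
  · simp only [flipIf_true, if_true]
    rw [redH_turn, redH_mirror]; congr 1; ring

lemma blueH_symm (k : ℤ) (o : Bool) (z : ℍ) :
    blueH q t k (turn q k (flipIf o z)) = blueH q t 0 z := by
  rw [blueH_turn, sub_self, blueH_zero_flipIf]

lemma dist_symm (k : ℤ) (o : Bool) (z w : ℍ) :
    dist (turn q k (flipIf o z)) (turn q k (flipIf o w)) = dist z w := by
  rw [dist_turn, dist_flipIf]

lemma IsLinear.symm {Λ : ℍ → ℝ} (h : IsLinear Λ) (k : ℤ) (o : Bool) :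
    IsLinear fun z => Λ (turn q k (flipIf o z)) := by
  obtain ⟨l, m, n, h⟩ := h
  set θ := 2 * k * π / q
  cases o
  · refine ⟨l, m * Real.cos θ + n * Real.sin θ, n * Real.cos θ - m * Real.sin θ, fun z => ?_⟩
    simp only [flipIf_false]
    rw [h, turn, cT_rotation, cX_rotation, cY_rotation]; ring
  · refine ⟨l, m * Real.cos θ + n * Real.sin θ, -(n * Real.cos θ - m * Real.sin θ), fun z => ?_⟩
    simp only [flipIf_true]
    rw [h, turn, cT_rotation, cX_rotation, cY_rotation, cT_mirror, cX_mirror, cY_mirror]; ring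

lemma fold_of_redH_nonneg {x : ℍ} (h : 0 ≤ blueH q t 0 x) (h' : 0 ≤ redH q t 0 x) :
    fold q t x = x :=
  fold_eq_quadRefl (i := false) (j := false) ⟨by simpa using h, by simpa using h'⟩

lemma fold_of_redH_nonpos {x : ℍ} (h : 0 ≤ blueH q t 0 x) (h' : redH q t 0 x ≤ 0) :
    fold q t x = redRefl q t x := by
  rw [fold_eq_quadRefl (i := false) (j := true) ⟨by simpa using h, by simpa using h'⟩]
  simp [quadRefl]

lemma redReflAt_congr {m m' : ℤ} (h : (q : ℤ) ∣ m - m') (z : ℍ) :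
    redReflAt q t m z = redReflAt q t m' z := by
  obtain ⟨n, hn⟩ := h
  obtain rfl : m = m' + q * n := by linarith
  unfold redReflAt
  rw [← turn_turn, turn_mul t, show -(m' + q * n) = -m' + q * (-n) by ring, ← turn_turn,
    turn_mul t]

section
variable [L : Loopless M q]

lemma foldAt_pt {z : ℍ} (hz : z ∈ polygon q t) (e : D) (b : Bool) :
    foldAt M q t e (pt M q t e false b z) = z := by
  have h : ∃ w ∈ polygon q t, ∃ b', pt M q t e false b z = pt M q t e false b' w :=
    ⟨z, hz, b, rfl⟩
  unfold foldAt
  rw [dif_pos h]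
  obtain ⟨h1, b', h2⟩ := h.choose_spec
  exact ((pt_inj hz h1 h2).1).symm

lemma foldAt_mem {e : D} {x : X M q t} (h : x ∈ star M q t e) :
    foldAt M q t e x ∈ polygon q t ∧ ∃ b, x = pt M q t e false b (foldAt M q t e x) := by
  obtain ⟨b, z, hz, rfl⟩ := h
  rw [foldAt_pt hz]
  exact ⟨hz, b, rfl⟩

lemma chartMap_of_rot {d e : D} {k : ℤ} (hk : d = (M.rot ^ k) e) {x : ℍ} (hx : x ∈ U q t) {j : Bool}
    (h : Quadrant q t false j x) (o b : Bool) :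
    chartMap M q t d o b x = pt M q t e false (b ^^ j) (turn q k (flipIf o (fold q t x))) := by
  rw [chartMap_eq hx h, pt_flip (core_fold hx).1]
  simp only [Bool.false_eq_true, if_false, Bool.xor_false]
  rw [hk, pt_rot_zpow (flipIf_mem (core_fold hx).1 o)]

/-- In such a chart the doubled polygon fills exactly one side of the blue line, so leaving it is a
change of sign of `blueH`. -/
lemma chartMap_mem_star_iff {d e : D} {k : ℤ} (hk : d = (M.rot ^ k) e) {x : ℍ} (hx : x ∈ U q t)
    (o b : Bool) : chartMap M q t d o b x ∈ star M q t e ↔ 0 ≤ blueH q t 0 x := by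
  constructor
  · rintro ⟨c, z, hz, h⟩
    rw [← (chartMap_eq_pt_iff_of_rot hk o b c hz hx).1 h.symm, placeIso_apply, blueH_quadRefl]
    simp only [Bool.false_eq_true, if_false]
    exact (mem_polygon.1 (flipIf_mem (turn_mem hz _) o) 0).1
  · intro h
    obtain ⟨i, j, hij⟩ := exists_quadrant (q := q) (t := t) x
    exact ⟨_, _, turn_mem (flipIf_mem (core_fold hx).1 o) k,
      chartMap_of_rot hk hx (j := j) ⟨by simpa using h, hij.2⟩ o b⟩

lemma foldAt_chartMap {d e : D} {k : ℤ} (hk : d = (M.rot ^ k) e) {x : ℍ} (hx : x ∈ U q t)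
    (h : 0 ≤ blueH q t 0 x) (o b : Bool) :
    foldAt M q t e (chartMap M q t d o b x) = turn q k (flipIf o (fold q t x)) := by
  obtain ⟨i, j, hij⟩ := exists_quadrant (q := q) (t := t) x
  rw [chartMap_of_rot hk hx (j := j) ⟨by simpa using h, hij.2⟩ o b,
    foldAt_pt (turn_mem (flipIf_mem (core_fold hx).1 o) k)]

/-- A chart straddles one edge, so it meets the doubled polygon of e only if e is at an end of this
edge; the end determines the half of the chart. -/
lemma chartMap_mem_star_cases {d e : D} {x : ℍ} (hx : x ∈ U q t) {o b : Bool}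
    (h : chartMap M q t d o b x ∈ star M q t e) :
    (∃ k : ℤ, d = (M.rot ^ k) e ∧ 0 ≤ blueH q t 0 x) ∨
    (∃ k : ℤ, M.rev d = (M.rot ^ k) e ∧ blueH q t 0 x ≤ 0) := by
  have key : (∃ k : ℤ, d = (M.rot ^ k) e) ∨ (∃ k : ℤ, M.rev d = (M.rot ^ k) e) := by
    obtain ⟨i, j, hij⟩ := exists_quadrant (q := q) (t := t) x
    obtain ⟨c, z, hz, h⟩ := h
    rw [chartMap_eq hx hij] at h
    rcases core_pt_eq (core_fold hx) hz h with ⟨k, h3, -⟩ | ⟨-, k, h3, -⟩ <;> cases i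
    · exact Or.inl ⟨k, by simpa using h3⟩
    · exact Or.inr ⟨k, by simpa using h3⟩
    · exact Or.inr ⟨k, by simpa using h3⟩
    · exact Or.inl ⟨k, by simpa [M.rev_rev] using h3⟩
  rcases key with ⟨k, hk⟩ | ⟨k, hk⟩
  · exact Or.inl ⟨k, hk, (chartMap_mem_star_iff hk hx o b).1 h⟩
  · refine Or.inr ⟨k, hk, ?_⟩
    rw [chartMap_swap hx, chartMap_mem_star_iff hk (blueRefl_mem_U hx), blueH_blueRefl] at h
    linarith

variable {γ : ℝ → X M q t}

lemma IsLift.self_mem {r₀ ε : ℝ} {d : D} {o b : Bool} {c : ℝ → ℍ} (h : IsLift γ r₀ ε d o b c) :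
    r₀ ∈ Set.Ioo (r₀ - ε) (r₀ + ε) := ⟨by linarith [h.pos], by linarith [h.pos]⟩

lemma IsLift.swap {r₀ ε : ℝ} {d : D} {o b : Bool} {c : ℝ → ℍ} (h : IsLift γ r₀ ε d o b c) :
    IsLift γ r₀ ε (M.rev d) (!o) b fun r => blueRefl q t (c r) where
  pos := h.pos
  speed := h.speed.iso dist_blueRefl
  mem r hr := blueRefl_mem_U (h.mem r hr)
  eq r hr := by rw [h.eq r hr, chartMap_swap (h.mem r hr)]

lemma IsLift.continuousOn_blueH {r₀ ε : ℝ} {d : D} {o b : Bool} {c : ℝ → ℍ}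
    (h : IsLift γ r₀ ε d o b c) :
    ContinuousOn (fun r => blueH q t 0 (c r)) (Set.Ioo (r₀ - ε) (r₀ + ε)) :=
  (continuous_height _ _).comp_continuousOn h.speed.continuousOn

lemma IsLift.continuousOn_redH {r₀ ε : ℝ} {d : D} {o b : Bool} {c : ℝ → ℍ}
    (h : IsLift γ r₀ ε d o b c) :
    ContinuousOn (fun r => redH q t 0 (c r)) (Set.Ioo (r₀ - ε) (r₀ + ε)) :=
  (continuous_height _ _).comp_continuousOn h.speed.continuousOn

lemma IsGeodesic.exists_isLift (hγ : IsGeodesic M q t γ) (r₀ : ℝ) :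
    ∃ ε d o b c, IsLift γ r₀ ε d o b c := by
  obtain ⟨d, o, b, z, hz, h⟩ := exists_chart (γ r₀)
  obtain ⟨ε, hε, c, -, hc, hcc⟩ := hγ.exists_lift (mem_U_of_core hz) h
  exact ⟨ε, d, o, b, c, hε, hc, fun r hr => (hcc r hr).1, fun r hr => (hcc r hr).2⟩

lemma IsGeodesic.exists_isLift_star (hγ : IsGeodesic M q t γ) {r₀ : ℝ} {e : D}
    (h : γ r₀ ∈ star M q t e) :
    ∃ (ε : ℝ) (d : D) (k : ℤ) (o b : Bool) (c : ℝ → ℍ), d = (M.rot ^ k) e ∧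
      IsLift γ r₀ ε d o b c := by
  obtain ⟨ε, d, o, b, c, hc⟩ := hγ.exists_isLift r₀
  rw [hc.eq r₀ hc.self_mem] at h
  rcases chartMap_mem_star_cases (hc.mem r₀ hc.self_mem) h with ⟨k, hk, -⟩ | ⟨k, hk, -⟩
  · exact ⟨ε, d, k, o, b, c, hk, hc⟩
  · exact ⟨ε, _, k, _, b, _, hk, hc.swap⟩

lemma IsLift.mem_star_iff {r₀ ε : ℝ} {d e : D} {o b : Bool} {c : ℝ → ℍ}
    (h : IsLift γ r₀ ε d o b c) {k : ℤ} (hk : d = (M.rot ^ k) e) {r : ℝ}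
    (hr : r ∈ Set.Ioo (r₀ - ε) (r₀ + ε)) : γ r ∈ star M q t e ↔ 0 ≤ blueH q t 0 (c r) := by
  rw [h.eq r hr, chartMap_mem_star_iff hk (h.mem r hr)]

lemma IsLift.foldAt_eq {r₀ ε : ℝ} {d e : D} {o b : Bool} {c : ℝ → ℍ}
    (h : IsLift γ r₀ ε d o b c) {k : ℤ} (hk : d = (M.rot ^ k) e) {r : ℝ}
    (hr : r ∈ Set.Ioo (r₀ - ε) (r₀ + ε)) (hs : γ r ∈ star M q t e) :
    foldAt M q t e (γ r) = turn q k (flipIf o (fold q t (c r))) := by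
  rw [h.eq r hr, foldAt_chartMap hk (h.mem r hr) ((h.mem_star_iff hk hr).1 hs)]

/-- Inside a doubled polygon, the position in the polygon moves at most at unit speed. -/
lemma IsGeodesic.dist_foldAt_le (hγ : IsGeodesic M q t γ) {e : D} {a b : ℝ} (hab : a ≤ b)
    (hs : ∀ r ∈ Set.Icc a b, γ r ∈ star M q t e) :
    dist (foldAt M q t e (γ a)) (foldAt M q t e (γ b)) ≤ b - a := by
  refine dist_le_of_locally (f := fun r => foldAt M q t e (γ r)) hab fun r hr => ?_
  obtain ⟨ε, d, k, o, b', c, hk, hc⟩ := hγ.exists_isLift_star (hs r hr)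
  refine ⟨ε, hc.pos, fun r' hr' hlt => ?_⟩
  obtain ⟨h1, h2⟩ := abs_lt.1 hlt
  have m : r' ∈ Set.Ioo (r - ε) (r + ε) := ⟨by linarith, by linarith⟩
  simp only [hc.foldAt_eq hk hc.self_mem (hs r hr), hc.foldAt_eq hk m (hs r' hr')]
  rw [dist_symm, abs_sub_comm, ← hc.speed r hc.self_mem r' m]
  exact dist_fold_le _ _

lemma IsGeodesic.continuousOn_foldAt (hγ : IsGeodesic M q t γ) {e : D} {a b : ℝ}
    (hs : ∀ r ∈ Set.Icc a b, γ r ∈ star M q t e) :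
    ContinuousOn (fun r => foldAt M q t e (γ r)) (Set.Icc a b) := by
  have key : ∀ r ∈ Set.Icc a b, ∀ r' ∈ Set.Icc a b, r ≤ r' →
      dist (foldAt M q t e (γ r)) (foldAt M q t e (γ r')) ≤ r' - r := fun r hr r' hr' h =>
    hγ.dist_foldAt_le h fun r'' h' => hs r'' ⟨hr.1.trans h'.1, h'.2.trans hr'.2⟩
  have : LipschitzOnWith 1 (fun r => foldAt M q t e (γ r)) (Set.Icc a b) :=
    LipschitzOnWith.of_dist_le_mul fun r hr r' hr' => by
      rw [NNReal.coe_one, one_mul, Real.dist_eq]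
      rcases le_total r r' with h | h
      · rw [abs_sub_comm, abs_of_nonneg (by linarith)]; exact key r hr r' hr' h
      · rw [abs_of_nonneg (by linarith), dist_comm]; exact key r' hr' r hr h
  exact this.continuousOn

/-- The mean value property along a geodesic inside a doubled polygon. -/
lemma IsGeodesic.mean_foldAt (hγ : IsGeodesic M q t γ) {e : D} {a b r : ℝ}
    (hs : ∀ r ∈ Set.Icc a b, γ r ∈ star M q t e) (hr : r ∈ Set.Ioo a b) {Λ : ℍ → ℝ}
    (hΛ : IsLinear Λ)
    (hinv : ∀ m, redH q t m (foldAt M q t e (γ r)) = 0 → ∀ z, Λ (redReflAt q t m z) = Λ z) :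
    ∃ h > 0, a ≤ r - h ∧ r + h ≤ b ∧
      Λ (foldAt M q t e (γ (r + h))) + Λ (foldAt M q t e (γ (r - h))) =
        2 * Real.cosh h * Λ (foldAt M q t e (γ r)) := by
  obtain ⟨ε, d, k, o, b', c, hk, hc⟩ := hγ.exists_isLift_star (hs r (Set.Ioo_subset_Icc_self hr))
  have hr0 := hs r (Set.Ioo_subset_Icc_self hr)
  have hB : ∀ r' ∈ Set.Ioo (r - ε) (r + ε), r' ∈ Set.Icc a b → 0 ≤ blueH q t 0 (c r') :=
    fun r' h1 h2 => (hc.mem_star_iff hk h1).1 (hs r' h2)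
  obtain ⟨Λ', hΛ', η, hη, hηε, key⟩ : ∃ Λ' : ℍ → ℝ, IsLinear Λ' ∧ ∃ η > 0, η ≤ ε ∧
      ∀ r' ∈ Set.Ioo (r - η) (r + η), r' ∈ Set.Icc a b →
        Λ (foldAt M q t e (γ r')) = Λ' (c r') := by
    -- Away from the red sides the fold is a single isometry near time r. On a red side it bends the
    -- lift, but Λ is invariant under this reflection and does not notice.
    rcases eq_or_ne (redH q t 0 (c r)) 0 with h0 | h0
    · refine ⟨_, hΛ.symm (q := q) k o, ε, hc.pos, le_rfl, fun r' h1 h2 => ?_⟩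
      rw [hc.foldAt_eq hk h1 (hs r' h2)]
      rcases le_total 0 (redH q t 0 (c r')) with h3 | h3
      · rw [fold_of_redH_nonneg (hB r' h1 h2) h3]
      · rw [fold_of_redH_nonpos (hB r' h1 h2) h3, symm_redRefl, hinv]
        rw [hc.foldAt_eq hk hc.self_mem hr0, redH_symm, redH_fold, h0, abs_zero]
    · have hcont := hc.continuousOn_redH.continuousAt (Ioo_mem_nhds hc.self_mem.1 hc.self_mem.2)
      rcases lt_or_gt_of_ne h0 with h0 | h0
      · obtain ⟨η, hη, hh⟩ := Metric.eventually_nhds_iff.1 (hcont.eventually (gt_mem_nhds h0))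
        obtain ⟨l, m, n, hl⟩ := hΛ.symm (q := q) k o
        refine ⟨fun z => Λ (turn q k (flipIf o (redRefl q t z))), ?_, min η ε,
          lt_min hη hc.pos, min_le_right _ _, fun r' h1 h2 => ?_⟩
        · set a' := apothem q (s q t)
          set θ := π / q
          refine ⟨l + 2 * Real.sinh a' * (l * Real.sinh a' + m * (Real.cosh a' * Real.cos θ) +
              n * (Real.cosh a' * Real.sin θ)),
            m - 2 * (Real.cosh a' * Real.cos θ) * (l * Real.sinh a' +
              m * (Real.cosh a' * Real.cos θ) + n * (Real.cosh a' * Real.sin θ)),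
            n - 2 * (Real.cosh a' * Real.sin θ) * (l * Real.sinh a' +
              m * (Real.cosh a' * Real.cos θ) + n * (Real.cosh a' * Real.sin θ)), fun z => ?_⟩
          have := hl (redRefl q t z)
          simp only at this
          show Λ _ = _
          rw [this, redRefl, cT_reflect, cX_reflect, cY_reflect]
          simp only [height]
          ring
        · have h1' : r' ∈ Set.Ioo (r - ε) (r + ε) :=
            ⟨by linarith [h1.1, min_le_right η ε], by linarith [h1.2, min_le_right η ε]⟩
          have h3 : redH q t 0 (c r') < 0 := hh (by
            rw [Real.dist_eq, abs_lt]
            constructor <;> linarith [h1.1, h1.2, min_le_left η ε])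
          rw [hc.foldAt_eq hk h1' (hs r' h2), fold_of_redH_nonpos (hB r' h1' h2) h3.le]
      · obtain ⟨η, hη, hh⟩ := Metric.eventually_nhds_iff.1 (hcont.eventually (lt_mem_nhds h0))
        refine ⟨_, hΛ.symm (q := q) k o, min η ε,
          lt_min hη hc.pos, min_le_right _ _, fun r' h1 h2 => ?_⟩
        have h1' : r' ∈ Set.Ioo (r - ε) (r + ε) :=
          ⟨by linarith [h1.1, min_le_right η ε], by linarith [h1.2, min_le_right η ε]⟩
        have h3 : 0 < redH q t 0 (c r') := hh (by
          rw [Real.dist_eq, abs_lt]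
          constructor <;> linarith [h1.1, h1.2, min_le_left η ε])
        rw [hc.foldAt_eq hk h1' (hs r' h2), fold_of_redH_nonneg (hB r' h1' h2) h3.le]
  obtain ⟨hr1, hr2⟩ := hr
  obtain ⟨h, hh0, hh1, hh2, hh3⟩ : ∃ h > 0, h < η ∧ h ≤ r - a ∧ h ≤ b - r :=
    ⟨min (η / 2) (min (r - a) (b - r)), lt_min (half_pos hη) (lt_min (by linarith) (by linarith)),
      (min_le_left _ _).trans_lt (half_lt_self hη), (min_le_right _ _).trans (min_le_left _ _),
      (min_le_right _ _).trans (min_le_right _ _)⟩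
  refine ⟨h, hh0, by linarith, by linarith, ?_⟩
  rw [key (r + h) ⟨by linarith, by linarith⟩ ⟨by linarith, by linarith⟩,
    key (r - h) ⟨by linarith, by linarith⟩ ⟨by linarith, by linarith⟩,
    key r ⟨by linarith, by linarith⟩ ⟨by linarith, by linarith⟩]
  exact hc.speed.mean hΛ' ⟨by linarith, by linarith⟩ ⟨by linarith, by linarith⟩ hc.self_mem

/-- Away from the red sides the copy is locally constant. -/
lemma IsGeodesic.exists_copy (hγ : IsGeodesic M q t γ) {e : D} {r : ℝ} (hr : γ r ∈ star M q t e)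
    (h0 : ¬ OnRed q t (foldAt M q t e (γ r))) :
    ∃ ε > 0, ∃ b, ∀ r' ∈ Set.Ioo (r - ε) (r + ε), γ r' ∈ star M q t e →
      γ r' = pt M q t e false b (foldAt M q t e (γ r')) := by
  obtain ⟨ε, d, k, o, b, c, hk, hc⟩ := hγ.exists_isLift_star hr
  have hne : redH q t 0 (c r) ≠ 0 := fun h => h0 ⟨if o then k - 1 else k, by
    rw [hc.foldAt_eq hk hc.self_mem hr, redH_symm, redH_fold, h, abs_zero]⟩
  have hcont := hc.continuousOn_redH.continuousAt (Ioo_mem_nhds hc.self_mem.1 hc.self_mem.2)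
  obtain ⟨j, hj⟩ : ∃ j : Bool, ∀ᶠ r' in nhds r,
      0 ≤ (if j then -redH q t 0 (c r') else redH q t 0 (c r')) := by
    rcases lt_or_gt_of_ne hne with h | h
    · refine ⟨true, (hcont.eventually (gt_mem_nhds h)).mono fun r' h' => ?_⟩
      simp only [if_true]; linarith
    · refine ⟨false, (hcont.eventually (lt_mem_nhds h)).mono fun r' h' => ?_⟩
      simp only [Bool.false_eq_true, if_false]; linarith
  obtain ⟨η, hη, hh⟩ := Metric.eventually_nhds_iff.1 hj
  refine ⟨min η ε, lt_min hη hc.pos, b ^^ j, fun r' h1 hs => ?_⟩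
  have h1' : r' ∈ Set.Ioo (r - ε) (r + ε) :=
    ⟨by linarith [h1.1, min_le_right η ε], by linarith [h1.2, min_le_right η ε]⟩
  have h3 := hh (y := r') (by
    rw [Real.dist_eq, abs_lt]
    constructor <;> linarith [h1.1, h1.2, min_le_left η ε])
  have hB := (hc.mem_star_iff hk h1').1 hs
  rw [hc.foldAt_eq hk h1' hs, hc.eq r' h1',
    chartMap_of_rot hk (hc.mem r' h1') (j := j) ⟨by simpa using hB, h3⟩]

end

end
end RightAngled

namespace RightAngled
noncomputable section

open Real

set_option linter.unusedSectionVars false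

/-! ### Lengths of geodesic arcs in a doubled polygon -/

variable {D : Type*} {M : SurfaceMap D} {q : ℕ} {t : ℝ} [G : Good q t]

lemma turn_natCast (j : ℕ) (z : ℍ) : turn q j z = rotation (2 * (j * (π / q))) • z := by
  unfold turn; congr 2; push_cast; ring

lemma turn_congr (t : ℝ) [Good q t] {m n : ℤ} (h : (q : ℤ) ∣ n - m) (z : ℍ) :
    turn q n z = turn q m z := by
  rw [show n = m + (n - m) by ring, ← turn_turn, turn_of_dvd t h]

/-- The distance between two different red sides is at least `t`. -/
lemma le_dist_of_redH {z w : ℍ} (hz : z ∈ polygon q t) (hw : w ∈ polygon q t) {m n : ℤ}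
    (hm : redH q t m z = 0) (hn : redH q t n w = 0) (hmn : ¬ (q : ℤ) ∣ n - m) :
    t ≤ dist z w ∧ (dist z w = t →
      ((q : ℤ) ∣ n - m - 1 ∧ z = turn q (m + 1) (perp (apothem q t) (-(t / 2))) ∧
        w = turn q (m + 1) (perp (apothem q t) (t / 2))) ∨
      ((q : ℤ) ∣ n - m + 1 ∧ z = turn q m (perp (apothem q t) (t / 2)) ∧
        w = turn q m (perp (apothem q t) (-(t / 2))))) := by
  obtain ⟨u, -, hu⟩ := exists_redSide (turn_mem hz (-m))
    (by rw [redH_turn, sub_neg_eq_add, zero_add, hm])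
  obtain ⟨v, -, hv⟩ := exists_redSide (turn_mem hw (-n))
    (by rw [redH_turn, sub_neg_eq_add, zero_add, hn])
  rw [turn_eq_iff, neg_neg] at hu hv
  obtain ⟨j, hj, l, hl⟩ := exists_nat_index G.three_le (n - m)
  have h1 : 1 ≤ j := by
    rcases Nat.eq_zero_or_pos j with rfl | h
    · exact (hmn ⟨l, by rw [hl]; simp⟩).elim
    · exact h
  have hd : dist z w = dist (perp (apothem q (s q t)) u)
      (rotation (2 * (j * (π / q))) • perp (apothem q (s q t)) v) := by
    rw [hu, hv, turn_congr t (m := m + j) (n := n) ⟨l, by linarith⟩, ← turn_turn, dist_turn,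
      turn_natCast, redSide_eq, redSide_eq, rotation_smul_smul, add_comm, ← rotation_smul_smul,
      dist_rotation]
  obtain ⟨h2, h3⟩ := (redRelations q t).le_dist u v h1 hj
  rw [← hd] at h2 h3
  refine ⟨h2, fun h => ?_⟩
  rcases h3 h with ⟨rfl, rfl, rfl⟩ | ⟨hj', rfl, rfl⟩
  · left
    have hdv : (q : ℤ) ∣ n - m - 1 := ⟨l, by rw [hl]; simp⟩
    refine ⟨hdv, ?_, ?_⟩
    · rw [hu, redSide_half, turn_turn]
    · rw [hv, redSide_neg_half, turn_congr t (m := m + 1)]; rwa [← sub_sub]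
  · right
    have hdv : (q : ℤ) ∣ n - m + 1 := ⟨l + 1, by
      rw [hl, hj']
      have := G.three_le
      push_cast [Nat.cast_sub (show 1 ≤ q by omega)]; ring⟩
    refine ⟨hdv, ?_, ?_⟩
    · rw [hu, redSide_neg_half]
    · rw [hv, redSide_half, turn_turn, turn_congr t (m := m)]
      convert hdv using 1; ring

/-- The distance between two different blue sides is at least `s(t)`. -/
lemma le_dist_of_blueH {z w : ℍ} (hz : z ∈ polygon q t) (hw : w ∈ polygon q t) {m n : ℤ}
    (hm : blueH q t m z = 0) (hn : blueH q t n w = 0) (hmn : ¬ (q : ℤ) ∣ n - m) :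
    s q t ≤ dist z w ∧ (dist z w = s q t → ∃ (k : ℤ) (σ : ℝ), |σ| = 1 ∧
      z = turn q k (redSide q t (σ * -(s q t / 2))) ∧
      w = turn q k (redSide q t (σ * (s q t / 2)))) := by
  obtain ⟨u, -, hu⟩ := exists_perp (turn_mem hz (-m))
    (by rw [blueH_turn, sub_neg_eq_add, zero_add, hm])
  obtain ⟨v, -, hv⟩ := exists_perp (turn_mem hw (-n))
    (by rw [blueH_turn, sub_neg_eq_add, zero_add, hn])
  rw [turn_eq_iff, neg_neg] at hu hv
  obtain ⟨j, hj, l, hl⟩ := exists_nat_index G.three_le (n - m)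
  have h1 : 1 ≤ j := by
    rcases Nat.eq_zero_or_pos j with rfl | h
    · exact (hmn ⟨l, by rw [hl]; simp⟩).elim
    · exact h
  have hd : dist z w = dist (perp (apothem q t) u)
      (rotation (2 * (j * (π / q))) • perp (apothem q t) v) := by
    rw [hu, hv, turn_congr t (m := m + j) (n := n) ⟨l, by linarith⟩, ← turn_turn, dist_turn,
      turn_natCast]
  obtain ⟨h2, h3⟩ := (blueRelations q t).le_dist u v h1 hj
  rw [← hd] at h2 h3
  refine ⟨h2, fun h => ?_⟩
  rcases h3 h with ⟨rfl, rfl, rfl⟩ | ⟨hj', rfl, rfl⟩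
  · refine ⟨m, 1, by simp, ?_, ?_⟩
    · rw [hu, one_mul, redSide_neg_half]
    · rw [hv, one_mul, redSide_half, turn_turn, turn_congr t (m := m + 1)]
      exact ⟨l, by rw [← sub_sub, hl]; simp⟩
  · refine ⟨m - 1, -1, by simp, ?_, ?_⟩
    · rw [hu, neg_mul_neg, one_mul, redSide_half, turn_turn, sub_add_cancel]
    · rw [hv, neg_one_mul, redSide_neg_half, turn_congr t (m := m - 1)]
      refine ⟨l + 1, ?_⟩
      have := G.three_le
      have e : n - (m - 1) = (n - m) + 1 := by ring
      rw [e, hl, hj']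
      push_cast [Nat.cast_sub (show 1 ≤ q by omega)]; ring

/-- A contracting path whose ends are at distance equal to its duration has equality in all triangle
inequalities, and points of a geodesic are determined by their distances to two others. The sign σ
stands for the direction. -/
lemma eq_of_contraction {c F : ℝ → ℍ} (hc : ∀ u v, dist (c u) (c v) = |u - v|) {r₁ r₂ σ : ℝ}
    (hσ : |σ| = 1) (h12 : r₁ < r₂)
    (hF : ∀ a b, r₁ ≤ a → a ≤ b → b ≤ r₂ → dist (F a) (F b) ≤ b - a)
    (e1 : F r₁ = c (σ * -((r₂ - r₁) / 2))) (e2 : F r₂ = c (σ * ((r₂ - r₁) / 2))) :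
    ∀ r ∈ Set.Icc r₁ r₂, F r = c (σ * (r - (r₁ + r₂) / 2)) := by
  have hd : ∀ u v, dist (c (σ * u)) (c (σ * v)) = |u - v| := fun u v => by
    rw [hc, ← mul_sub, abs_mul, hσ, one_mul]
  have h0 : dist (F r₁) (F r₂) = r₂ - r₁ := by
    rw [e1, e2, hd, abs_sub_comm, abs_of_nonneg (by linarith)]; ring
  intro r hr
  have h1 := hF r₁ r le_rfl hr.1 hr.2
  have h2 := hF r r₂ hr.1 hr.2 le_rfl
  have h3 := dist_triangle (F r₁) (F r) (F r₂)
  refine eq_of_dist_eq (A := F r₁) (B := F r₂) (a := r₁) (b := r₂) (r := r) h12.ne ?_ ?_ ?_ ?_ ?_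
  · rw [h0, abs_of_nonneg (by linarith)]
  · rw [abs_of_nonneg (by linarith [hr.1])]; linarith
  · rw [abs_of_nonneg (by linarith [hr.2]), dist_comm]; linarith
  · rw [e1, hd, abs_sub_comm]; congr 1; ring
  · rw [e2, hd]; congr 1; ring

section
variable [L : Loopless M q] {γ : ℝ → X M q t}

lemma IsGeodesic.range_eq (hγ : IsGeodesic M q t γ) {γ' : ℝ → X M q t}
    (hγ' : IsGeodesic M q t γ') {δ u a b : ℝ} (hδ : |δ| = 1) (hab : a < b)
    (h : ∀ r ∈ Set.Ioo a b, γ r = γ' (δ * r + u)) : Set.range γ = Set.range γ' := by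
  have e := hγ.eq_of_eqOn (hγ'.comp_affine hδ u) hab h
  have hδ2 : δ * δ = 1 := by rw [← abs_mul_abs_self, hδ, one_mul]
  ext x
  constructor
  · rintro ⟨r, rfl⟩
    exact ⟨δ * r + u, by rw [e]⟩
  · rintro ⟨r, rfl⟩
    refine ⟨δ * (r - u), ?_⟩
    rw [e]
    simp only
    rw [← mul_assoc, hδ2, one_mul, sub_add_cancel]

lemma exists_blueGeodesic_eq (d : D) (b : Bool) {σ : ℝ} (hσ : |σ| = 1) :
    ∃ δ u : ℝ, |δ| = 1 ∧ ∀ v, |v| ≤ t / 2 →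
      pt M q t d false b (perp (apothem q t) (σ * v)) = blueGeodesic M q t d (δ * v + u) := by
  have hσv : ∀ v, |v| ≤ t / 2 → |σ * v| ≤ t / 2 := fun v hv => by rwa [abs_mul, hσ, one_mul]
  cases b
  · refine ⟨σ, t / 2, hσ, fun v hv => ?_⟩
    obtain ⟨h1, h2⟩ := abs_le.1 (hσv v hv)
    rw [blueGeodesic_eq d (j := 0) (by push_cast; linarith) (by push_cast; linarith), blueArc]
    simp
  · refine ⟨-σ, t + t / 2, by rwa [abs_neg], fun v hv => ?_⟩
    obtain ⟨h1, h2⟩ := abs_le.1 (hσv v hv)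
    rw [blueGeodesic_eq d (j := 1) (by push_cast; linarith) (by push_cast; linarith), blueArc]
    have := pt_perp_not (M := M) (q := q) (hσv v hv) d true true
    rw [show -σ * v + (t + t / 2) - ((1 : ℤ) : ℝ) * t - t / 2 = -(σ * v) by push_cast; ring]
    simpa using this

lemma exists_redGeodesic_eq (d : D) (b : Bool) {σ : ℝ} (hσ : |σ| = 1) :
    ∀ v, |v| ≤ s q t / 2 →
      pt M q t d false b (redSide q t (σ * v)) = redGeodesic M q t d (σ * v + s q t / 2) := by
  intro v hv
  have hσv : |σ * v| ≤ s q t / 2 := by rwa [abs_mul, hσ, one_mul]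
  obtain ⟨h1, h2⟩ := abs_le.1 hσv
  rw [redGeodesic_eq d (j := 0) (by push_cast; linarith) (by push_cast; linarith), redArc,
    pt_red_copy (redSide_mem hσv) ⟨0, redH_zero_redSide _⟩ d b false]
  simp

/-- An arc of length at most `s(t)` between two different blue sides is a red side. -/
lemma IsGeodesic.arc_blue (hγ : IsGeodesic M q t γ) {e : D} {r₀ r₁ : ℝ} (h01 : r₀ < r₁)
    (hs : ∀ r ∈ Set.Icc r₀ r₁, γ r ∈ star M q t e) (h0 : blueH q t 0 (foldAt M q t e (γ r₀)) = 0)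
    {k : ℤ} (hk : blueH q t k (foldAt M q t e (γ r₁)) = 0) (hqk : ¬ (q : ℤ) ∣ k) :
    s q t ≤ r₁ - r₀ ∧ (r₁ - r₀ = s q t → ∃ d, (∀ p : ℕ, 0 < p → ((M.rev * M.rot) ^ p) d = d →
      Set.range γ = redCurve M q t d)) := by
  have hF : ∀ a b, r₀ ≤ a → a ≤ b → b ≤ r₁ →
      dist (foldAt M q t e (γ a)) (foldAt M q t e (γ b)) ≤ b - a := fun a b h1 h2 h3 =>
    hγ.dist_foldAt_le h2 fun r hr => hs r ⟨h1.trans hr.1, hr.2.trans h3⟩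
  obtain ⟨m0, -⟩ := foldAt_mem (hs r₀ ⟨le_rfl, h01.le⟩)
  obtain ⟨m1, -⟩ := foldAt_mem (hs r₁ ⟨h01.le, le_rfl⟩)
  obtain ⟨h1, h2⟩ := le_dist_of_blueH m0 m1 h0 hk (by rwa [sub_zero])
  have h3 := hF r₀ r₁ le_rfl h01.le le_rfl
  refine ⟨h1.trans h3, fun hlen => ?_⟩
  obtain ⟨j, σ, hσ, e1, e2⟩ := h2 (le_antisymm (h3.trans hlen.le) h1)
  have key := eq_of_contraction (c := fun u => turn q j (redSide q t u))
    (F := fun r => foldAt M q t e (γ r)) (fun u v => by rw [dist_turn, dist_redSide]) hσ h01 hF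
    (by rw [hlen]; exact e1) (by rw [hlen]; exact e2)
  refine ⟨(M.rot ^ j) e, fun p hp hd => ?_⟩
  rw [← range_redGeodesic]
  refine hγ.range_eq (isClosedGeodesic_red _ hp hd).2.2
    (δ := σ) (u := -(σ * ((r₀ + r₁) / 2)) + s q t / 2) hσ h01
    fun r hr => ?_
  -- Folding forgets the copy b, but the two copies coincide along a red side.
  obtain ⟨mr, b, hb⟩ := foldAt_mem (hs r ⟨hr.1.le, hr.2.le⟩)
  have hv : |r - (r₀ + r₁) / 2| ≤ s q t / 2 :=
    abs_le.2 ⟨by linarith [hr.1, hr.2], by linarith [hr.1, hr.2]⟩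
  have hk := key r ⟨hr.1.le, hr.2.le⟩
  rw [hb, hk, ← pt_rot_zpow (redSide_mem (by rwa [abs_mul, hσ, one_mul])),
    exists_redGeodesic_eq _ b hσ _ hv]
  congr 1; ring

/-- An arc that leaves and comes back to the same blue side has length greater than `t`. -/
lemma IsGeodesic.arc_backtrack (hγ : IsGeodesic M q t γ) {e : D} {r₀ r₁ : ℝ} (h01 : r₀ < r₁)
    (hs : ∀ r ∈ Set.Icc r₀ r₁, γ r ∈ star M q t e) (h0 : blueH q t 0 (foldAt M q t e (γ r₀)) = 0)
    (h1 : blueH q t 0 (foldAt M q t e (γ r₁)) = 0)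
    (hpos : ∃ r ∈ Set.Icc r₀ r₁, 0 < blueH q t 0 (foldAt M q t e (γ r))) : t < r₁ - r₀ := by
  have hF : ∀ a b, r₀ ≤ a → a ≤ b → b ≤ r₁ →
      dist (foldAt M q t e (γ a)) (foldAt M q t e (γ b)) ≤ b - a := fun a b h1 h2 h3 =>
    hγ.dist_foldAt_le h2 fun r hr => hs r ⟨h1.trans hr.1, hr.2.trans h3⟩
  -- The arc touches a red side other than the neighbours 0 and -1 of the blue side. The reflections
  -- in these neighbours preserve the height over the blue side, so otherwise the maximum principle
  -- would make this height nonpositive.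
  obtain ⟨r, hr, m, hm, hm0, hm1⟩ : ∃ r ∈ Set.Ioo r₀ r₁, ∃ m : ℤ,
      redH q t m (foldAt M q t e (γ r)) = 0 ∧ ¬ (q : ℤ) ∣ m ∧ ¬ (q : ℤ) ∣ m + 1 := by
    by_contra hcon
    push Not at hcon
    obtain ⟨r, hr, hr'⟩ := hpos
    refine hr'.not_ge (nonpos_of_mean (f := fun r => blueH q t 0 (foldAt M q t e (γ r))) h01.le
      ((continuous_height _ _).comp_continuousOn (hγ.continuousOn_foldAt hs)) h0.le h1.le
      (fun r hr => hγ.mean_foldAt hs hr (isLinear_height _ _) fun m hm z => ?_) r hr)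
    show blueH q t 0 (redReflAt q t m z) = blueH q t 0 z
    by_cases hq : (q : ℤ) ∣ m
    · rw [redReflAt_congr (m' := 0) (by rwa [sub_zero]), redReflAt_zero, blueH_redRefl]
    · rw [redReflAt_congr (m' := -1) (by rw [sub_neg_eq_add]; exact hcon r hr m hm hq), redReflAt,
        blueH_turn]
      simp only [neg_neg, zero_add, sub_neg_eq_add]
      rw [blueH_one_redRefl, blueH_turn, sub_self]
  have ht := G.pos
  set y := foldAt M q t e (γ r) with hy
  obtain ⟨my, -⟩ := foldAt_mem (hs r ⟨hr.1.le, hr.2.le⟩)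
  obtain ⟨u, hu, e0⟩ := exists_perp (foldAt_mem (hs r₀ ⟨le_rfl, h01.le⟩)).1 h0
  obtain ⟨v, hv, e1⟩ := exists_perp (foldAt_mem (hs r₁ ⟨h01.le, le_rfl⟩)).1 h1
  have hA : |t / 2| ≤ t / 2 := by rw [abs_of_pos (half_pos ht)]
  have hB : |-(t / 2)| ≤ t / 2 := by rwa [abs_neg]
  obtain ⟨a1, a2⟩ := le_dist_of_redH (perp_mem (q := q) hA) my (m := 0)
    (by rw [redH_zero_perp]; simp) hm (by rwa [sub_zero])
  obtain ⟨b1, -⟩ := le_dist_of_redH (perp_mem (q := q) hB) my (m := -1)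
    (by rw [redH_neg_one_perp]; simp) hm (by rwa [sub_neg_eq_add])
  -- With equality, the corner would be on a second blue side, or the red side m would be a
  -- neighbour of the blue side 0.
  have a3 : t < dist (perp (apothem q t) (t / 2)) y := by
    refine lt_of_le_of_ne a1 fun h => ?_
    rcases a2 h.symm with ⟨-, h3, -⟩ | ⟨h3, -⟩
    · have h4 : (q : ℤ) ∣ 1 := dvd_of_blueH (perp_mem (q := q) hA) (blueH_zero_perp _) (k := 1) (by
        rw [h3, blueH_turn]; simpa using blueH_zero_perp _)
      have := Int.le_of_dvd one_pos h4
      have := G.three_le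
      omega
    · rw [sub_zero] at h3; exact hm1 h3
  have l0 := hF r₀ r le_rfl hr.1.le hr.2.le
  have l1 := hF r r₁ hr.1.le hr.2.le le_rfl
  rw [← hy, e0] at l0
  rw [← hy, e1] at l1
  obtain ⟨u1, u2⟩ := abs_le.1 hu
  obtain ⟨v1, v2⟩ := abs_le.1 hv
  -- Going from each of the two corners to y through each end of the arc gives four inequalities in
  -- whose sum u and v cancel: 2t plus twice the length exceeds 4t.
  have t1 := dist_triangle (perp (apothem q t) (t / 2)) (perp (apothem q t) u) y
  have t2 := dist_triangle_right (perp (apothem q t) (t / 2)) y (perp (apothem q t) v)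
  have t3 := dist_triangle (perp (apothem q t) (-(t / 2))) (perp (apothem q t) u) y
  have t4 := dist_triangle_right (perp (apothem q t) (-(t / 2))) y (perp (apothem q t) v)
  rw [dist_perp, abs_of_nonneg (by linarith)] at t1 t2
  rw [dist_perp, abs_of_nonpos (by linarith)] at t3 t4
  linarith

/-- A closed geodesic in a doubled polygon has length at least `2 t`. -/
lemma IsClosedGeodesic.of_star {ℓ : ℝ} (hγ : IsClosedGeodesic M q t ℓ γ) {e : D}
    (hs : ∀ r, γ r ∈ star M q t e) :
    2 * t ≤ ℓ ∧ (ℓ = 2 * t → ∃ d, Set.range γ = blueCurve M q t d) := by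
  obtain ⟨hℓ, hper, hg⟩ := hγ
  have ht := G.pos
  set F := fun r => foldAt M q t e (γ r) with hFdef
  have hF : ∀ a b, a ≤ b → dist (F a) (F b) ≤ b - a := fun a b h =>
    hg.dist_foldAt_le h fun r _ => hs r
  have hFP : ∀ r, F r ∈ polygon q t := fun r => (foldAt_mem (hs r)).1
  have hFper : Function.Periodic F ℓ := fun r => by simp only [hFdef, hper r]
  have hFc : Continuous F := by
    have : LipschitzWith 1 F := LipschitzWith.of_dist_le_mul fun r r' => by
      rw [NNReal.coe_one, one_mul, Real.dist_eq]
      rcases le_total r r' with h | h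
      · rw [abs_sub_comm, abs_of_nonneg (by linarith)]; exact hF r r' h
      · rw [abs_of_nonneg (by linarith), dist_comm]; exact hF r' r h
    exact this.continuous
  -- If only the red side m₀ were met, the function cosh(dist(·, w)), where w is its midpoint, would
  -- be invariant under the reflections involved. Along the curve it would be positive and periodic
  -- with the mean value property, which is impossible at its maximum.
  have key : ∀ m₀ : ℤ, ∃ r, ∃ m : ℤ, redH q t m (F r) = 0 ∧ ¬ (q : ℤ) ∣ m - m₀ := by
    intro m₀
    by_contra hcon
    push Not at hcon
    set w := turn q m₀ (redSide q t 0) with hw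
    have hfix : redReflAt q t m₀ w = w := by
      rw [redReflAt, hw, turn_turn, neg_add_cancel, turn_zero, redRefl,
        reflect_of_height_eq_zero]
      rw [← redH_zero_eq, redH_zero_redSide]
    have hdist : ∀ m, (q : ℤ) ∣ m - m₀ → ∀ z, dist (redReflAt q t m z) w = dist z w := by
      intro m hm z
      rw [redReflAt_congr hm]
      conv_lhs => rw [← hfix]
      rw [redReflAt, redReflAt, dist_turn, dist_redRefl, dist_turn]
    have hcont : Continuous fun r => Real.cosh (dist (F r) w) :=
      Real.continuous_cosh.comp (hFc.dist continuous_const)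
    have hcper : Function.Periodic (fun r => Real.cosh (dist (F r) w)) ℓ := fun r => by
      simp only [hFper r]
    obtain ⟨x, hx, hmax⟩ := (isCompact_Icc (a := (0 : ℝ)) (b := ℓ)).exists_isMaxOn
      (Set.nonempty_Icc.2 hℓ.le) hcont.continuousOn
    have hall : ∀ r, Real.cosh (dist (F r) w) ≤ Real.cosh (dist (F x) w) := by
      intro r
      obtain ⟨y, hy, e⟩ := hcper.exists_mem_Ico₀ hℓ r
      rw [e]
      exact hmax ⟨hy.1, hy.2.le⟩
    obtain ⟨h, hh, -, -, hmean⟩ := hg.mean_foldAt (a := x - 1) (b := x + 1) (r := x)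
      (fun r _ => hs r) ⟨by linarith, by linarith⟩ (isLinear_cosh_dist w) (fun m hm z => by
        simp only [hdist m (hcon x m hm) z])
    have h1 := hall (x + h)
    have h2 := hall (x - h)
    have h3 := Real.one_lt_cosh.2 hh.ne'
    have h4 := Real.cosh_pos (dist (F x) w)
    simp only [hFdef] at h1 h2 h4
    nlinarith
  -- Two different red sides are visited within one period, and both ways between them take time at
  -- least t.
  obtain ⟨r₁, m₁, h1, -⟩ := key 0
  obtain ⟨r₂', m₂, h2, h12⟩ := key m₁
  obtain ⟨r₂, hr₂, e2⟩ := hFper.exists_mem_Ico hℓ r₂' r₁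
  rw [e2] at h2
  obtain ⟨d1, d2⟩ := le_dist_of_redH (hFP r₁) (hFP r₂) h1 h2 h12
  have d3 := hF r₁ r₂ hr₂.1
  have d4 := hF r₂ (r₁ + ℓ) hr₂.2.le
  rw [hFper, dist_comm] at d4
  refine ⟨by linarith, fun hlen => ?_⟩
  have hlen' : r₂ - r₁ = t := by linarith
  obtain ⟨k, σ, hσ, e1, e2⟩ : ∃ (k : ℤ) (σ : ℝ), |σ| = 1 ∧
      F r₁ = turn q k (perp (apothem q t) (σ * -(t / 2))) ∧
      F r₂ = turn q k (perp (apothem q t) (σ * (t / 2))) := by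
    rcases d2 (by linarith) with ⟨-, h3, h4⟩ | ⟨-, h3, h4⟩
    · exact ⟨_, 1, by simp, by rw [h3, one_mul], by rw [h4, one_mul]⟩
    · exact ⟨_, -1, by simp, by rw [h3, neg_mul_neg, one_mul], by rw [h4, neg_one_mul]⟩
  have hlt : r₁ < r₂ := by linarith
  have hcurve := eq_of_contraction (c := fun u => turn q k (perp (apothem q t) u))
    (F := F) (fun u v => by rw [dist_turn, dist_perp]) hσ hlt (fun a b _ h _ => hF a b h)
    (by rw [hlen']; exact e1) (by rw [hlen']; exact e2)
  set r₀ := (r₁ + r₂) / 2 with hr₀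
  have hF0 : F r₀ = turn q k (perp (apothem q t) 0) := by
    rw [hcurve r₀ ⟨by linarith, by linarith⟩]; simp
  -- The midpoint of the blue side is on no red side, so the copy is constant nearby and the folded
  -- curve determines γ there.
  have hnot : ¬ OnRed q t (F r₀) := by
    rintro ⟨m, hm⟩
    rw [hF0, redH_turn] at hm
    have hP := perp_mem (q := q) (t := t) (u := 0) (by simpa using (half_pos ht).le)
    have h0 := (core_of_sector hP (sector_perp le_rfl)).redH_zero_of_onRed ⟨_, hm⟩
    rw [redH_zero_perp, Real.sinh_eq_zero] at h0
    linarith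
  obtain ⟨ε, hε, b, hb⟩ := hg.exists_copy (hs r₀) hnot
  obtain ⟨δ, u, hδ, hpar⟩ := exists_blueGeodesic_eq (M := M) (q := q) (t := t) ((M.rot ^ k) e) b hσ
  refine ⟨(M.rot ^ k) e, ?_⟩
  rw [← range_blueGeodesic]
  have hm0 : 0 < min ε (t / 2) := lt_min hε (half_pos ht)
  refine hg.range_eq (isClosedGeodesic_blue _).2.2 (δ := δ) (u := -(δ * r₀) + u)
    (a := r₀ - min ε (t / 2)) (b := r₀ + min ε (t / 2)) hδ (by linarith) fun r hr => ?_
  have hv : |r - r₀| ≤ t / 2 := abs_le.2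
    ⟨by linarith [hr.1, min_le_right ε (t / 2)], by linarith [hr.2, min_le_right ε (t / 2)]⟩
  rw [hb r ⟨by linarith [hr.1, min_le_left ε (t / 2)], by linarith [hr.2, min_le_left ε (t / 2)]⟩
    (hs r)]
  have := hcurve r ⟨by linarith [(abs_le.1 hv).1], by linarith [(abs_le.1 hv).2]⟩
  simp only [hFdef] at this
  rw [this, ← pt_rot_zpow (perp_mem (by rwa [abs_mul, hσ, one_mul])), hpar _ hv]
  congr 1; ring

end

end
end RightAngled

namespace RightAngled
noncomputable section

open Real

set_option linter.unusedSectionVars false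

/-! ### Closed walks in the map -/

/-- A loop would be an embedded cycle of length 1. -/
lemma loopless_of_girth {D : Type*} {M : SurfaceMap D} {p q : ℕ} (hp : 3 ≤ p)
    (hM : M.HasType p q) (hg : M.GirthAtLeast p) : Loopless M q := by
  refine ⟨hM.1, fun d h => ?_⟩
  have := hg 1 (fun _ => d) ⟨one_pos, fun _ => h.symm, fun i j _ => Subsingleton.elim i j,
    fun _ _ => (M.rev_ne d).symm⟩
  omega

/-- A closed walk that never backtracks, except possibly at its base point, contains an embedded
cycle. -/
lemma le_length_of_walk {D : Type*} {M : SurfaceMap D} {p n : ℕ} (hg : M.GirthAtLeast p)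
    (hn : 0 < n) {u : ℕ → D} (hu : u n = u 0)
    (hc : ∀ i < n, M.SameVertex (M.rev (u i)) (u (i + 1)))
    (hb : ∀ i, i + 1 < n → u (i + 1) ≠ M.rev (u i)) : p ≤ n := by
  classical
  -- A closed subwalk of minimal length is an embedded cycle: its vertices are distinct by
  -- minimality, and an edge used in both directions would give a shorter closed subwalk or a
  -- backtrack inside the walk.
  have hex : ∃ m, 0 < m ∧ ∃ i, i + m ≤ n ∧ M.SameVertex (u i) (u (i + m)) :=
    ⟨n, hn, 0, by omega, by rw [zero_add, hu]; exact Equiv.Perm.SameCycle.refl _ _⟩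
  obtain ⟨hm, i, him, hi⟩ := Nat.find_spec hex
  set m := Nat.find hex with hmdef
  have hmin : ∀ a b, a < b → b < m → ¬ M.SameVertex (u (i + a)) (u (i + b)) := by
    intro a b hab hbm h
    refine Nat.find_min hex (m := b - a) (by omega) ⟨by omega, i + a, by omega, ?_⟩
    rwa [show i + a + (b - a) = i + b by omega]
  have : NeZero m := ⟨hm.ne'⟩
  have hedge : ∀ a b, a < b → b < m → u (i + a) ≠ M.rev (u (i + b)) := by
    intro a b hab hbm h
    have h' : M.rev (u (i + a)) = u (i + b) := by rw [h, M.rev_rev]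
    rcases Nat.lt_or_ge (a + 1) b with hlt | hge
    · have := hc (i + a) (by omega)
      rw [h'] at this
      exact hmin (a + 1) b hlt hbm this.symm
    · obtain rfl : b = a + 1 := by omega
      exact hb (i + a) (by omega) h'.symm
  refine (hg m (fun x => u (i + x.val)) ⟨hm, fun x => ?_, fun x y h => ?_, fun x y => ?_⟩).trans
    (by omega)
  · have hx := ZMod.val_lt x
    rcases Nat.lt_or_ge (x.val + 1) m with h | h
    · have e : (x + 1).val = x.val + 1 := by
        rw [ZMod.val_add_of_lt]
        · rw [ZMod.val_one'' (by omega)]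
        · rwa [ZMod.val_one'' (by omega)]
      simp only [e]
      exact hc (i + x.val) (by omega)
    · have e : x + 1 = 0 := by
        rw [← ZMod.natCast_zmod_val x, ← Nat.cast_one, ← Nat.cast_add,
          show x.val + 1 = m by omega, ZMod.natCast_self]
      simp only [e, ZMod.val_zero, add_zero]
      have := hc (i + x.val) (by omega)
      rw [show i + x.val + 1 = i + m by omega] at this
      exact this.trans hi.symm
  · have hx := ZMod.val_lt x
    have hy := ZMod.val_lt y
    rcases lt_trichotomy x.val y.val with h1 | h1 | h1
    · exact (hmin _ _ h1 hy h).elim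
    · exact ZMod.val_injective m h1
    · exact (hmin _ _ h1 hx h.symm).elim
  · have hx := ZMod.val_lt x
    have hy := ZMod.val_lt y
    rcases lt_trichotomy x.val y.val with h1 | h1 | h1
    · exact hedge _ _ h1 hy
    · simp only [h1]; exact (M.rev_ne _).symm
    · intro h
      refine hedge _ _ h1 hx ?_
      rw [h, M.rev_rev]

/-- A closed walk that backtracks at most once has length at least the girth. -/
lemma le_length_of_backtrack {D : Type*} {M : SurfaceMap D} {p n : ℕ} (hg : M.GirthAtLeast p)
    (hn : 0 < n) {w : ℕ → D} (hw : w n = w 0)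
    (hc : ∀ i < n, M.SameVertex (M.rev (w i)) (w (i + 1)))
    (hb : ∀ i < n, ∀ j < n, w (i + 1) = M.rev (w i) → w (j + 1) = M.rev (w j) → i = j) :
    p ≤ n := by
  have hv : ∀ i, w ((i + 1) % n) = w (i % n + 1) := by
    intro i
    have hi := Nat.mod_lt i hn
    rcases Nat.lt_or_ge (i % n + 1) n with h | h
    · rw [Nat.add_mod, Nat.mod_eq_of_lt (a := 1) (by omega), Nat.mod_eq_of_lt h]
    · have e : i % n + 1 = n := by omega
      rw [e, hw, Nat.add_mod, show i % n = n - 1 by omega]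
      rcases Nat.lt_or_ge 1 n with h1 | h1
      · rw [Nat.mod_eq_of_lt h1, show n - 1 + 1 = n by omega, Nat.mod_self]
      · obtain rfl : n = 1 := by omega
        simp
  obtain ⟨i₀, hi₀, hb'⟩ : ∃ i₀ < n, ∀ i < n, w (i + 1) = M.rev (w i) → i = i₀ := by
    by_cases h : ∃ i < n, w (i + 1) = M.rev (w i)
    · obtain ⟨i₀, h1, h2⟩ := h
      exact ⟨i₀, h1, fun i hi h => hb i hi i₀ h1 h h2⟩
    · push Not at h
      exact ⟨0, hn, fun i hi h' => (h i hi h').elim⟩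
  -- The walk is started just after the step i₀, so that its only possible backtrack is at the base
  -- point, where `le_length_of_walk` allows it.
  refine le_length_of_walk hg hn (u := fun i => w ((i + (i₀ + 1)) % n)) ?_ ?_ ?_
  · simp
  · intro i _
    rw [show i + 1 + (i₀ + 1) = i + (i₀ + 1) + 1 by ring, hv]
    exact hc _ (Nat.mod_lt _ hn)
  · intro i hi h
    rw [show i + 1 + (i₀ + 1) = i + (i₀ + 1) + 1 by ring, hv] at h
    have := hb' _ (Nat.mod_lt _ hn) h
    have h2 : i + (i₀ + 1) < 2 * n := by omega
    rcases Nat.lt_or_ge (i + (i₀ + 1)) n with h3 | h3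
    · rw [Nat.mod_eq_of_lt h3] at this; omega
    · rw [Nat.mod_eq_sub_mod h3, Nat.mod_eq_of_lt (by omega)] at this; omega

/-! ### Exits from the doubled polygons -/

variable {D : Type*} {M : SurfaceMap D} {q : ℕ} {t : ℝ} [G : Good q t]
variable {γ : ℝ → X M q t}

/-- At time `r`, the geodesic crosses the blue curve of `d` transversely, and leaves the doubled
polygon of the initial vertex of `d`. -/
def IsExit (γ : ℝ → X M q t) (r : ℝ) (d : D) : Prop :=
  ∃ ε o b c, IsLift γ r ε d o b c ∧ ∃ α < 0, ∀ r' ∈ Set.Ioo (r - ε) (r + ε),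
    blueH q t 0 (c r') = α * Real.sinh (r' - r)

lemma IsExit.add_period {ℓ : ℝ} (hper : Function.Periodic γ ℓ) {r : ℝ} {d : D}
    (h : IsExit γ r d) : IsExit γ (r + ℓ) d := by
  obtain ⟨ε, o, b, c, hc, α, hα, h⟩ := h
  have hs : ∀ r' ∈ Set.Ioo (r + ℓ - ε) (r + ℓ + ε), r' - ℓ ∈ Set.Ioo (r - ε) (r + ε) :=
    fun r' hr' => ⟨by linarith [hr'.1], by linarith [hr'.2]⟩
  refine ⟨ε, o, b, fun r' => c (r' - ℓ), ⟨hc.pos, fun x hx y hy => ?_, fun x hx => hc.mem _ (hs x hx),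
    fun x hx => ?_⟩, α, hα, fun x hx => ?_⟩
  · rw [hc.speed _ (hs x hx) _ (hs y hy)]; congr 1; ring
  · rw [← hc.eq _ (hs x hx), hper.sub_eq]
  · rw [h _ (hs x hx)]; congr 2; ring

section
variable [L : Loopless M q]

lemma IsExit.blueH_foldAt {r : ℝ} {d e : D} (h : IsExit γ r d) {k : ℤ} (hk : d = (M.rot ^ k) e) :
    γ r ∈ star M q t e ∧ blueH q t k (foldAt M q t e (γ r)) = 0 := by
  obtain ⟨ε, o, b, c, hc, α, hα, h⟩ := h
  have h0 : blueH q t 0 (c r) = 0 := by rw [h r hc.self_mem]; simp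
  have hs := (hc.mem_star_iff hk hc.self_mem).2 h0.ge
  refine ⟨hs, ?_⟩
  rw [hc.foldAt_eq hk hc.self_mem hs, blueH_symm, blueH_fold, h0, abs_zero]

/-- Seen from the polygon of `rev d` the lift is reflected in the blue line and its height becomes
positive: an exit is an entrance on the other side. -/
lemma IsExit.after {r : ℝ} {d : D} (h : IsExit γ r d) :
    blueH q t 0 (foldAt M q t (M.rev d) (γ r)) = 0 ∧ ∃ ε > 0, ∀ r' ∈ Set.Icc r (r + ε),
      γ r' ∈ star M q t (M.rev d) ∧
        (r < r' → 0 < blueH q t 0 (foldAt M q t (M.rev d) (γ r'))) := by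
  obtain ⟨ε, o, b, c, hc, α, hα, h⟩ := h
  have hk : M.rev d = (M.rot ^ (0 : ℤ)) (M.rev d) := by simp
  have key : ∀ r' ∈ Set.Ico r (r + ε), γ r' ∈ star M q t (M.rev d) ∧
      blueH q t 0 (foldAt M q t (M.rev d) (γ r')) = -α * Real.sinh (r' - r) := by
    intro r' hr'
    have m : r' ∈ Set.Ioo (r - ε) (r + ε) := ⟨by linarith [hr'.1, hc.pos], hr'.2⟩
    have hB : blueH q t 0 (blueRefl q t (c r')) = -α * Real.sinh (r' - r) := by
      rw [blueH_blueRefl, h r' m]; ring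
    have hnn : 0 ≤ -α * Real.sinh (r' - r) :=
      mul_nonneg (by linarith) (Real.sinh_nonneg_iff.2 (by linarith [hr'.1]))
    have hs := (hc.swap.mem_star_iff hk m).2 (by rw [hB]; exact hnn)
    refine ⟨hs, ?_⟩
    rw [hc.swap.foldAt_eq hk m hs, blueH_symm, blueH_fold, hB, abs_of_nonneg hnn]
  refine ⟨?_, ε / 2, half_pos hc.pos, fun r' hr' => ?_⟩
  · rw [(key r ⟨le_rfl, by linarith [hc.pos]⟩).2]; simp
  · obtain ⟨h1, h2⟩ := key r' ⟨hr'.1, by linarith [hr'.2, hc.pos]⟩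
    refine ⟨h1, fun hlt => ?_⟩
    rw [h2]
    exact mul_pos (by linarith) (Real.sinh_pos_iff.2 (by linarith))

/-- There is no exit while the geodesic stays in a doubled polygon. -/
lemma IsExit.not_mem_Ioo {r a b : ℝ} {d e : D} (h : IsExit γ r d)
    (hs : ∀ r' ∈ Set.Icc a b, γ r' ∈ star M q t e) : r ∉ Set.Ioo a b := by
  rintro ⟨h1, h2⟩
  obtain ⟨ε, o, c', c, hc, α, hα, h⟩ := h
  have hε := hc.pos
  obtain ⟨h', hh0, hh1, hh2, hh3⟩ : ∃ h' > 0, h' < ε ∧ h' ≤ r - a ∧ h' ≤ b - r :=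
    ⟨min (ε / 2) (min (r - a) (b - r)), lt_min (half_pos hε) (lt_min (by linarith) (by linarith)),
      (min_le_left _ _).trans_lt (half_lt_self hε), (min_le_right _ _).trans (min_le_left _ _),
      (min_le_right _ _).trans (min_le_right _ _)⟩
  have m1 : r - h' ∈ Set.Ioo (r - ε) (r + ε) := ⟨by linarith, by linarith⟩
  have m2 : r + h' ∈ Set.Ioo (r - ε) (r + ε) := ⟨by linarith, by linarith⟩
  have s1 := hs (r - h') ⟨by linarith, by linarith⟩
  have s2 := hs (r + h') ⟨by linarith, by linarith⟩
  have hsinh : 0 < Real.sinh h' := Real.sinh_pos_iff.2 hh0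
  have b1 : 0 < blueH q t 0 (c (r - h')) := by
    rw [h _ m1, show r - h' - r = -h' by ring, Real.sinh_neg]; nlinarith
  have b2 : blueH q t 0 (c (r + h')) < 0 := by
    rw [h _ m2, add_sub_cancel_left]; nlinarith
  rw [hc.eq _ m1] at s1
  rw [hc.eq _ m2] at s2
  -- Shortly before and after r the curve is strictly on different sides of an edge; one doubled
  -- polygon containing both would make the edge a loop.
  rcases chartMap_mem_star_cases (hc.mem _ m1) s1 with ⟨k, hk, -⟩ | ⟨k, hk, h3⟩
  · rcases chartMap_mem_star_cases (hc.mem _ m2) s2 with ⟨l, hl, h3⟩ | ⟨l, hl, -⟩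
    · linarith
    · exact not_rot_rev M q hk hl
  · linarith

/-- Just before r the geodesic is strictly inside one doubled polygon, so both darts start at the
same vertex. At time r the point is on the blue sides of both, and different blue sides are
disjoint. -/
lemma IsExit.unique {r : ℝ} {d d' : D} (h : IsExit γ r d) (h' : IsExit γ r d') : d = d' := by
  have hd' : d' = (M.rot ^ (0 : ℤ)) d' := by simp
  obtain ⟨hs, hb⟩ := h'.blueH_foldAt hd'
  have h0 := h
  obtain ⟨ε, o, b, c, hc, α, hα, h⟩ := h
  obtain ⟨ε', o', b', c', hc', α', hα', h'⟩ := h'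
  have hε := hc.pos
  have hε' := hc'.pos
  obtain ⟨η, hη0, hη1, hη2⟩ : ∃ η > 0, η < ε ∧ η < ε' :=
    ⟨min (ε / 2) (ε' / 2), lt_min (half_pos hε) (half_pos hε'),
      (min_le_left _ _).trans_lt (half_lt_self hε), (min_le_right _ _).trans_lt (half_lt_self hε')⟩
  have m1 : r - η ∈ Set.Ioo (r - ε) (r + ε) := ⟨by linarith, by linarith⟩
  have m2 : r - η ∈ Set.Ioo (r - ε') (r + ε') := ⟨by linarith, by linarith⟩
  have hsinh : 0 < Real.sinh η := Real.sinh_pos_iff.2 hη0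
  have b1 : 0 < blueH q t 0 (c (r - η)) := by
    rw [h _ m1, show r - η - r = -η by ring, Real.sinh_neg]; nlinarith
  have b2 : 0 < blueH q t 0 (c' (r - η)) := by
    rw [h' _ m2, show r - η - r = -η by ring, Real.sinh_neg]; nlinarith
  have s2 := (hc'.mem_star_iff hd' m2).2 b2.le
  rw [hc.eq _ m1] at s2
  rcases chartMap_mem_star_cases (hc.mem _ m1) s2 with ⟨k, hk, -⟩ | ⟨k, hk, h3⟩
  · have hbk := (h0.blueH_foldAt hk).2
    have := dvd_of_blueH (foldAt_mem hs).1 hb hbk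
    rw [hk, (rot_zpow_eq_iff M k d').2 this]
  · linarith

/-- A geodesic that is not contained in a doubled polygon exits from it. -/
lemma IsGeodesic.exists_exit (hγ : IsGeodesic M q t γ) {e : D} {a' a b : ℝ} (haa : a' < a)
    (hab : a ≤ b) (hs : ∀ r ∈ Set.Icc a' a, γ r ∈ star M q t e) (hb : γ b ∉ star M q t e) :
    ∃ r ≥ a, (∀ r' ∈ Set.Icc a' r, γ r' ∈ star M q t e) ∧
      ∃ (d : D) (k : ℤ), d = (M.rot ^ k) e ∧ IsExit γ r d := by
  set S := {r | a ≤ r ∧ γ r ∉ star M q t e} with hS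
  have hSne : S.Nonempty := ⟨b, hab, hb⟩
  -- The exit time is the infimum of the later times outside. The interval before a ensures that the
  -- geodesic is inside just before this time, even if it is a.
  have hSb : BddBelow S := ⟨a, fun r hr => hr.1⟩
  set r₁ := sInf S with hr₁
  have har : a ≤ r₁ := le_csInf hSne fun r hr => hr.1
  have hbefore : ∀ r, a' ≤ r → r < r₁ → γ r ∈ star M q t e := by
    intro r h1 h2
    rcases le_total r a with h3 | h3
    · exact hs r ⟨h1, h3⟩
    · by_contra h4
      exact (csInf_le hSb (show r ∈ S from ⟨h3, h4⟩)).not_gt h2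
  have hafter : ∀ η > 0, ∃ r, r₁ ≤ r ∧ r < r₁ + η ∧ γ r ∉ star M q t e := by
    intro η hη
    obtain ⟨r, hr, hlt⟩ := exists_lt_of_csInf_lt hSne (show sInf S < r₁ + η by linarith)
    exact ⟨r, csInf_le hSb hr, hlt, hr.2⟩
  obtain ⟨ε, d, k, o, b', c, hk, hc⟩ : ∃ (ε : ℝ) (d : D) (k : ℤ) (o b : Bool) (c : ℝ → ℍ),
      d = (M.rot ^ k) e ∧ IsLift γ r₁ ε d o b c := by
    obtain ⟨ε, d, o, b, c, hc⟩ := hγ.exists_isLift r₁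
    have hε := hc.pos
    have m : max a' (r₁ - ε / 2) ∈ Set.Ioo (r₁ - ε) (r₁ + ε) :=
      ⟨lt_max_of_lt_right (by linarith), max_lt (by linarith) (by linarith)⟩
    have h := hbefore _ (le_max_left a' (r₁ - ε / 2)) (max_lt (by linarith) (by linarith))
    rw [hc.eq _ m] at h
    rcases chartMap_mem_star_cases (hc.mem _ m) h with ⟨k, hk, -⟩ | ⟨k, hk, -⟩
    · exact ⟨ε, d, k, o, b, c, hk, hc⟩
    · exact ⟨ε, _, k, _, b, _, hk, hc.swap⟩
  have hε := hc.pos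
  have hcont := hc.continuousOn_blueH.continuousAt (Ioo_mem_nhds hc.self_mem.1 hc.self_mem.2)
  have h0 : blueH q t 0 (c r₁) = 0 := by
    rcases lt_trichotomy (blueH q t 0 (c r₁)) 0 with h | h | h
    · exfalso
      obtain ⟨η, hη, hh⟩ := Metric.eventually_nhds_iff.1 (hcont.eventually (gt_mem_nhds h))
      obtain ⟨r, hr1, hr2, hr3, hr4⟩ : ∃ r, r < r₁ ∧ r₁ - ε < r ∧ r₁ - η < r ∧ a' ≤ r :=
        ⟨max a' (max (r₁ - ε / 2) (r₁ - η / 2)), max_lt (by linarith) (max_lt (by linarith)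
          (by linarith)), lt_max_of_lt_right (lt_max_of_lt_left (by linarith)),
          lt_max_of_lt_right (lt_max_of_lt_right (by linarith)), le_max_left _ _⟩
      have := (hc.mem_star_iff hk (r := r) ⟨hr2, by linarith⟩).1 (hbefore r hr4 hr1)
      have := hh (y := r) (by rw [Real.dist_eq, abs_lt]; constructor <;> linarith)
      linarith
    · exact h
    · exfalso
      obtain ⟨η, hη, hh⟩ := Metric.eventually_nhds_iff.1 (hcont.eventually (lt_mem_nhds h))
      obtain ⟨r, hr1, hr2, hr3⟩ := hafter (min η ε) (lt_min hη hε)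
      have h1 := min_le_left η ε
      have h2 := min_le_right η ε
      refine hr3 ((hc.mem_star_iff hk ⟨by linarith, by linarith⟩).2 ?_)
      exact (hh (y := r) (by rw [Real.dist_eq, abs_lt]; constructor <;> linarith)).le
  obtain ⟨α, hα⟩ := hc.speed.exists_sinh hε (Λ := blueH q t 0) (isLinear_height _ _) h0
  -- With α ≥ 0 the geodesic would stay inside a little longer; in particular, running along the
  -- blue curve (α = 0) is not an exit.
  have hα0 : α < 0 := by
    by_contra hcon
    push Not at hcon
    obtain ⟨r, hr1, hr2, hr3⟩ := hafter ε hε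
    have m : r ∈ Set.Ioo (r₁ - ε) (r₁ + ε) := ⟨by linarith, hr2⟩
    refine hr3 ((hc.mem_star_iff hk m).2 ?_)
    rw [hα r m]
    exact mul_nonneg hcon (Real.sinh_nonneg_iff.2 (by linarith))
  refine ⟨r₁, har, fun r hr => ?_, d, k, hk, ε, o, b', c, hc, α, hα0, hα⟩
  rcases eq_or_lt_of_le hr.2 with rfl | h
  · exact (hc.mem_star_iff hk hc.self_mem).2 h0.ge
  · exact hbefore r hr.1 h

/-- The height over the blue line is nonzero at r or a multiple of a hyperbolic sine, so it has a
constant sign for a short time. This gives a doubled polygon in which the search for an exit can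
start. -/
lemma IsGeodesic.exists_star_right (hγ : IsGeodesic M q t γ) (r : ℝ) :
    ∃ (e : D) (ε : ℝ), 0 < ε ∧ ∀ r' ∈ Set.Icc r (r + ε), γ r' ∈ star M q t e := by
  obtain ⟨ε, d, o, b, c, hc⟩ := hγ.exists_isLift r
  have hε := hc.pos
  have hd : d = (M.rot ^ (0 : ℤ)) d := by simp
  have hd' : M.rev d = (M.rot ^ (0 : ℤ)) (M.rev d) := by simp
  obtain ⟨η, hη, h⟩ : ∃ η > 0, (∀ r' ∈ Set.Icc r (r + η), 0 ≤ blueH q t 0 (c r')) ∨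
      (∀ r' ∈ Set.Icc r (r + η), blueH q t 0 (c r') ≤ 0) := by
    have hcont := hc.continuousOn_blueH.continuousAt (Ioo_mem_nhds hc.self_mem.1 hc.self_mem.2)
    rcases lt_trichotomy (blueH q t 0 (c r)) 0 with h | h | h
    · obtain ⟨η, hη, hh⟩ := Metric.eventually_nhds_iff.1 (hcont.eventually (gt_mem_nhds h))
      exact ⟨η / 2, half_pos hη, Or.inr fun r' hr' => (hh (by
        rw [Real.dist_eq, abs_lt]; constructor <;> linarith [hr'.1, hr'.2])).le⟩
    · obtain ⟨α, hα⟩ := hc.speed.exists_sinh hε (Λ := blueH q t 0) (isLinear_height _ _) h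
      refine ⟨ε / 2, half_pos hε, ?_⟩
      have key : ∀ r' ∈ Set.Icc r (r + ε / 2), blueH q t 0 (c r') = α * Real.sinh (r' - r) ∧
          0 ≤ Real.sinh (r' - r) := fun r' hr' =>
        ⟨hα r' ⟨by linarith [hr'.1], by linarith [hr'.2]⟩,
          Real.sinh_nonneg_iff.2 (by linarith [hr'.1])⟩
      rcases le_total 0 α with h' | h'
      · left; intro r' hr'; rw [(key r' hr').1]; exact mul_nonneg h' (key r' hr').2
      · right; intro r' hr'; rw [(key r' hr').1]
        exact mul_nonpos_of_nonpos_of_nonneg h' (key r' hr').2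
    · obtain ⟨η, hη, hh⟩ := Metric.eventually_nhds_iff.1 (hcont.eventually (lt_mem_nhds h))
      exact ⟨η / 2, half_pos hη, Or.inl fun r' hr' => (hh (by
        rw [Real.dist_eq, abs_lt]; constructor <;> linarith [hr'.1, hr'.2])).le⟩
  have m : ∀ r' ∈ Set.Icc r (r + min η (ε / 2)), r' ∈ Set.Ioo (r - ε) (r + ε) ∧
      r' ∈ Set.Icc r (r + η) := fun r' hr' =>
    ⟨⟨by linarith [hr'.1], by linarith [hr'.2, min_le_right η (ε / 2)]⟩,
      ⟨hr'.1, by linarith [hr'.2, min_le_left η (ε / 2)]⟩⟩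
  rcases h with h | h
  · exact ⟨d, min η (ε / 2), lt_min hη (half_pos hε), fun r' hr' =>
      (hc.mem_star_iff hd (m r' hr').1).2 (h r' (m r' hr').2)⟩
  · refine ⟨M.rev d, min η (ε / 2), lt_min hη (half_pos hε), fun r' hr' =>
      (hc.swap.mem_star_iff hd' (m r' hr').1).2 ?_⟩
    rw [blueH_blueRefl]
    have := h r' (m r' hr').2
    linarith only [this]

/-- Consecutive exits of a geodesic. -/
structure NextExit (γ : ℝ → X M q t) (r : ℝ) (d : D) (r' : ℝ) (d' : D) : Prop where
  lt : r < r'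
  exit : IsExit γ r' d'
  star : ∀ x ∈ Set.Icc r r', γ x ∈ star M q t (M.rev d)
  sameVertex : M.SameVertex (M.rev d) d'
  backtrack : d' = M.rev d → t < r' - r
  le_length : d' ≠ M.rev d → s q t ≤ r' - r
  length_eq : d' ≠ M.rev d → r' - r = s q t → ∃ d, (∀ p : ℕ, 0 < p →
    ((M.rev * M.rot) ^ p) d = d → Set.range γ = redCurve M q t d)

lemma IsGeodesic.exists_nextExit (hγ : IsGeodesic M q t γ)
    (hout : ∀ (e : D) (a : ℝ), ∃ b ≥ a, γ b ∉ RightAngled.star M q t e) {r : ℝ} {d : D}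
    (h : IsExit γ r d) : ∃ r' d', NextExit γ r d r' d' := by
  obtain ⟨h0, ε, hε, hs⟩ := h.after
  obtain ⟨b, hab, hb⟩ := hout (M.rev d) (r + ε)
  obtain ⟨r', hr', hs', d', k, hk, hx⟩ := hγ.exists_exit (a' := r) (a := r + ε) (by linarith) hab
    (fun x hx => (hs x hx).1) hb
  have hlt : r < r' := by linarith
  obtain ⟨-, h1⟩ := hx.blueH_foldAt hk
  have hdvd : d' = M.rev d ↔ (q : ℤ) ∣ k := by rw [hk, rot_zpow_eq_iff (q := q) M]
  refine ⟨r', d', hlt, hx, hs', ⟨k, hk.symm⟩, fun hd => ?_, fun hd => ?_, fun hd => ?_⟩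
  · obtain ⟨n, hn⟩ := hdvd.1 hd
    refine hγ.arc_backtrack hlt hs' h0 ?_ ⟨r + ε, ⟨by linarith, hr'⟩,
      (hs (r + ε) ⟨by linarith, le_rfl⟩).2 (by linarith)⟩
    have := blueH_add_mul (q := q) (t := t) 0 n (foldAt M q t (M.rev d) (γ r'))
    rw [← this, zero_add, ← hn, h1]
  · exact (hγ.arc_blue hlt hs' h0 h1 (fun h => hd (hdvd.2 h))).1
  · exact (hγ.arc_blue hlt hs' h0 h1 (fun h => hd (hdvd.2 h))).2

/-- A closed geodesic that is not contained in a doubled polygon has a finite cyclic sequence of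
exits. -/
lemma IsClosedGeodesic.exists_exits {ℓ : ℝ} (hγ : IsClosedGeodesic M q t ℓ γ)
    (hout : ∀ e, ∃ r, γ r ∉ RightAngled.star M q t e) (hst : s q t ≤ t) :
    ∃ (n : ℕ) (ρ : ℕ → ℝ) (w : ℕ → D), 0 < n ∧ ρ n = ρ 0 + ℓ ∧ w n = w 0 ∧
      ∀ k, NextExit γ (ρ k) (w k) (ρ (k + 1)) (w (k + 1)) := by
  obtain ⟨hℓ, hper, hg⟩ := hγ
  have hs := s_pos q t
  have hout' : ∀ (e : D) (a : ℝ), ∃ b ≥ a, γ b ∉ RightAngled.star M q t e := by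
    intro e a
    obtain ⟨r, hr⟩ := hout e
    obtain ⟨y, hy, e'⟩ := hper.exists_mem_Ico hℓ r a
    exact ⟨y, hy.1, by rwa [← e']⟩
  obtain ⟨r₀, d₀, h₀⟩ : ∃ r d, IsExit γ r d := by
    obtain ⟨e, ε, hε, he⟩ := hg.exists_star_right 0
    obtain ⟨b, hab, hb⟩ := hout' e (0 + ε)
    obtain ⟨r, -, -, d, -, -, hd⟩ := hg.exists_exit (by linarith) hab he hb
    exact ⟨r, d, hd⟩
  have hnext : ∀ x : {x : ℝ × D // IsExit γ x.1 x.2}, ∃ y : {x : ℝ × D // IsExit γ x.1 x.2},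
      NextExit γ x.1.1 x.1.2 y.1.1 y.1.2 := by
    rintro ⟨⟨r, d⟩, h⟩
    obtain ⟨r', d', h'⟩ := hg.exists_nextExit hout' h
    exact ⟨⟨(r', d'), h'.exit⟩, h'⟩
  choose f hf using hnext
  set x : ℕ → {x : ℝ × D // IsExit γ x.1 x.2} := fun n => f^[n] ⟨(r₀, d₀), h₀⟩ with hx
  have hstep : ∀ k, NextExit γ (x k).1.1 (x k).1.2 (x (k + 1)).1.1 (x (k + 1)).1.2 := by
    intro k
    simp only [hx, Function.iterate_succ_apply']
    exact hf _
  have hgap : ∀ k, s q t ≤ (x (k + 1)).1.1 - (x k).1.1 := by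
    intro k
    by_cases hb : (x (k + 1)).1.2 = M.rev (x k).1.2
    · exact hst.trans ((hstep k).backtrack hb).le
    · exact (hstep k).le_length hb
  -- The exits do not accumulate, because consecutive ones are at least s(t) apart.
  have hgrow : ∀ k : ℕ, r₀ + k * s q t ≤ (x k).1.1 := by
    intro k
    induction k with
    | zero => simp [hx]
    | succ k ih => have := hgap k; push_cast; linarith
  have hex : ∃ n, r₀ + ℓ ≤ (x n).1.1 := by
    obtain ⟨n, hn⟩ := exists_nat_gt (ℓ / s q t)
    rw [div_lt_iff₀ hs] at hn
    exact ⟨n, by linarith [hgrow n]⟩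
  classical
  set n := Nat.find hex with hn
  have hn1 : r₀ + ℓ ≤ (x n).1.1 := Nat.find_spec hex
  have hx0 : x 0 = ⟨(r₀, d₀), h₀⟩ := rfl
  have hnpos : 0 < n := by
    rcases Nat.eq_zero_or_pos n with h | h
    · rw [h, hx0] at hn1; simp only at hn1; linarith
    · exact h
  -- The initial exit recurs after one period, and there is no exit strictly between consecutive
  -- ones; so the sequence hits the time r₀ + ℓ exactly, with the same dart.
  have hexit := h₀.add_period hper
  have heq : (x n).1.1 = r₀ + ℓ := by
    refine le_antisymm ?_ hn1
    by_contra hlt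
    push Not at hlt
    have h1 := Nat.find_min hex (m := n - 1) (by omega)
    push Not at h1
    have h2 := hstep (n - 1)
    rw [Nat.sub_add_cancel hnpos] at h2
    exact hexit.not_mem_Ioo h2.star ⟨h1, hlt⟩
  refine ⟨n, fun k => (x k).1.1, fun k => (x k).1.2, hnpos, heq, ?_, hstep⟩
  have := (x n).2
  rw [heq] at this
  exact this.unique hexit

/-- The length of the closed geodesics. -/
lemma IsClosedGeodesic.two_mul_le {p : ℕ} (hp : 3 ≤ p) (hM : M.HasType p q)
    (hgirth : M.GirthAtLeast p) (h2t : 2 * t = p * s q t) {ℓ : ℝ}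
    (hγ : IsClosedGeodesic M q t ℓ γ) : 2 * t ≤ ℓ ∧ (ℓ = 2 * t →
      (∃ d, Set.range γ = blueCurve M q t d) ∨ ∃ d, Set.range γ = redCurve M q t d) := by
  by_cases hstar : ∃ e, ∀ r, γ r ∈ RightAngled.star M q t e
  · obtain ⟨e, he⟩ := hstar
    obtain ⟨h1, h2⟩ := hγ.of_star he
    exact ⟨h1, fun h => Or.inl (h2 h)⟩
  push Not at hstar
  have hs := s_pos q t
  have hp' : (3 : ℝ) ≤ p := by exact_mod_cast hp
  have hst : s q t < t := by nlinarith
  obtain ⟨n, ρ, w, hn, hρ, hw, hstep⟩ := hγ.exists_exits hstar hst.le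
  have hgap : ∀ k, s q t ≤ ρ (k + 1) - ρ k := by
    intro k
    by_cases hb : w (k + 1) = M.rev (w k)
    · exact hst.le.trans ((hstep k).backtrack hb).le
    · exact (hstep k).le_length hb
  have hmono : Monotone ρ := monotone_nat_of_le_succ fun k => (hstep k).lt.le
  -- Two backtracking arcs alone are longer than 2t, so otherwise at most one step backtracks and
  -- the girth bounds the number of steps.
  by_cases hb : ∃ k l, k < l ∧ l < n ∧ w (k + 1) = M.rev (w k) ∧ w (l + 1) = M.rev (w l)
  · obtain ⟨k, l, hkl, hln, hk, hl⟩ := hb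
    have h1 := (hstep k).backtrack hk
    have h2 := (hstep l).backtrack hl
    have h3 := hmono (Nat.zero_le k)
    have h4 := hmono (show k + 1 ≤ l by omega)
    have h5 := hmono (show l + 1 ≤ n by omega)
    have : 2 * t < ℓ := by linarith
    exact ⟨this.le, fun h => by linarith⟩
  · push Not at hb
    have hpn : p ≤ n := by
      refine le_length_of_backtrack hgirth hn hw (fun i _ => (hstep i).sameVertex) ?_
      intro i hi j hj h1 h2
      rcases lt_trichotomy i j with h | h | h
      · exact (hb i j h hj h1 h2).elim
      · exact h
      · exact (hb j i h hi h2 h1).elim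
    have hgrow : ∀ k : ℕ, ρ 1 + k * s q t ≤ ρ (k + 1) := by
      intro k
      induction k with
      | zero => simp
      | succ k ih => have := hgap (k + 1); push_cast; linarith
    have h1 := hgrow (n - 1)
    rw [Nat.sub_add_cancel hn, Nat.cast_sub hn, hρ] at h1
    have hpn' : (p : ℝ) ≤ n := by exact_mod_cast hpn
    have h2 := hgap 0
    have h3 : (p : ℝ) * s q t ≤ n * s q t := mul_le_mul_of_nonneg_right hpn' hs.le
    push_cast at h1
    refine ⟨by linarith, fun h => Or.inr ?_⟩
    -- With total length 2t = p s(t) there is no slack, so already the arc between exits 0 and 1 is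
    -- as short as possible; it does not backtrack since s(t) < t, and so is a red side.
    have h4 : ρ (0 + 1) - ρ 0 = s q t := by
      simp only [zero_add] at h2 ⊢
      linarith
    have hnb : w (0 + 1) ≠ M.rev (w 0) := fun hb => by
      have := (hstep 0).backtrack hb
      linarith
    obtain ⟨d, hd⟩ := (hstep 0).length_eq hnb h4
    refine ⟨d, hd p (by omega) ?_⟩
    have := Function.isPeriodicPt_minimalPeriod (M.rev * M.rot : Equiv.Perm D) d
    rw [hM.2 d] at this
    rw [← Equiv.Perm.iterate_eq_pow]
    exact this

end

end
end RightAngled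

namespace RightAngled
noncomputable section

open Real

set_option linter.unusedSectionVars false

/-! ### The complement of the blue and red curves -/

variable {D : Type*} {M : SurfaceMap D} {q : ℕ} {t : ℝ} [G : Good q t]

/-- The open polygon. -/
def openPolygon (q : ℕ) (t : ℝ) : Set ℍ :=
  {z | ∀ k : ℤ, 0 < blueH q t k z ∧ 0 < redH q t k z}

lemma core_of_openPolygon {z : ℍ} (hz : z ∈ openPolygon q t) : Core q t z :=
  ⟨mem_polygon.2 fun k => ⟨(hz k).1.le, (hz k).2.le⟩, fun k _ _ => hz k⟩

lemma isOpen_openPolygon : IsOpen (openPolygon q t) := by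
  have : openPolygon q t = ⋂ k ∈ Finset.range q, {z | 0 < blueH q t (k : ℤ) z} ∩
      {z | 0 < redH q t (k : ℤ) z} := by
    ext z
    simp only [openPolygon, Set.mem_ofPred_eq, Set.mem_iInter, Finset.mem_range, Set.mem_inter_iff]
    refine ⟨fun h k _ => h k, fun h k => ?_⟩
    obtain ⟨j, hj, n, rfl⟩ := exists_nat_index G.three_le k
    rw [blueH_add_mul, redH_add_mul]
    exact h j hj
  rw [this]
  exact isOpen_biInter_finset fun k _ => (isOpen_lt continuous_const (continuous_height _ _)).inter
    (isOpen_lt continuous_const (continuous_height _ _))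

lemma turn_mem_openPolygon {z : ℍ} (hz : z ∈ openPolygon q t) (k : ℤ) :
    turn q k z ∈ openPolygon q t := by
  intro j
  rw [blueH_turn, redH_turn]
  exact hz _

/-- Half-planes that contain `i` are star-shaped about `i`. -/
lemma height_pos_of_scale {a θ l : ℝ} (ha : 0 < Real.sinh a) (h0 : 0 ≤ l) (h1 : l ≤ 1) {z w : ℍ}
    (hX : cX w = l * cX z) (hY : cY w = l * cY z) (hz : 0 < height a θ z) : 0 < height a θ w := by
  rcases h0.eq_or_lt with rfl | h0
  · unfold height
    rw [hX, hY]
    have := mul_pos (cT_pos w) ha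
    simpa using this
  -- Scaling the space coordinates by l ≤ 1 shrinks the time coordinate by a factor no smaller than
  -- l, because of the constant 1 in its square.
  · have hT : l * cT z ≤ cT w := by
      refine le_of_sq_le_sq ?_ (cT_pos w).le
      rw [mul_pow, cT_sq, cT_sq, hX, hY]
      nlinarith [cT_sq z]
    have := mul_pos h0 hz
    unfold height at this ⊢
    rw [hX, hY]
    nlinarith

/-- In the space coordinates the open polygon is star-shaped about its centre, as an intersection of
half-planes that contain it. -/
instance contractibleSpace_openPolygon : ContractibleSpace (openPolygon q t) := by
  have hstar : StarConvex ℝ (0 : ℝ × ℝ) (coordHomeo '' openPolygon q t) := by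
    rintro _ ⟨z, hz, rfl⟩ a b ha hb hab
    refine ⟨ofXY (b * cX z) (b * cY z), fun k => ?_, ?_⟩
    · exact ⟨height_pos_of_scale (blueRelations q t).sinh_pos hb (by linarith) (cX_ofXY _ _)
        (cY_ofXY _ _) (hz k).1, height_pos_of_scale (redRelations q t).sinh_pos hb (by linarith)
        (cX_ofXY _ _) (cY_ofXY _ _) (hz k).2⟩
    · show (cX _, cY _) = a • (0 : ℝ × ℝ) + b • (cX z, cY z)
      simp
  have hI : UpperHalfPlane.I ∈ openPolygon q t := by
    intro k
    simp only [blueH, redH, height, cX_I, cY_I, cT_I, one_mul, zero_mul, add_zero, mul_zero,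
      sub_zero]
    exact ⟨(blueRelations q t).sinh_pos, (redRelations q t).sinh_pos⟩
  have := hstar.contractibleSpace ⟨_, _, hI, rfl⟩
  exact (coordHomeo.image (openPolygon q t)).contractibleSpace

variable (M q t) in
/-- The complement of the blue and red curves. -/
def complement : Set (X M q t) :=
  (⋃₀ (Set.range (blueCurve M q t) ∪ Set.range (redCurve M q t)))ᶜ

variable (M q t) in
/-- The image of an open polygon. -/
def cell (d : D) (b : Bool) : Set (X M q t) := pt M q t d false b '' openPolygon q t

lemma mem_cell_of_mem_complement {x : X M q t} (hx : x ∈ complement M q t) :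
    ∃ d b, x ∈ cell M q t d b := by
  obtain ⟨d, b, z, hz, rfl⟩ := exists_pt x
  refine ⟨d, b, z, fun k => ?_, rfl⟩
  have hzk := turn_mem hz (-k)
  have e : pt M q t d false b z = pt M q t ((M.rot ^ k) d) false b (turn q (-k) z) := by
    rw [pt_rot_zpow hzk, turn_turn]; simp
  refine ⟨lt_of_le_of_ne (mem_polygon.1 hz k).1 fun h => hx ?_,
    lt_of_le_of_ne (mem_polygon.1 hz k).2 fun h => hx ?_⟩
  · obtain ⟨u, hu, h'⟩ := exists_perp hzk (by rw [blueH_turn, sub_neg_eq_add, zero_add, ← h])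
    exact ⟨_, Or.inl ⟨(M.rot ^ k) d, rfl⟩, b, u, ⟨_, hzk⟩, hu, h', by rw [e, pt_false hzk]⟩
  · obtain ⟨u, hu, h'⟩ := exists_redSide hzk (by rw [redH_turn, sub_neg_eq_add, zero_add, ← h])
    exact ⟨_, Or.inr ⟨(M.rot ^ k) d, rfl⟩, (M.rot ^ k) d, b, u, ⟨_, hzk⟩,
      Equiv.Perm.SameCycle.refl _ _, hu, h', by rw [e, pt_false hzk]⟩

section
variable [L : Loopless M q]

/-- The points of an open polygon are identified only through rotations. -/
lemma eq_turn_of_pt_eq {d e : D} {b c : Bool} {z w : ℍ} (hz : z ∈ openPolygon q t)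
    (hw : w ∈ polygon q t) (h : pt M q t d false b z = pt M q t e false c w) :
    b = c ∧ ∃ k : ℤ, e = (M.rot ^ k) d ∧ z = turn q k w := by
  rcases pt_eq_pt (core_of_openPolygon hz).1 hw h with ⟨k, h1, h2, h3⟩ | ⟨j, k, h1, -⟩
  · refine ⟨?_, k, h1, h2⟩
    rcases h3 with h3 | ⟨m, h3⟩
    · exact h3
    · exact ((hz m).2.ne' h3).elim
  · exact ((hz j).1.ne' h1).elim

lemma cell_subset_complement (d : D) (b : Bool) : cell M q t d b ⊆ complement M q t := by
  rintro _ ⟨z, hz, rfl⟩ ⟨_, ⟨e, rfl⟩ | ⟨e, rfl⟩, h⟩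
  · obtain ⟨c, u, ⟨w, hw⟩, hu, h1, h2⟩ := h
    rw [← pt_false hw] at h2
    obtain ⟨-, k, -, rfl⟩ := eq_turn_of_pt_eq hz hw h2
    have := (hz k).1
    simp only at h1
    rw [blueH_turn, sub_self, h1, blueSide, blueH_zero_perp] at this
    exact lt_irrefl _ this
  · obtain ⟨e', c, u, ⟨w, hw⟩, -, hu, h1, h2⟩ := h
    rw [← pt_false hw] at h2
    obtain ⟨-, k, -, rfl⟩ := eq_turn_of_pt_eq hz hw h2
    have := (hz k).2
    simp only at h1
    rw [redH_turn, sub_self, h1, redH_zero_redSide] at this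
    exact lt_irrefl _ this

lemma cell_eq_chartMap (d : D) (b : Bool) :
    cell M q t d b = chartMap M q t d false b '' openPolygon q t :=
  Set.image_congr fun _ hz => (chartMap_core (core_of_openPolygon hz) d false b).symm

lemma openPolygon_subset_U : openPolygon q t ⊆ U q t := fun _ hz =>
  mem_U_of_core (core_of_openPolygon hz)

lemma isOpen_cell (d : D) (b : Bool) : IsOpen (cell M q t d b) := by
  rw [cell_eq_chartMap]
  exact isOpen_chartMap_image d false b openPolygon_subset_U isOpen_openPolygon

/-- Interior points are identified only by rotations of one polygon, so cells that meet belong to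
the same vertex and the same copy. -/
lemma cell_eq_of_not_disjoint {d e : D} {b c : Bool}
    (h : ¬ Disjoint (cell M q t d b) (cell M q t e c)) : cell M q t e c ⊆ cell M q t d b := by
  rw [Set.not_disjoint_iff] at h
  obtain ⟨_, ⟨z, hz, rfl⟩, w, hw, h⟩ := h
  obtain ⟨rfl, k, rfl, -⟩ := eq_turn_of_pt_eq hz (core_of_openPolygon hw).1 h.symm
  rintro _ ⟨v, hv, rfl⟩
  exact ⟨turn q k v, turn_mem_openPolygon hv k, (pt_rot_zpow (core_of_openPolygon hv).1 d b k).symm⟩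

lemma isOpenEmbedding_cell (d : D) (b : Bool) :
    Topology.IsOpenEmbedding fun z : openPolygon q t => chartMap M q t d false b z := by
  refine Topology.IsOpenEmbedding.of_continuous_injective_isOpenMap ?_ ?_ ?_
  · exact ((continuousOn_chartMap d false b).mono openPolygon_subset_U).domRestrict
  · intro z w h
    exact Subtype.ext (injOn_chartMap (M := M) (t := t) d false b (openPolygon_subset_U z.2)
      (openPolygon_subset_U w.2) h)
  · intro V hV
    have e : (fun z : openPolygon q t => chartMap M q t d false b z) '' V =
        chartMap M q t d false b '' (Subtype.val '' V) := by
      rw [Set.image_image]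
    rw [e]
    refine isOpen_chartMap_image d false b ?_
      (isOpen_openPolygon.isOpenEmbedding_subtypeVal.isOpenMap V hV)
    rintro _ ⟨z, -, rfl⟩
    exact openPolygon_subset_U z.2

lemma range_cell (d : D) (b : Bool) :
    Set.range (fun z : openPolygon q t => chartMap M q t d false b z) = cell M q t d b := by
  rw [cell_eq_chartMap, Set.image_eq_range]

lemma contractibleSpace_cell (d : D) (b : Bool) : ContractibleSpace (cell M q t d b) := by
  rw [← range_cell]
  exact (isOpenEmbedding_cell d b).isEmbedding.toHomeomorph.symm.contractibleSpace

/-- The cells are open and connected, cover the complement and are pairwise equal or disjoint, so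
they are its components. -/
lemma connectedComponentIn_complement {x : X M q t} {d : D} {b : Bool} (hx : x ∈ cell M q t d b) :
    connectedComponentIn (complement M q t) x = cell M q t d b := by
  have hconn : IsPreconnected (cell M q t d b) := by
    rw [← range_cell]
    exact isPreconnected_range (isOpenEmbedding_cell d b).continuous
  apply Set.Subset.antisymm
  · set W := ⋃ (p : D × Bool) (_ : Disjoint (cell M q t d b) (cell M q t p.1 p.2)),
      cell M q t p.1 p.2 with hW
    refine isPreconnected_connectedComponentIn.subset_left_of_subset_union (isOpen_cell d b)
      (v := W) (isOpen_iUnion fun p => isOpen_iUnion fun _ => isOpen_cell _ _) ?_ ?_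
      ⟨x, mem_connectedComponentIn (cell_subset_complement d b hx), hx⟩
    · simp only [hW, Set.disjoint_iUnion_right]
      exact fun _ h => h
    · intro y hy
      obtain ⟨e, c, hc⟩ := mem_cell_of_mem_complement (connectedComponentIn_subset _ _ hy)
      by_cases hd : Disjoint (cell M q t d b) (cell M q t e c)
      · exact Or.inr (Set.mem_iUnion₂.2 ⟨(e, c), hd, hc⟩)
      · exact Or.inl (cell_eq_of_not_disjoint hd hc)
  · exact hconn.subset_connectedComponentIn hx (cell_subset_complement d b)

lemma fills_blue_red :
    Fills (Set.range (blueCurve M q t) ∪ Set.range (redCurve M q t)) := by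
  intro x hx
  obtain ⟨d, b, h⟩ := mem_cell_of_mem_complement hx
  have := contractibleSpace_cell (M := M) (q := q) (t := t) d b
  rw [← connectedComponentIn_complement h] at this
  exact this

end

end
end RightAngled

/-! ### The theorem on the systoles -/

theorem mainTheorem3 {D : Type*} [Finite D] (p q : ℕ) (hp : 3 ≤ p) (hq : 3 ≤ q)
    (M : SurfaceMap D) (hM : M.HasType p q) (hgirth : M.GirthAtLeast p)
    (t₀ : ℝ) (ht₀ : 0 < t₀) (h : 2 * t₀ = p * RightAngled.s q t₀) :
    RightAngled.systoles M q t₀ =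
        Set.range (RightAngled.blueCurve M q t₀) ∪ Set.range (RightAngled.redCurve M q t₀) ∧
      (∀ L γ, RightAngled.IsSystole M q t₀ L γ → L = 2 * t₀) ∧
      RightAngled.Fills (RightAngled.systoles M q t₀) := by
  have : RightAngled.Good q t₀ := ⟨hq, ht₀⟩
  have : RightAngled.Loopless M q := RightAngled.loopless_of_girth hp hM hgirth
  have hmin : ∀ L γ, RightAngled.IsClosedGeodesic M q t₀ L γ → 2 * t₀ ≤ L := fun L γ hγ =>
    (hγ.two_mul_le hp hM hgirth h).1
  have hlen : ∀ L γ, RightAngled.IsSystole M q t₀ L γ → L = 2 * t₀ := by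
    rintro L γ ⟨hγ, hL⟩
    -- Any point of the surface provides a dart, whose blue curve is a competitor of length 2 t₀.
    obtain ⟨d, -⟩ := RightAngled.exists_pt (γ 0)
    exact le_antisymm (hL _ _ (RightAngled.isClosedGeodesic_blue d)) (hmin L γ hγ)
  have hsys : RightAngled.systoles M q t₀ =
      Set.range (RightAngled.blueCurve M q t₀) ∪ Set.range (RightAngled.redCurve M q t₀) := by
    ext C
    constructor
    · rintro ⟨L, γ, hγ, rfl⟩
      rcases (hγ.1.two_mul_le hp hM hgirth h).2 (hlen L γ hγ) with ⟨d, hd⟩ | ⟨d, hd⟩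
      · exact Or.inl ⟨d, hd.symm⟩
      · exact Or.inr ⟨d, hd.symm⟩
    · rintro (⟨d, rfl⟩ | ⟨d, rfl⟩)
      · exact ⟨2 * t₀, _, ⟨RightAngled.isClosedGeodesic_blue d, hmin⟩,
          RightAngled.range_blueGeodesic d⟩
      · have hd : ((M.rev * M.rot) ^ p) d = d := by
          have := Function.isPeriodicPt_minimalPeriod (M.rev * M.rot : Equiv.Perm D) d
          rw [hM.2 d] at this
          rw [← Equiv.Perm.iterate_eq_pow]
          exact this
        refine ⟨2 * t₀, _, ⟨?_, hmin⟩, RightAngled.range_redGeodesic d⟩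
        rw [h]
        exact RightAngled.isClosedGeodesic_red d (by omega) hd
  refine ⟨hsys, hlen, ?_⟩
  rw [hsys]
  exact RightAngled.fills_blue_red
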